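/- Let $\mathbb{H}^2$ be the hyperbolic plane of curvature $-1$ in the upper half-plane model, and let $w>0$. The *prototile* is $B=\{x+iy : -w\le x\le w,\ 1\le y\le 2\}$, regarded as a pentagon with vertices $\pm w+2i,\ \pm w+i,\ i$ and with five edges: the horocyclic edges $a=\{-w\le x\le w,\ y=2\}$, $b_1=\{-w\le x\le 0,\ y=1\}$, $b_2=\{0\le x\le w,\ y=1\}$ (all of length $w$) and the two straight edges $c$ on $x=\pm w$, oriented from $a$ towards the $b$-edges. Copies of $B$ under isometries carry the corresponding vertices and edges; the labels $b_1,b_2$ are transported by the orientation-preserving isometry that moves $B$ to the copy. A *B-tiling* is a set $\mathcal T$ of isometric copies of $B$ (tiles) that cover $\mathbb{H}^2$ and have pairwise disjoint interiors, such that any non-empty intersection of two different tiles is a common edge or a common vertex, and such that the orientations of shared $c$-edges agree. - A *ring* is a set $\{T_i : i\in\mathbb Z\}$ of pairwise different tiles such that $T_i$ and $T_{i+1}$ share a $c$-edge for all $i$; then $\{T_i : i\ge 0\}$ is a *half ring*. Rings $R_0,\dots,R_{k-1}$ are *consecutive* if for every $0\le j<k-1$ the $a$-edge of some tile of $R_j$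 is a $b$-edge of some tile of $R_{j+1}$. - Two tiles are *linked* if they are joined by a finite sequence of pairwise different tiles in which successive tiles share an edge that is not a $c$-edge. A *pool* is the set of all tiles linked with a given tile. - The *tail* of a tile $T$ is the sequence of pairwise different tiles $T=T_0,T_1,T_2,\dots$ such that the $a$-edge of $T_{i-1}$ is a $b$-edge of $T_i$ for all $i\ge1$. Its sequence $s(T)=(s_1,s_2,\dots)$ has $s_i=1$ if the $a$-edge of $T_{i-1}$ is the $b_1$-edge of $T_i$, and $s_i=-1$ if it is the $b_2$-edge. - A sequence $s$ is *periodic* if $s_{i+p}=s_i$ for all $i\geq 1$, for some $p\ge1$; let $p$ be the least such number. The *essential period* of $s$ is $p/2$ if $p$ is even and $s_{i+p/2}=-s_i$ for all $i\ge 1$, and $p$ otherwise. - $\mathrm{Sym}(\mathcal T)$ is the group of all isometries $\varphi$ of $\mathbb{H}^2$ with $\varphi(\mathcal T)=\mathcal T$. A *fundamental domain* of a group $\Gamma$ of isometries is a set $F\subseteq\mathbb{H}^2$ whose interior is non-empty and connected, which is the closure of its interior, whose images $\gamma F$ ($\gamma\in\Gamma$) cover $\mathbb{H}^2$, and for which $\gamma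 F$ and $\delta F$ have disjoint interiors whenever $\gamma\ne\delta$ in $\Gamma$. Let $\mathcal T$ be a B-tiling of $\mathbb{H}^2$. Then: 1. If $\mathcal T$ has exactly two pools, the union of the tiles of some half ring is a fundamental domain of $\mathrm{Sym}(\mathcal T)$. More precisely, for every ring $R$ and every pool $P$ the set $R\cap P$ is a half ring, and the union of its tiles is a fundamental domain. 2. If $\mathcal T$ has exactly one pool and $s(T)$ is periodic for some tile $T$, let $k$ be the essential period of $s(T)$. Then there are $k$ consecutive rings, and for any $k$ consecutive rings the union of all their tiles is a fundamental domain of $\mathrm{Sym}(\mathcal T)$. 3. In all other cases $\mathbb{H}^2$ itself is a fundamental domain of $\mathrm{Sym}(\mathcal T)$. -/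

import Mathlib

open Set

noncomputable section

namespace Boroczky

/-! The hyperbolic plane of curvature `-1` is Mathlib's `UpperHalfPlane` with its metric, and its
isometries are the elements of `UpperHalfPlane ≃ᵢ UpperHalfPlane`.  The parameter `w > 0` is the
common hyperbolic length of the horocyclic edges of the prototile. -/

/-- The prototile: the region between the horocycles `im = 2` and `im = 1` (at distance `log 2`,
centred at the ideal point `∞`) and between the parallel lines `re = -w` and `re = w`. -/
def proto (w : ℝ) : Set UpperHalfPlane :=
  {z | -w ≤ z.re ∧ z.re ≤ w ∧ 1 ≤ z.im ∧ z.im ≤ 2}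

/-- The short horocyclic edge of the prototile. -/
def protoA (w : ℝ) : Set UpperHalfPlane := {z | -w ≤ z.re ∧ z.re ≤ w ∧ z.im = 2}

/-- The first half of the long horocyclic arc of the prototile. -/
def protoB1 (w : ℝ) : Set UpperHalfPlane := {z | -w ≤ z.re ∧ z.re ≤ 0 ∧ z.im = 1}

/-- The second half of the long horocyclic arc of the prototile. -/
def protoB2 (w : ℝ) : Set UpperHalfPlane := {z | 0 ≤ z.re ∧ z.re ≤ w ∧ z.im = 1}

/-- The straight edge of the prototile on the line `re = x`; used for `x = -w` and `x = w`. -/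
def protoC (x : ℝ) : Set UpperHalfPlane := {z | z.re = x ∧ 1 ≤ z.im ∧ z.im ≤ 2}

/-- The five vertices of the prototile, regarded as a pentagon. -/
def protoVertices (w : ℝ) : Set UpperHalfPlane :=
  {z | (z.im = 2 ∧ (z.re = -w ∨ z.re = w)) ∨ (z.im = 1 ∧ (z.re = -w ∨ z.re = 0 ∨ z.re = w))}

/-- `T` is a Böröczky pentagon: a congruent copy of the prototile. -/
def IsPentagon (w : ℝ) (T : Set UpperHalfPlane) : Prop :=
  ∃ g : UpperHalfPlane ≃ᵢ UpperHalfPlane, T = g '' proto w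

/-- `e` is the `a`-edge of the pentagon `T`. -/
def IsAEdge (w : ℝ) (T e : Set UpperHalfPlane) : Prop :=
  ∃ g : UpperHalfPlane ≃ᵢ UpperHalfPlane, T = g '' proto w ∧ e = g '' protoA w

/-- `e` is one of the two `b`-edges of the pentagon `T`. -/
def IsBEdge (w : ℝ) (T e : Set UpperHalfPlane) : Prop :=
  ∃ g : UpperHalfPlane ≃ᵢ UpperHalfPlane, T = g '' proto w ∧
    (e = g '' protoB1 w ∨ e = g '' protoB2 w)

/-- `e` is the `b₁`-edge of the pentagon `T`.  The labels of the two `b`-edges are carried from the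
prototile to `T` by the orientation preserving isometry (a real Möbius transformation) that moves
the prototile to `T`. -/
def IsB1Edge (w : ℝ) (T e : Set UpperHalfPlane) : Prop :=
  ∃ g : Matrix.SpecialLinearGroup (Fin 2) ℝ,
    T = (fun z : UpperHalfPlane => g • z) '' proto w ∧
    e = (fun z : UpperHalfPlane => g • z) '' protoB1 w

/-- `e` is the `b₂`-edge of the pentagon `T`. -/
def IsB2Edge (w : ℝ) (T e : Set UpperHalfPlane) : Prop :=
  ∃ g : Matrix.SpecialLinearGroup (Fin 2) ℝ,
    T = (fun z : UpperHalfPlane => g • z) '' proto w ∧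
    e = (fun z : UpperHalfPlane => g • z) '' protoB2 w

/-- `e` is one of the two `c`-edges of the pentagon `T`, and `p` is its initial point with respect
to the orientation from the `a`-edge to the `b`-edges, i.e. the endpoint of `e` on the `a`-edge. -/
def IsCEdgeFrom (w : ℝ) (T e : Set UpperHalfPlane) (p : UpperHalfPlane) : Prop :=
  ∃ g : UpperHalfPlane ≃ᵢ UpperHalfPlane, T = g '' proto w ∧
    ∃ x : ℝ, (x = -w ∨ x = w) ∧ e = g '' protoC x ∧
      ∃ q : UpperHalfPlane, q.re = x ∧ q.im = 2 ∧ p = g q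

/-- `e` is one of the two `c`-edges of the pentagon `T`. -/
def IsCEdge (w : ℝ) (T e : Set UpperHalfPlane) : Prop := ∃ p, IsCEdgeFrom w T e p

/-- `e` is an edge of the pentagon `T`. -/
def IsEdge (w : ℝ) (T e : Set UpperHalfPlane) : Prop :=
  IsAEdge w T e ∨ IsBEdge w T e ∨ IsCEdge w T e

/-- `v` is a vertex of the pentagon `T`. -/
def IsVertex (w : ℝ) (T : Set UpperHalfPlane) (v : UpperHalfPlane) : Prop :=
  ∃ g : UpperHalfPlane ≃ᵢ UpperHalfPlane, T = g '' proto w ∧ v ∈ g '' protoVertices w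

/-- A B-tiling: an edge-to-edge tiling of the hyperbolic plane by Böröczky pentagons that respects
the orientations of the `c`-edges. -/
structure IsBTiling (w : ℝ) (𝒯 : Set (Set UpperHalfPlane)) : Prop where
  pentagon : ∀ T ∈ 𝒯, IsPentagon w T
  cover : ⋃₀ 𝒯 = univ
  disjoint : ∀ T ∈ 𝒯, ∀ T' ∈ 𝒯, T ≠ T' → Disjoint (interior T) (interior T')
  edgeToEdge : ∀ T ∈ 𝒯, ∀ T' ∈ 𝒯, T ≠ T' → (T ∩ T').Nonempty →
    IsEdge w T (T ∩ T') ∧ IsEdge w T' (T ∩ T') ∨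
    ∃ v, IsVertex w T v ∧ IsVertex w T' v ∧ T ∩ T' = {v}
  oriented : ∀ T ∈ 𝒯, ∀ T' ∈ 𝒯, ∀ e p p', IsCEdgeFrom w T e p → IsCEdgeFrom w T' e p' → p = p'

/-- `f` enumerates a ring: a biinfinite sequence of pairwise different tiles in which consecutive
tiles share a `c`-edge. -/
def IsRingSeq (w : ℝ) (𝒯 : Set (Set UpperHalfPlane)) (f : ℤ → Set UpperHalfPlane) : Prop :=
  Function.Injective f ∧ (∀ i, f i ∈ 𝒯) ∧ ∀ i, ∃ e, IsCEdge w (f i) e ∧ IsCEdge w (f (i + 1)) e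

/-- `R` is (the set of tiles of) a ring of the tiling. -/
def IsRing (w : ℝ) (𝒯 R : Set (Set UpperHalfPlane)) : Prop :=
  ∃ f, IsRingSeq w 𝒯 f ∧ R = range f

/-- `H` is (the set of tiles of) a half ring `(T_i)_{i ≥ 0}`, where `(T_i)_{i ∈ ℤ}` is a ring. -/
def IsHalfRing (w : ℝ) (𝒯 H : Set (Set UpperHalfPlane)) : Prop :=
  ∃ f, IsRingSeq w 𝒯 f ∧ H = f '' Ici 0

/-- One step down from `T` to `T'`: the `a`-edge of `T` is a `b`-edge of `T'`. -/
def Down (w : ℝ) (T T' : Set UpperHalfPlane) : Prop := ∃ e, IsAEdge w T e ∧ IsBEdge w T' e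

/-- `S` is the set of all tiles of `k` consecutive rings `R 0, …, R (k - 1)`, each of which lies
directly below the previous one. -/
def IsRingBlock (w : ℝ) (𝒯 : Set (Set UpperHalfPlane)) (k : ℕ) (S : Set (Set UpperHalfPlane)) :
    Prop :=
  ∃ R : Fin k → Set (Set UpperHalfPlane), (∀ i, IsRing w 𝒯 (R i)) ∧
    (∀ i j : Fin k, (j : ℕ) = i + 1 → ∃ T ∈ R i, ∃ T' ∈ R j, Down w T T') ∧
    S = ⋃ i, R i

/-- `T` and `T'` share an edge that is not a `c`-edge. -/
def ShareHorocyclicEdge (w : ℝ) (T T' : Set UpperHalfPlane) : Prop :=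
  ∃ e, (IsAEdge w T e ∨ IsBEdge w T e) ∧ (IsAEdge w T' e ∨ IsBEdge w T' e)

/-- `T` and `T'` are linked by a (finite) horocyclic path `f 0, …, f n` of pairwise different
tiles. -/
def Linked (w : ℝ) (𝒯 : Set (Set UpperHalfPlane)) (T T' : Set UpperHalfPlane) : Prop :=
  ∃ (n : ℕ) (f : ℕ → Set UpperHalfPlane), f 0 = T ∧ f n = T' ∧ (∀ i ≤ n, f i ∈ 𝒯) ∧
    InjOn f (Iic n) ∧ ∀ i < n, ShareHorocyclicEdge w (f i) (f (i + 1))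

/-- The set of all pools of the tiling; a pool consists of all tiles linked with a given tile. -/
def pools (w : ℝ) (𝒯 : Set (Set UpperHalfPlane)) : Set (Set (Set UpperHalfPlane)) :=
  {P | ∃ T ∈ 𝒯, P = {T' | Linked w 𝒯 T T'}}

/-- `t` is the tail of `T`: the infinite horocyclic path down-down-… that starts at `T`. -/
def IsTail (w : ℝ) (𝒯 : Set (Set UpperHalfPlane)) (T : Set UpperHalfPlane)
    (t : ℕ → Set UpperHalfPlane) : Prop :=
  t 0 = T ∧ (∀ i, t i ∈ 𝒯) ∧ Function.Injective t ∧ ∀ i, Down w (t i) (t (i + 1))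

/-- `s` is the sequence `s(T)` of the tail of `T` (indexed from `0`): `s i = 1` if the `a`-edge of
the tile `i` of the tail is the `b₁`-edge of the tile `i + 1`, and `s i = -1` if it is the
`b₂`-edge. -/
def IsTailSeq (w : ℝ) (𝒯 : Set (Set UpperHalfPlane)) (T : Set UpperHalfPlane) (s : ℕ → ℤˣ) :
    Prop :=
  ∃ t, IsTail w 𝒯 T t ∧ ∀ i, ∃ e, IsAEdge w (t i) e ∧
    (IsB1Edge w (t (i + 1)) e ∧ s i = 1 ∨ IsB2Edge w (t (i + 1)) e ∧ s i = -1)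

/-- `p` is a period of `s`. -/
def HasPeriod (s : ℕ → ℤˣ) (p : ℕ) : Prop := 1 ≤ p ∧ ∀ i, s i = s (i + p)

/-- `s` is (purely) periodic. -/
def IsPeriodic (s : ℕ → ℤˣ) : Prop := ∃ p, HasPeriod s p

/-- The period, i.e. the least period, of a periodic sequence. -/
def leastPeriod (s : ℕ → ℤˣ) : ℕ := sInf {p | HasPeriod s p}

open Classical in
/-- The essential period of a periodic sequence with least period `k`: it is `k / 2` if `k` is even
and shifting by `k / 2` changes all signs, and `k` otherwise. -/
def essentialPeriod (s : ℕ → ℤˣ) : ℕ :=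
  if Even (leastPeriod s) ∧ ∀ i, s i = -s (i + leastPeriod s / 2) then leastPeriod s / 2
  else leastPeriod s

/-- The symmetry group of the tiling: all isometries that map the set of tiles onto itself. -/
def symGroup (𝒯 : Set (Set UpperHalfPlane)) : Subgroup (UpperHalfPlane ≃ᵢ UpperHalfPlane) where
  carrier := {φ | (fun T : Set UpperHalfPlane => φ '' T) '' 𝒯 = 𝒯}
  one_mem' := by
    have h : (fun T : Set UpperHalfPlane =>
        (1 : UpperHalfPlane ≃ᵢ UpperHalfPlane) '' T) = id := by
      funext T
      simp
    simp only [mem_ofPred_eq, h, image_id]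
  mul_mem' := by
    intro φ ψ hφ hψ
    have h : (fun T : Set UpperHalfPlane => (φ * ψ) '' T) =
        (fun T => φ '' T) ∘ (fun T => ψ '' T) := by
      funext T
      simp only [Function.comp_apply, image_image]
      rfl
    simp only [mem_ofPred_eq] at hφ hψ ⊢
    rw [h, image_comp, hψ, hφ]
  inv_mem' := by
    intro φ hφ
    simp only [mem_ofPred_eq] at hφ ⊢
    have h : (fun T : Set UpperHalfPlane => (φ⁻¹ : UpperHalfPlane ≃ᵢ UpperHalfPlane) '' T) ∘ (fun T => φ '' T) = id := by
      funext T
      simp only [Function.comp_apply, image_image, id]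
      have h2 : ∀ x, (φ⁻¹ : UpperHalfPlane ≃ᵢ UpperHalfPlane) (φ x) = x := fun x => φ.symm_apply_apply x
      simp [h2]
    conv_lhs => rw [← hφ]
    rw [← image_comp, h, image_id]

/-- `F` is a fundamental domain of the group `Γ` of isometries: a closed set that is the closure of
its connected interior, whose images under `Γ` cover the plane, and whose images under different
elements of `Γ` have disjoint interiors. -/
structure IsFundDomain (Γ : Subgroup (UpperHalfPlane ≃ᵢ UpperHalfPlane)) (F : Set UpperHalfPlane) :
    Prop where
  closure_interior : closure (interior F) = F
  connected : IsConnected (interior F)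
  cover : ⋃ γ ∈ Γ, γ '' F = univ
  disjoint : ∀ γ ∈ Γ, ∀ δ ∈ Γ, γ ≠ δ → Disjoint (interior (γ '' F)) (interior (δ '' F))

end Boroczky

end

noncomputable section

namespace Boroczky

/-! Every B-tiling looks like the standard one. After a Möbius map `A` its tiles are the rectangles
of half-width `2 ^ k * w` between the heights `2 ^ k` and `2 ^ (k + 1)`, with centre lines `c k + 2
^ k * (2 * w) * n`, where `c (k + 1) - c k = ± 2 ^ k * w`. The sign `σ k` is the only freedom, and
`σ` read from level `0` upwards is the tail sequence of the tile `(0, 0)`. Note that a step `Down`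
leads to the next higher level of the half-plane. This normal form (`IsBTiling.exists_frame`)
follows from rigidity of isometries, which fixes the neighbour across each edge up to one sign at
the `a`-edge, and from local finiteness, which provides neighbours. Afterwards tilings are integer
arithmetic.

A wall is a vertical line made of `c`-edges on all levels. There is at most one, since two of them
would be separated by a multiple of every tile width. The chains of tiles over two abscissas merge
at a high level unless a wall separates them (`IsFrame.exists_wall_between`), so there are two pools
if a wall exists and one otherwise.

In the frame each symmetry is a similarity `x + i y ↦ ε 2 ^ m x + b + i 2 ^ m y` that takes centre
lines of level `k` to centre lines of level `m + k` (`IsFrame.exists_of_mem_symGroup`). With a wall,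
the symmetries are exactly the similarities of this form that fix the wall
(`IsFrame.isCompatible_iff_of_wall`). Then `m` can be used to choose the level and `ε` the side, and
half a level is a fundamental domain. Without a wall, `m = 0` forces the identity
(`IsFrame.sim_eq_one_of_no_wall`), a symmetry yields `σ (m + k) = ε * σ k` for large `k`
(`IsFrame.eventually_shift`), and such a relation for all `k ≥ 0` yields a symmetry
(`IsFrame.isCompatible_of_shift`). If the tail sequence is periodic, the values of `m` are therefore
the multiples of its essential period, and that many levels form a fundamental domain. If some `m ≠
0` occurs, applying the relation twice removes `ε` and a later tail is periodic; so if no tail is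
periodic, the group is trivial. -/

/-! ### Distances, similarities and rectangles -/

/-- The hyperbolic distance is determined by this algebraic expression. -/
def distQuot (z z' : UpperHalfPlane) : ℝ :=
  ((z.re - z'.re) ^ 2 + (z.im - z'.im) ^ 2) / (z.im * z'.im)

theorem cosh_dist_eq_distQuot (z z' : UpperHalfPlane) :
    Real.cosh (dist z z') = 1 + distQuot z z' / 2 := by
  rw [UpperHalfPlane.cosh_dist, distQuot, Complex.dist_eq_re_im, Real.sq_sqrt (by positivity)]
  have h1 := z.im_pos
  have h2 := z'.im_pos
  simp only [UpperHalfPlane.coe_re, UpperHalfPlane.coe_im]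
  field_simp

theorem dist_eq_iff_distQuot {z z' u u' : UpperHalfPlane} :
    dist z z' = dist u u' ↔ distQuot z z' = distQuot u u' := by
  constructor
  · intro h
    have h1 := cosh_dist_eq_distQuot z z'
    rw [h, cosh_dist_eq_distQuot] at h1
    linarith
  · intro h
    have h1 : Real.cosh (dist z z') = Real.cosh (dist u u') := by
      rw [cosh_dist_eq_distQuot, cosh_dist_eq_distQuot, h]
    exact Real.cosh_strictMonoOn.injOn (mem_Ici.2 dist_nonneg) (mem_Ici.2 dist_nonneg) h1

theorem distQuot_map (g : UpperHalfPlane ≃ᵢ UpperHalfPlane) (z z' : UpperHalfPlane) :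
    distQuot (g z) (g z') = distQuot z z' :=
  dist_eq_iff_distQuot.1 (g.isometry.dist_eq z z')

theorem cast_units_mul_self (ε : ℤˣ) : (((ε : ℤ) : ℝ)) * ((ε : ℤ) : ℝ) = 1 := by
  rcases Int.units_eq_one_or ε with h | h <;> simp [h]

theorem abs_cast_units (ε : ℤˣ) : |((ε : ℤ) : ℝ)| = 1 := by
  rcases Int.units_eq_one_or ε with h | h <;> simp [h]

/-- The point of the upper half-plane with real part `x` on the horocycle of height `2 ^ i`. -/
def horoPt (x : ℝ) (i : ℤ) : UpperHalfPlane := ⟨⟨x, 2 ^ i⟩, by positivity⟩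

@[simp] theorem horoPt_re (x : ℝ) (i : ℤ) : (horoPt x i).re = x := rfl

@[simp] theorem horoPt_im (x : ℝ) (i : ℤ) : (horoPt x i).im = 2 ^ i := rfl

theorem eq_horoPt {z : UpperHalfPlane} {i : ℤ} (h : z.im = 2 ^ i) : z = horoPt z.re i :=
  UpperHalfPlane.ext_re_im rfl h

/-- The map `x + i y ↦ ε 2 ^ m x + b + i 2 ^ m y`. -/
def simFun (ε : ℤˣ) (m : ℤ) (b : ℝ) (z : UpperHalfPlane) : UpperHalfPlane :=
  ⟨⟨(ε : ℤ) * 2 ^ m * z.re + b, 2 ^ m * z.im⟩, by have := z.im_pos; positivity⟩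

theorem simFun_simFun (ε ε' : ℤˣ) (m m' : ℤ) (b b' : ℝ) (z : UpperHalfPlane) :
    simFun ε m b (simFun ε' m' b' z) = simFun (ε * ε') (m + m') ((ε : ℤ) * 2 ^ m * b' + b) z := by
  apply UpperHalfPlane.ext_re_im
  · simp only [simFun, UpperHalfPlane.mk_re, Units.val_mul, Int.cast_mul,
      zpow_add₀ (two_ne_zero' ℝ)]
    ring
  · simp only [simFun, UpperHalfPlane.mk_im, zpow_add₀ (two_ne_zero' ℝ)]
    ring

theorem simFun_one_zero (z : UpperHalfPlane) : simFun 1 0 0 z = z := by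
  apply UpperHalfPlane.ext_re_im <;> simp [simFun]

/-- The isometry `x + i y ↦ ε 2 ^ m x + b + i 2 ^ m y`. -/
def sim (ε : ℤˣ) (m : ℤ) (b : ℝ) : UpperHalfPlane ≃ᵢ UpperHalfPlane where
  toFun := simFun ε m b
  invFun := simFun ε (-m) (-((ε : ℤ) * 2 ^ (-m) * b))
  left_inv z := by
    rw [simFun_simFun, Int.units_mul_self]
    simp [simFun_one_zero]
  right_inv z := by
    rw [simFun_simFun, Int.units_mul_self]
    have h : ((ε : ℤ) : ℝ) * 2 ^ m * -((ε : ℤ) * 2 ^ (-m) * b) + b = 0 := by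
      have h1 := cast_units_mul_self ε
      have h2 : (2 : ℝ) ^ m * 2 ^ (-m) = 1 := by
        rw [← zpow_add₀ (two_ne_zero' ℝ)]
        simp
      linear_combination (-(2 : ℝ) ^ m * 2 ^ (-m) * b) * h1 - b * h2
    rw [h]
    simp [simFun_one_zero]
  isometry_toFun := Isometry.of_dist_eq fun z z' => by
    rw [dist_eq_iff_distQuot]
    have h1 := z.im_pos
    have h2 := z'.im_pos
    have h3 : (0 : ℝ) < 2 ^ m := by positivity
    have h4 := cast_units_mul_self ε
    simp only [distQuot, simFun, UpperHalfPlane.mk_re, UpperHalfPlane.mk_im]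
    rw [div_eq_div_iff (by positivity) (by positivity)]
    linear_combination ((2 : ℝ) ^ m) ^ 2 * (z.re - z'.re) ^ 2 * z.im * z'.im * h4

@[simp] theorem sim_re (ε : ℤˣ) (m : ℤ) (b : ℝ) (z : UpperHalfPlane) :
    (sim ε m b z).re = (ε : ℤ) * 2 ^ m * z.re + b := rfl

@[simp] theorem sim_im (ε : ℤˣ) (m : ℤ) (b : ℝ) (z : UpperHalfPlane) :
    (sim ε m b z).im = 2 ^ m * z.im := rfl

theorem sim_mul_sim (ε ε' : ℤˣ) (m m' : ℤ) (b b' : ℝ) :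
    sim ε m b * sim ε' m' b' = sim (ε * ε') (m + m') ((ε : ℤ) * 2 ^ m * b' + b) :=
  IsometryEquiv.ext fun z => simFun_simFun ε ε' m m' b b' z

theorem sim_one_zero : sim 1 0 0 = 1 := IsometryEquiv.ext simFun_one_zero

theorem sim_inv (ε : ℤˣ) (m : ℤ) (b : ℝ) :
    (sim ε m b)⁻¹ = sim ε (-m) (-((ε : ℤ) * 2 ^ (-m) * b)) := by
  refine IsometryEquiv.ext fun z => ?_
  rfl

theorem sim_horoPt (ε : ℤˣ) (m : ℤ) (b x : ℝ) (i : ℤ) :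
    sim ε m b (horoPt x i) = horoPt ((ε : ℤ) * 2 ^ m * x + b) (m + i) := by
  apply UpperHalfPlane.ext_re_im
  · simp
  · simp [zpow_add₀ (two_ne_zero' ℝ)]

/-- The region `|re - x| ≤ r`, `2 ^ i ≤ im ≤ 2 ^ j`. -/
def rect (x r : ℝ) (i j : ℤ) : Set UpperHalfPlane :=
  {z | |z.re - x| ≤ r ∧ 2 ^ i ≤ z.im ∧ z.im ≤ 2 ^ j}

theorem mem_rect {x r : ℝ} {i j : ℤ} {z : UpperHalfPlane} :
    z ∈ rect x r i j ↔ |z.re - x| ≤ r ∧ 2 ^ i ≤ z.im ∧ z.im ≤ 2 ^ j := Iff.rfl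

theorem sim_mem_rect_iff (ε : ℤˣ) (m : ℤ) (b x r : ℝ) (i j : ℤ) (z : UpperHalfPlane) :
    sim ε m b z ∈ rect ((ε : ℤ) * 2 ^ m * x + b) (2 ^ m * r) (m + i) (m + j) ↔
      z ∈ rect x r i j := by
  have h3 : (0 : ℝ) < 2 ^ m := by positivity
  have h : ((ε : ℤ) : ℝ) * 2 ^ m * z.re + b - ((ε : ℤ) * 2 ^ m * x + b) =
      (ε : ℤ) * (2 ^ m * (z.re - x)) := by ring
  rw [mem_rect, mem_rect, sim_re, sim_im, h, abs_mul, abs_cast_units, one_mul, abs_mul,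
    abs_of_pos h3, zpow_add₀ (two_ne_zero' ℝ), zpow_add₀ (two_ne_zero' ℝ)]
  simp only [mul_le_mul_iff_right₀ h3]

theorem sim_image_rect (ε : ℤˣ) (m : ℤ) (b x r : ℝ) (i j : ℤ) :
    sim ε m b '' rect x r i j = rect ((ε : ℤ) * 2 ^ m * x + b) (2 ^ m * r) (m + i) (m + j) := by
  ext z
  obtain ⟨u, rfl⟩ := (sim ε m b).surjective z
  rw [sim_mem_rect_iff, (sim ε m b).injective.mem_set_image]

theorem horoPt_mem_rect {u x r : ℝ} {k i j : ℤ} :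
    horoPt u k ∈ rect x r i j ↔ |u - x| ≤ r ∧ i ≤ k ∧ k ≤ j := by
  rw [mem_rect, horoPt_re, horoPt_im, zpow_le_zpow_iff_right₀ one_lt_two,
    zpow_le_zpow_iff_right₀ one_lt_two]

/-- Tiles and edges are all rectangles, possibly degenerate (`r = 0` or `i = j`), so this turns
incidences into equations between parameters. -/
theorem rect_injective {x r x' r' : ℝ} {i j i' j' : ℤ} (hr : 0 ≤ r) (hij : i ≤ j)
    (h : rect x r i j = rect x' r' i' j') : x = x' ∧ r = r' ∧ i = i' ∧ j = j' := by
  have key : ∀ u k, (|u - x| ≤ r ∧ i ≤ k ∧ k ≤ j) ↔ (|u - x'| ≤ r' ∧ i' ≤ k ∧ k ≤ j') := by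
    intro u k
    rw [← horoPt_mem_rect, h, horoPt_mem_rect]
  have h1 := (key (x + r) i).1 ⟨by simp [abs_of_nonneg hr], le_rfl, hij⟩
  have h2 := (key (x - r) j).1 ⟨by simp [abs_of_nonneg hr], hij, le_rfl⟩
  have hr' : 0 ≤ r' := (abs_nonneg _).trans h1.1
  have hij' : i' ≤ j' := h1.2.1.trans h1.2.2
  have h3 := (key (x' + r') i').2 ⟨by simp [abs_of_nonneg hr'], le_rfl, hij'⟩
  have h4 := (key (x' - r') j').2 ⟨by simp [abs_of_nonneg hr'], hij', le_rfl⟩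
  simp only [abs_le] at h1 h2 h3 h4
  refine ⟨?_, ?_, ?_, ?_⟩ <;> linarith

/-! ### Rigidity -/

theorem dist_horoPt_sinh (x x' : ℝ) (i : ℤ) :
    Real.sinh (dist (horoPt x i) (horoPt x' i) / 2) = |x - x'| / (2 * 2 ^ i) := by
  rw [UpperHalfPlane.sinh_half_dist, Complex.dist_eq_re_im]
  have h3 : (0 : ℝ) < 2 ^ i := by positivity
  simp only [UpperHalfPlane.coe_re, UpperHalfPlane.coe_im, horoPt_re, horoPt_im, sub_self]
  rw [Real.sqrt_mul_self h3.le]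
  simp [Real.sqrt_sq_eq_abs]

/-- On a horocycle `sinh (d / 2)` is proportional to the Euclidean distance, whereas `sinh` is
strictly superadditive on positive numbers. -/
theorem dist_horoPt_lt (x y z : ℝ) (i : ℤ) (hxy : x ≠ y) (hyz : y ≠ z) :
    dist (horoPt x i) (horoPt z i) < dist (horoPt x i) (horoPt y i) +
      dist (horoPt y i) (horoPt z i) := by
  set a := dist (horoPt x i) (horoPt y i)
  set b := dist (horoPt y i) (horoPt z i)
  have h3 : (0 : ℝ) < 2 ^ i := by positivity
  have hne : ∀ u v : ℝ, u ≠ v → 0 < dist (horoPt u i) (horoPt v i) := fun u v h =>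
    dist_pos.2 fun h' => h (congrArg UpperHalfPlane.re h')
  have ha : 0 < a := hne _ _ hxy
  have hb : 0 < b := hne _ _ hyz
  have h1 : Real.sinh (dist (horoPt x i) (horoPt z i) / 2) < Real.sinh ((a + b) / 2) := by
    rw [add_div, Real.sinh_add]
    have h4 : 1 < Real.cosh (a / 2) := Real.one_lt_cosh.2 (by positivity)
    have h5 : 1 < Real.cosh (b / 2) := Real.one_lt_cosh.2 (by positivity)
    have h6 : 0 < Real.sinh (a / 2) := Real.sinh_pos_iff.2 (by positivity)
    have h7 : 0 < Real.sinh (b / 2) := Real.sinh_pos_iff.2 (by positivity)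
    have h8 : Real.sinh (dist (horoPt x i) (horoPt z i) / 2) ≤
        Real.sinh (a / 2) + Real.sinh (b / 2) := by
      rw [dist_horoPt_sinh, dist_horoPt_sinh, dist_horoPt_sinh, ← add_div]
      exact div_le_div_of_nonneg_right (abs_sub_le x y z) (by positivity)
    nlinarith
  have := Real.sinh_lt_sinh.1 h1
  linarith

/-- An isometry does not map three points of a horocycle to a vertical geodesic. -/
theorem not_re_eq_of_horoPt (g : UpperHalfPlane ≃ᵢ UpperHalfPlane) {x y z : ℝ} {i : ℤ}
    (hxy : x ≠ y) (hxz : x ≠ z) (hyz : y ≠ z)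
    (h1 : (g (horoPt x i)).re = (g (horoPt y i)).re)
    (h2 : (g (horoPt y i)).re = (g (horoPt z i)).re) : False := by
  have e1 := g.isometry.dist_eq (horoPt x i) (horoPt y i)
  have e2 := g.isometry.dist_eq (horoPt y i) (horoPt z i)
  have e3 := g.isometry.dist_eq (horoPt x i) (horoPt z i)
  rw [UpperHalfPlane.dist_of_re_eq h1, Real.dist_eq] at e1
  rw [UpperHalfPlane.dist_of_re_eq h2, Real.dist_eq] at e2
  rw [UpperHalfPlane.dist_of_re_eq (h1.trans h2), Real.dist_eq] at e3
  -- On a vertical line one of the three distances is the sum of the other two, which violates one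
  -- of these strict inequalities.
  have f1 := dist_horoPt_lt x y z i hxy hyz
  have f2 := dist_horoPt_lt y x z i hxy.symm hxz
  have f3 := dist_horoPt_lt x z y i hxz hyz.symm
  rw [dist_comm (horoPt y i) (horoPt x i)] at f2
  rw [dist_comm (horoPt z i) (horoPt y i)] at f3
  rw [← e1, ← e2, ← e3] at f1 f2 f3
  grind

/-- Differences of the distance equations are linear in the coordinates of `g p`, and two of them
already force `g p = p`. -/
theorem eq_one_of_fix_horoPt (g : UpperHalfPlane ≃ᵢ UpperHalfPlane) {x y z : ℝ} {i : ℤ}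
    (hxy : x ≠ y) (hxz : x ≠ z) (hyz : y ≠ z) (h1 : g (horoPt x i) = horoPt x i)
    (h2 : g (horoPt y i) = horoPt y i) (h3 : g (horoPt z i) = horoPt z i) : g = 1 := by
  refine IsometryEquiv.ext fun p => ?_
  have e1 := distQuot_map g p (horoPt x i)
  have e2 := distQuot_map g p (horoPt y i)
  have e3 := distQuot_map g p (horoPt z i)
  rw [h1] at e1
  rw [h2] at e2
  rw [h3] at e3
  have hp := p.im_pos
  have hq := (g p).im_pos
  have h4 : (0 : ℝ) < 2 ^ i := by positivity
  simp only [distQuot, horoPt_re, horoPt_im] at e1 e2 e3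
  generalize (2 : ℝ) ^ i = c at *
  rw [div_eq_div_iff (by positivity) (by positivity)] at e1 e2 e3
  have hc := h4.ne'
  have f1 : c * ((y - x) * ((x + y) * (p.im - (g p).im) -
      2 * ((g p).re * p.im - p.re * (g p).im))) = 0 := by linear_combination e2 - e1
  have f2 : c * ((z - x) * ((x + z) * (p.im - (g p).im) -
      2 * ((g p).re * p.im - p.re * (g p).im))) = 0 := by linear_combination e3 - e1
  have f1' := (mul_eq_zero.1 ((mul_eq_zero.1 f1).resolve_left hc)).resolve_left
    (sub_ne_zero.2 hxy.symm)
  have f2' := (mul_eq_zero.1 ((mul_eq_zero.1 f2).resolve_left hc)).resolve_left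
    (sub_ne_zero.2 hxz.symm)
  have f3 : (z - y) * (p.im - (g p).im) = 0 := by linear_combination f2' - f1'
  have f4 : p.im = (g p).im :=
    sub_eq_zero.1 ((mul_eq_zero.1 f3).resolve_left (sub_ne_zero.2 hyz.symm))
  refine UpperHalfPlane.ext_re_im ?_ f4.symm
  rw [← f4] at f1'
  have f5 : p.im * ((g p).re - p.re) = 0 := by linear_combination -f1' / 2
  simpa using sub_eq_zero.1 ((mul_eq_zero.1 f5).resolve_left hp.ne')

/-- An isometry that maps three points of a horizontal horocycle to a horizontal horocycle is a
Euclidean similarity. -/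
theorem eq_sim_of_horoPt (g : UpperHalfPlane ≃ᵢ UpperHalfPlane) {x y z : ℝ} {i j : ℤ}
    (hxy : x ≠ y) (hxz : x ≠ z) (hyz : y ≠ z) (h1 : (g (horoPt x i)).im = 2 ^ j)
    (h2 : (g (horoPt y i)).im = 2 ^ j) (h3 : (g (horoPt z i)).im = 2 ^ j) :
    ∃ ε b, g = sim ε (j - i) b := by
  have e1 := distQuot_map g (horoPt x i) (horoPt y i)
  have e2 := distQuot_map g (horoPt y i) (horoPt z i)
  have e3 := distQuot_map g (horoPt x i) (horoPt z i)
  have hx := eq_horoPt h1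
  have hy := eq_horoPt h2
  have hz := eq_horoPt h3
  simp only [distQuot, h1, h2, h3, horoPt_re, horoPt_im, sub_self] at e1 e2 e3
  set u := (g (horoPt x i)).re
  set v := (g (horoPt y i)).re
  set t := (g (horoPt z i)).re
  have hi : (0 : ℝ) < 2 ^ i := by positivity
  have hj : (0 : ℝ) < 2 ^ j := by positivity
  have ha : (2 : ℝ) ^ (j - i) * 2 ^ i = 2 ^ j := by
    rw [← zpow_add₀ (two_ne_zero' ℝ)]
    simp
  set a := (2 : ℝ) ^ (j - i) with ha'
  rw [← ha] at e1 e2 e3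
  have hapos : 0 < a := by positivity
  have conv : ∀ p q : ℝ, (p ^ 2 + 0 ^ 2) / (a * 2 ^ i * (a * 2 ^ i)) =
      (q ^ 2 + 0 ^ 2) / (2 ^ i * 2 ^ i) → p = a * q ∨ p = -(a * q) := by
    intro p q h
    rw [div_eq_div_iff (by positivity) (by positivity)] at h
    apply sq_eq_sq_iff_eq_or_eq_neg.1
    have h0 : ((2 : ℝ) ^ i) ^ 2 ≠ 0 := by positivity
    apply mul_left_cancel₀ h0
    linear_combination h
  -- The distances fix both gaps up to sign; the distance of the outer points, whose gap is the sum,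
  -- excludes opposite signs.
  have key : ∃ ε : ℤˣ, u - v = (ε : ℤ) * a * (x - y) ∧ v - t = (ε : ℤ) * a * (y - z) := by
    have n1 : a * (x - y) ≠ 0 := mul_ne_zero hapos.ne' (sub_ne_zero.2 hxy)
    have n2 : a * (y - z) ≠ 0 := mul_ne_zero hapos.ne' (sub_ne_zero.2 hyz)
    rcases conv _ _ e1 with c1 | c1 <;> rcases conv _ _ e2 with c2 | c2 <;>
      rcases conv _ _ e3 with c3 | c3
    · exact ⟨1, by simpa using c1, by simpa using c2⟩
    · exact ⟨1, by simpa using c1, by simpa using c2⟩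
    · exact (n2 (by linarith)).elim
    · exact (n1 (by linarith)).elim
    · exact (n1 (by linarith)).elim
    · exact (n2 (by linarith)).elim
    · exact ⟨-1, by simpa using c1, by simpa using c2⟩
    · exact ⟨-1, by simpa using c1, by simpa using c2⟩
  obtain ⟨ε, k1, k2⟩ := key
  refine ⟨ε, u - (ε : ℤ) * a * x, ?_⟩
  have hs : ∀ p q, q - u = (ε : ℤ) * a * (p - x) →
      sim ε (j - i) (u - (ε : ℤ) * a * x) (horoPt p i) = horoPt q j := by
    intro p q h
    rw [sim_horoPt, ← ha']
    congr 1
    · linarith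
    · ring
  have hfix : ∀ p q, g (horoPt p i) = horoPt q j → q - u = (ε : ℤ) * a * (p - x) →
      ((sim ε (j - i) (u - (ε : ℤ) * a * x))⁻¹ * g) (horoPt p i) = horoPt p i := by
    intro p q h h'
    rw [IsometryEquiv.mul_apply, h, ← hs p q h', IsometryEquiv.inv_apply_self]
  have := eq_one_of_fix_horoPt _ hxy hxz hyz (hfix x u hx (by ring)) (hfix y v hy (by linarith))
    (hfix z t hz (by linarith))
  rw [inv_mul_eq_one] at this
  exact this.symm

/-- An isometry that fixes two points of a vertical geodesic is the identity or the reflection in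
that geodesic. -/
theorem eq_one_or_reflection (g : UpperHalfPlane ≃ᵢ UpperHalfPlane) {x : ℝ} {i j : ℤ} (hij : i ≠ j)
    (hi : g (horoPt x i) = horoPt x i) (hj : g (horoPt x j) = horoPt x j) :
    g = 1 ∨ g = sim (-1) 0 (2 * x) := by
  have key : ∀ p, (g p).im = p.im ∧ ((g p).re - x) ^ 2 = (p.re - x) ^ 2 := by
    intro p
    have e1 := distQuot_map g p (horoPt x i)
    have e2 := distQuot_map g p (horoPt x j)
    rw [hi] at e1
    rw [hj] at e2
    have hp := p.im_pos
    have hq := (g p).im_pos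
    have hI : (0 : ℝ) < 2 ^ i := by positivity
    have hJ : (0 : ℝ) < 2 ^ j := by positivity
    have hne : (2 : ℝ) ^ i ≠ 2 ^ j := fun h => hij (zpow_right_injective₀ two_pos (by norm_num) h)
    simp only [distQuot, horoPt_re, horoPt_im] at e1 e2
    generalize (2 : ℝ) ^ i = c at *
    generalize (2 : ℝ) ^ j = d at *
    rw [div_eq_div_iff (by positivity) (by positivity)] at e1 e2
    have f1 : (((g p).re - x) ^ 2 + ((g p).im - c) ^ 2) * p.im =
        ((p.re - x) ^ 2 + (p.im - c) ^ 2) * (g p).im := by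
      apply mul_right_cancel₀ hI.ne'
      linear_combination e1
    have f2 : (((g p).re - x) ^ 2 + ((g p).im - d) ^ 2) * p.im =
        ((p.re - x) ^ 2 + (p.im - d) ^ 2) * (g p).im := by
      apply mul_right_cancel₀ hJ.ne'
      linear_combination e2
    have f3 : (c - d) * ((c + d) * (p.im - (g p).im)) = 0 := by linear_combination f1 - f2
    have f4 := (mul_eq_zero.1 ((mul_eq_zero.1 f3).resolve_left (sub_ne_zero.2 hne))).resolve_left
      (by positivity)
    have f5 : (g p).im = p.im := by linarith
    refine ⟨f5, ?_⟩
    rw [f5] at f1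
    have := mul_right_cancel₀ hp.ne' f1
    linarith
  have fin : ∀ u, g (horoPt u i) = horoPt u i ∨ g (horoPt u i) = horoPt (2 * x - u) i := by
    intro u
    obtain ⟨h1, h2⟩ := key (horoPt u i)
    rw [horoPt_im] at h1
    rw [horoPt_re] at h2
    rcases sq_eq_sq_iff_eq_or_eq_neg.1 h2 with h | h
    · left
      rw [eq_horoPt h1]
      congr 1
      linarith
    · right
      rw [eq_horoPt h1]
      congr 1
      linarith
  -- The mirror image `x - 2` of `x + 2` has the wrong distance from the fixed point `x + 1`, so `x
  -- + 2` is a third fixed point. The other case reduces to this one by composing with the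
  -- reflection.
  have sub : ∀ h : UpperHalfPlane ≃ᵢ UpperHalfPlane, h (horoPt x i) = horoPt x i →
      (∀ u, h (horoPt u i) = horoPt u i ∨ h (horoPt u i) = horoPt (2 * x - u) i) →
      h (horoPt (x + 1) i) = horoPt (x + 1) i → h = 1 := by
    intro h h0 h1 h2
    refine eq_one_of_fix_horoPt h (x := x) (y := x + 1) (z := x + 2) (i := i) (by simp) (by simp)
      (by simp) h0 h2 ?_
    rcases h1 (x + 2) with h3 | h3
    · exact h3
    · exfalso
      have h4 := distQuot_map h (horoPt (x + 2) i) (horoPt (x + 1) i)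
      rw [h2, h3] at h4
      simp only [distQuot, horoPt_re, horoPt_im] at h4
      have hI : (0 : ℝ) < 2 ^ i := by positivity
      rw [div_eq_div_iff (by positivity) (by positivity)] at h4
      have := mul_right_cancel₀ (by positivity) h4
      nlinarith
  rcases fin (x + 1) with h | h
  · exact Or.inl (sub g hi fin h)
  · right
    have hr : ∀ u, sim (-1) 0 (2 * x) (horoPt u i) = horoPt (2 * x - u) i := by
      intro u
      rw [sim_horoPt]
      congr 1
      · simp
        ring
      · simp
    have h1 := sub (sim (-1) 0 (2 * x) * g) (by
        rw [IsometryEquiv.mul_apply, hi, hr]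
        congr 1
        ring) (by
        intro u
        rw [IsometryEquiv.mul_apply]
        rcases fin u with h | h
        · right
          rw [h, hr]
        · left
          rw [h, hr]
          congr 1
          ring) (by
        rw [IsometryEquiv.mul_apply, h, hr]
        congr 1
        ring)
    rw [← inv_eq_iff_mul_eq_one] at h1
    rw [← h1, sim_inv]
    congr 1
    simp

/-! ### Topology -/

/-- This reduces the topology of boxes to that of products of subsets of the line. -/
theorem isOpenEmbedding_re_im :
    Topology.IsOpenEmbedding (fun z : UpperHalfPlane => (z.re, z.im)) :=
  Complex.equivRealProdCLM.toHomeomorph.isOpenEmbedding.comp UpperHalfPlane.isOpenEmbedding_coe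

/-- The set of points with real part in `I` and imaginary part in `J`. -/
def box (I J : Set ℝ) : Set UpperHalfPlane := {z | z.re ∈ I ∧ z.im ∈ J}

theorem mem_box {I J : Set ℝ} {z : UpperHalfPlane} : z ∈ box I J ↔ z.re ∈ I ∧ z.im ∈ J := Iff.rfl

theorem box_eq_preimage (I J : Set ℝ) :
    box I J = (fun z : UpperHalfPlane => (z.re, z.im)) ⁻¹' (I ×ˢ J) := rfl

theorem interior_box (I J : Set ℝ) : interior (box I J) = box (interior I) (interior J) := by
  rw [box_eq_preimage, box_eq_preimage, ← interior_prod_eq,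
    isOpenEmbedding_re_im.isOpenMap.preimage_interior_eq_interior_preimage
      isOpenEmbedding_re_im.continuous]

theorem closure_box (I J : Set ℝ) : closure (box I J) = box (closure I) (closure J) := by
  rw [box_eq_preimage, box_eq_preimage, ← closure_prod_eq,
    isOpenEmbedding_re_im.isOpenMap.preimage_closure_eq_closure_preimage
      isOpenEmbedding_re_im.continuous]

theorem isConnected_box {I J : Set ℝ} (hI : IsConnected I) (hJ : IsConnected J)
    (h : J ⊆ Ioi 0) : IsConnected (box I J) := by
  have h1 : (fun z : UpperHalfPlane => (z.re, z.im)) '' box I J = I ×ˢ J := by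
    ext ⟨a, b⟩
    constructor
    · rintro ⟨z, hz, h2⟩
      rw [← h2]
      exact hz
    · rintro ⟨ha, hb⟩
      exact ⟨⟨⟨a, b⟩, h hb⟩, ⟨ha, hb⟩, rfl⟩
  constructor
  · have := hI.nonempty.prod hJ.nonempty
    rw [← h1] at this
    exact this.of_image
  · rw [← isOpenEmbedding_re_im.isInducing.isPreconnected_image, h1]
    exact (hI.prod hJ).isPreconnected

theorem rect_eq_box (x r : ℝ) (i j : ℤ) :
    rect x r i j = box (Icc (x - r) (x + r)) (Icc (2 ^ i) (2 ^ j)) := by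
  ext z
  rw [mem_rect, mem_box, abs_sub_le_iff, mem_Icc, mem_Icc]
  constructor <;> rintro ⟨⟨h1, h2⟩, h3⟩ <;> exact ⟨⟨by linarith, by linarith⟩, h3⟩

theorem mem_interior_rect {x r : ℝ} {i j : ℤ} {z : UpperHalfPlane} :
    z ∈ interior (rect x r i j) ↔ |z.re - x| < r ∧ 2 ^ i < z.im ∧ z.im < 2 ^ j := by
  rw [rect_eq_box, interior_box, interior_Icc, interior_Icc, mem_box, abs_sub_lt_iff, mem_Ioo,
    mem_Ioo]
  constructor <;> rintro ⟨⟨h1, h2⟩, h3⟩ <;> exact ⟨⟨by linarith, by linarith⟩, h3⟩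

theorem closure_interior_rect {x r : ℝ} {i j : ℤ} (hr : 0 < r) (hij : i < j) :
    closure (interior (rect x r i j)) = rect x r i j := by
  have h : (2 : ℝ) ^ i < 2 ^ j := zpow_lt_zpow_right₀ one_lt_two hij
  rw [rect_eq_box, interior_box, closure_box, interior_Icc, interior_Icc,
    closure_Ioo (by linarith), closure_Ioo h.ne]

theorem isClosed_rect (x r : ℝ) (i j : ℤ) : IsClosed (rect x r i j) := by
  rw [← closure_eq_iff_isClosed, rect_eq_box, closure_box, isClosed_Icc.closure_eq,
    isClosed_Icc.closure_eq]

/-! ### Orientation preserving isometries -/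

/-- The isometry given by a matrix of determinant one. -/
def slIso (A : Matrix.SpecialLinearGroup (Fin 2) ℝ) : UpperHalfPlane ≃ᵢ UpperHalfPlane :=
  IsometryEquiv.constSMul A

theorem slIso_apply (A : Matrix.SpecialLinearGroup (Fin 2) ℝ) (z : UpperHalfPlane) :
    slIso A z = A • z := rfl

theorem slIso_mul (A B : Matrix.SpecialLinearGroup (Fin 2) ℝ) :
    slIso (A * B) = slIso A * slIso B :=
  IsometryEquiv.ext fun z => mul_smul A B z

theorem slIso_inv (A : Matrix.SpecialLinearGroup (Fin 2) ℝ) : slIso A⁻¹ = (slIso A)⁻¹ := by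
  refine eq_inv_of_mul_eq_one_left ?_
  rw [← slIso_mul, inv_mul_cancel]
  exact IsometryEquiv.ext fun z => one_smul (Matrix.SpecialLinearGroup (Fin 2) ℝ) z

theorem coe_slIso (A : Matrix.SpecialLinearGroup (Fin 2) ℝ) (z : UpperHalfPlane) :
    ((slIso A z : UpperHalfPlane) : ℂ) * (A 1 0 * z + A 1 1) = A 0 0 * z + A 0 1 := by
  rw [slIso_apply, UpperHalfPlane.specialLinearGroup_apply]
  have h : ((A 1 0 : ℝ) : ℂ) * z + (A 1 1 : ℝ) ≠ 0 := by
    refine UpperHalfPlane.linear_ne_zero (cd := ![A 1 0, A 1 1]) z ?_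
    intro h
    have h0 : A 1 0 = 0 := congrFun h 0
    have h1 : A 1 1 = 0 := congrFun h 1
    have := A.det_coe
    rw [Matrix.det_fin_two] at this
    simp [h0, h1] at this
  simp only [Algebra.algebraMap_self, RingHom.id_apply]
  exact div_mul_cancel₀ _ h

/-- This makes the labels `b₁` and `b₂` well defined, as the reflection is the only nontrivial
symmetry of the prototile. The values at `i`, `2 i` and `1 + i` would make the determinant vanish.
-/
theorem slIso_ne_reflection (A : Matrix.SpecialLinearGroup (Fin 2) ℝ) :
    slIso A ≠ sim (-1) 0 0 := by
  intro h
  have key : ∀ (x : ℝ) (i : ℤ), A 1 0 * (-x ^ 2 - (2 ^ i) ^ 2) - A 1 1 * x =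
      A 0 0 * x + A 0 1 ∧ A 1 1 * 2 ^ i = A 0 0 * 2 ^ i := by
    intro x i
    have h1 := coe_slIso A (horoPt x i)
    rw [h] at h1
    have h2 := congrArg Complex.re h1
    have h3 := congrArg Complex.im h1
    simp at h2 h3
    exact ⟨by linear_combination h2, by linear_combination h3⟩
  have k1 := key 0 0
  have k2 := key 0 1
  have k3 := key 1 0
  have := A.det_coe
  rw [Matrix.det_fin_two] at this
  simp at k1 k2 k3
  have h0 : A 1 0 = 0 := by linarith [k1.1, k2.1]
  have h1 : A 0 1 = 0 := by linarith [k1.1]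
  have h2 : A 0 0 = 0 := by linarith [k1.2, k3.1]
  rw [h0, h2] at this
  simp at this

theorem exists_slIso_eq_sim (m : ℤ) (b : ℝ) : ∃ A, slIso A = sim 1 m b := by
  refine ⟨(horoPt b m).toSL2R, IsometryEquiv.ext fun z => ?_⟩
  have h := coe_slIso (horoPt b m).toSL2R z
  have hm : (0 : ℝ) < 2 ^ m := by positivity
  have hs : √((2 : ℝ) ^ m) ≠ 0 := (Real.sqrt_pos.2 hm).ne'
  have hs' : ((√((2 : ℝ) ^ m) : ℝ) : ℂ) ≠ 0 := by exact_mod_cast hs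
  have hsq : ((√((2 : ℝ) ^ m) : ℝ) : ℂ) * (√((2 : ℝ) ^ m) : ℝ) = ((2 ^ m : ℝ) : ℂ) := by
    exact_mod_cast Real.mul_self_sqrt hm.le
  simp [UpperHalfPlane.coe_toSL2R] at h
  have h2 : ((slIso (horoPt b m).toSL2R z : UpperHalfPlane) : ℂ) = ((2 ^ m : ℝ) : ℂ) * z + b := by
    rw [← hsq]
    field_simp at h
    rw [h]
    ring
  apply UpperHalfPlane.ext_re_im
  · rw [← UpperHalfPlane.coe_re, h2, Complex.add_re, Complex.re_ofReal_mul]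
    simp
  · rw [← UpperHalfPlane.coe_im, h2, Complex.add_im, Complex.im_ofReal_mul]
    simp

/-- For `x = z.re` and `t = |z| ^ 2 - 1` the expression is the numerator of the real part of the
image of `z` under a rotation about `i`. It changes from `x` to `-x` between the angle parameters
`0` and `π / 2`. -/
theorem exists_cos_sin (x t : ℝ) :
    ∃ c s : ℝ, c ^ 2 + s ^ 2 = 1 ∧ c * s * t + (c ^ 2 - s ^ 2) * x = 0 := by
  let f : ℝ → ℝ := fun θ => Real.cos θ * Real.sin θ * t +
    (Real.cos θ ^ 2 - Real.sin θ ^ 2) * x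
  have hf : Continuous f := by fun_prop
  have hmem : (0 : ℝ) ∈ uIcc (f 0) (f (Real.pi / 2)) := by
    simp only [f, Real.cos_zero, Real.sin_zero, Real.cos_pi_div_two, Real.sin_pi_div_two]
    rw [mem_uIcc]
    rcases le_total x 0 with h | h
    · left
      constructor <;> linarith
    · right
      constructor <;> linarith
  obtain ⟨θ, -, hθ⟩ := intermediate_value_uIcc hf.continuousOn hmem
  exact ⟨Real.cos θ, Real.sin θ, Real.cos_sq_add_sin_sq θ, hθ⟩

theorem exists_rotation_re_eq_zero (z : UpperHalfPlane) :
    ∃ A, slIso A (horoPt 0 0) = horoPt 0 0 ∧ (slIso A z).re = 0 := by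
  obtain ⟨c, s, hcs, hθ⟩ := exists_cos_sin z.re (z.re ^ 2 + z.im ^ 2 - 1)
  refine ⟨⟨!![c, -s; s, c], ?_⟩, ?_, ?_⟩
  · rw [Matrix.det_fin_two]
    simp
    linarith
  · set A : Matrix.SpecialLinearGroup (Fin 2) ℝ :=
      ⟨!![c, -s; s, c], _⟩ with hA
    have h := coe_slIso A (horoPt 0 0)
    have h1 := congrArg Complex.re h
    have h2 := congrArg Complex.im h
    simp [hA] at h1 h2
    rw [← hA] at h1 h2
    apply UpperHalfPlane.ext_re_im
    · rw [horoPt_re]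
      linear_combination c * h1 + s * h2 - (slIso A (horoPt 0 0)).re * hcs
    · rw [horoPt_im, zpow_zero]
      linear_combination c * h2 - s * h1 - (slIso A (horoPt 0 0)).im * hcs + hcs
  · set A : Matrix.SpecialLinearGroup (Fin 2) ℝ :=
      ⟨!![c, -s; s, c], _⟩ with hA
    have h := coe_slIso A z
    have h1 := congrArg Complex.re h
    have h2 := congrArg Complex.im h
    simp [hA] at h1 h2
    rw [← hA] at h1 h2
    have h3 : (slIso A z).re * ((s * z.re + c) ^ 2 + (s * z.im) ^ 2) =
        0 := by
      rw [← hθ]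
      linear_combination (s * z.re + c) * h1 + s * z.im * h2
    refine (mul_eq_zero.1 h3).resolve_right ?_
    intro h4
    have h5 : s * z.im = 0 := by
      nlinarith [sq_nonneg (s * z.re + c), sq_nonneg (s * z.im)]
    have h6 : s = 0 := (mul_eq_zero.1 h5).resolve_right z.im_ne_zero
    rw [h6] at h4 hcs
    nlinarith

/-- Transitivity moves `z` to `i` and a rotation about `i` moves `z'` to the imaginary axis. The
distance leaves `2 i` and `i / 2`, which `z ↦ -1 / z` exchanges. -/
theorem exists_slIso_map_pair {z z' : UpperHalfPlane}
    (h : dist z z' = dist (horoPt 0 0) (horoPt 0 1)) :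
    ∃ A, slIso A z = horoPt 0 0 ∧ slIso A z' = horoPt 0 1 := by
  obtain ⟨A, hA⟩ := MulAction.exists_smul_eq (Matrix.SpecialLinearGroup (Fin 2) ℝ) z (horoPt 0 0)
  obtain ⟨B, hB, hB'⟩ := exists_rotation_re_eq_zero (slIso A z')
  rw [← slIso_apply] at hA
  have h1 : slIso (B * A) z = horoPt 0 0 := by
    rw [slIso_mul, IsometryEquiv.mul_apply, hA, hB]
  have h2 : (slIso (B * A) z').re = 0 := by
    rw [slIso_mul, IsometryEquiv.mul_apply, hB']
  have h3 := (slIso (B * A)).isometry.dist_eq z z'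
  rw [h, h1, dist_eq_iff_distQuot] at h3
  have hp := (slIso (B * A) z').im_pos
  simp only [distQuot, horoPt_re, horoPt_im, h2, zpow_zero, zpow_one] at h3
  rw [div_eq_div_iff (by positivity) (by positivity)] at h3
  have h4 : ((slIso (B * A) z').im - 2) * (2 * (slIso (B * A) z').im - 1) = 0 := by
    linear_combination h3
  rcases mul_eq_zero.1 h4 with h5 | h5
  · refine ⟨B * A, h1, UpperHalfPlane.ext_re_im h2 ?_⟩
    rw [horoPt_im, zpow_one]
    linarith
  · let S : Matrix.SpecialLinearGroup (Fin 2) ℝ := ⟨!![0, -1; 1, 0], by simp [Matrix.det_fin_two]⟩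
    have hS : ∀ u : UpperHalfPlane, u.re = 0 → (slIso S u).re = 0 ∧ (slIso S u).im * u.im = 1 := by
      intro u hu
      have h := coe_slIso S u
      have h1 := congrArg Complex.re h
      have h2 := congrArg Complex.im h
      simp [S, hu] at h1 h2
      exact ⟨h2.resolve_right u.im_ne_zero, h1⟩
    refine ⟨S * (B * A), ?_, ?_⟩
    · rw [slIso_mul, IsometryEquiv.mul_apply, h1]
      obtain ⟨k1, k2⟩ := hS (horoPt 0 0) rfl
      apply UpperHalfPlane.ext_re_im k1
      simpa using k2
    · rw [slIso_mul, IsometryEquiv.mul_apply]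
      obtain ⟨k1, k2⟩ := hS _ h2
      apply UpperHalfPlane.ext_re_im k1
      rw [horoPt_im, zpow_one]
      have h6 : (slIso (B * A) z').im = 1 / 2 := by linarith
      rw [h6] at k2
      linarith

/-- Every isometry of the hyperbolic plane is a Möbius transformation or a Möbius transformation
after the reflection in the imaginary axis. -/
theorem exists_slIso_eq (g : UpperHalfPlane ≃ᵢ UpperHalfPlane) :
    ∃ A, g = slIso A ∨ g = slIso A * sim (-1) 0 0 := by
  obtain ⟨A, h0, h1⟩ := exists_slIso_map_pair (g.isometry.dist_eq (horoPt 0 0) (horoPt 0 1))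
  refine ⟨A⁻¹, ?_⟩
  rw [slIso_inv]
  have := eq_one_or_reflection (slIso A * g) (x := 0) (i := 0) (j := 1) (by simp) h0 h1
  rw [mul_zero, mul_eq_one_iff_inv_eq, eq_comm (a := (slIso A)⁻¹)] at this
  refine this.imp id fun h => ?_
  rw [← h, inv_mul_cancel_left]

/-! ### The prototile and its edges -/

theorem proto_eq (w : ℝ) : proto w = rect 0 w 0 1 := by
  ext z
  simp [proto, rect, abs_le, and_assoc]

theorem protoA_eq (w : ℝ) : protoA w = rect 0 w 1 1 := by
  ext z
  simp only [protoA, rect, abs_le, mem_ofPred_eq, zpow_one, sub_zero, le_antisymm_iff (a := z.im)]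
  tauto

theorem protoB1_eq (w : ℝ) : protoB1 w = rect (-(w / 2)) (w / 2) 0 0 := by
  ext z
  simp only [protoB1, rect, abs_le, zpow_zero, mem_ofPred_eq]
  constructor
  · rintro ⟨h1, h2, h3⟩
    refine ⟨⟨?_, ?_⟩, ?_, ?_⟩ <;> linarith
  · rintro ⟨⟨h1, h2⟩, h3, h4⟩
    refine ⟨?_, ?_, ?_⟩ <;> linarith

theorem protoB2_eq (w : ℝ) : protoB2 w = rect (w / 2) (w / 2) 0 0 := by
  ext z
  simp only [protoB2, rect, abs_le, zpow_zero, mem_ofPred_eq]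
  constructor
  · rintro ⟨h1, h2, h3⟩
    refine ⟨⟨?_, ?_⟩, ?_, ?_⟩ <;> linarith
  · rintro ⟨⟨h1, h2⟩, h3, h4⟩
    refine ⟨?_, ?_, ?_⟩ <;> linarith

theorem protoC_eq (x : ℝ) : protoC x = rect x 0 0 1 := by
  ext z
  simp [protoC, rect, sub_eq_zero]

theorem protoVertices_eq (w : ℝ) : protoVertices w =
    {horoPt (-w) 1, horoPt w 1, horoPt (-w) 0, horoPt 0 0, horoPt w 0} := by
  ext z
  simp only [protoVertices, mem_ofPred_eq, mem_insert_iff, mem_singleton_iff]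
  have key : ∀ x i, z = horoPt x i ↔ z.im = 2 ^ i ∧ z.re = x := fun x i =>
    ⟨fun h => by rw [h]; exact ⟨rfl, rfl⟩, fun h => UpperHalfPlane.ext_re_im h.2 h.1⟩
  simp only [key, zpow_zero, zpow_one]
  tauto

theorem exists_three_of_infinite {S : Set ℝ} (hS : S.Infinite) :
    ∃ x ∈ S, ∃ y ∈ S, ∃ z ∈ S, x ≠ y ∧ x ≠ z ∧ y ≠ z := by
  obtain ⟨x, hx⟩ := hS.nonempty
  obtain ⟨y, hy, hy'⟩ := hS.exists_notMem_finset {x}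
  obtain ⟨z, hz, hz'⟩ := hS.exists_notMem_finset {x, y}
  simp only [Finset.mem_singleton, Finset.mem_insert, not_or] at hy' hz'
  exact ⟨x, hx, y, hy, z, hz, Ne.symm hy', Ne.symm hz'.1, Ne.symm hz'.2⟩

/-- The prototile has exactly two symmetries. -/
theorem stabilizer_proto {w : ℝ} (hw : 0 < w) (g : UpperHalfPlane ≃ᵢ UpperHalfPlane)
    (hg : g '' rect 0 w 0 1 = rect 0 w 0 1) : g = 1 ∨ g = sim (-1) 0 0 := by
  have hsim : ∀ ε m b, g = sim ε m b → g = 1 ∨ g = sim (-1) 0 0 := by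
    rintro ε m b rfl
    rw [sim_image_rect, eq_comm] at hg
    obtain ⟨h1, -, h3, -⟩ := rect_injective hw.le zero_le_one hg
    have hm : m = 0 := by omega
    have hb : b = 0 := by simpa using h1.symm
    subst hm hb
    rcases Int.units_eq_one_or ε with rfl | rfl
    · exact Or.inl sim_one_zero
    · exact Or.inr rfl
  -- The `a`-edge goes into the boundary, which lies on two horocycles and two vertical lines. By
  -- pigeonhole one of them receives three points: a vertical line cannot, and a horizontal
  -- horocycle makes `g` a similarity.
  have hmem : ∀ x ∈ Icc (-w) w, (g (horoPt x 1)).im = 2 ^ (0 : ℤ) ∨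
      (g (horoPt x 1)).im = 2 ^ (1 : ℤ) ∨ (g (horoPt x 1)).re = w ∨ (g (horoPt x 1)).re = -w := by
    intro x hx
    have h1 : horoPt x 1 ∈ rect 0 w 0 1 := by
      rw [horoPt_mem_rect, sub_zero, abs_le]
      exact ⟨hx, zero_le_one, le_rfl⟩
    have h2 : g (horoPt x 1) ∈ rect 0 w 0 1 := by
      rw [← hg]
      exact mem_image_of_mem _ h1
    have h3 : g (horoPt x 1) ∉ interior (rect 0 w 0 1) := by
      rw [← hg, ← IsometryEquiv.coe_toHomeomorph, ← Homeomorph.image_interior,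
        (Homeomorph.injective _).mem_set_image, mem_interior_rect]
      rintro ⟨-, -, h⟩
      simp at h
    rw [mem_interior_rect] at h3
    rw [mem_rect] at h2
    by_contra! hne
    apply h3
    refine ⟨lt_of_le_of_ne h2.1 ?_, lt_of_le_of_ne h2.2.1 hne.1.symm,
      lt_of_le_of_ne h2.2.2 hne.2.1⟩
    rw [sub_zero]
    intro h
    rcases (abs_eq hw.le).1 h with h | h
    · exact hne.2.2.1 h
    · exact hne.2.2.2 h
  have hinf : (Icc (-w) w).Infinite := Icc_infinite (by linarith)
  have hcov : Icc (-w) w ⊆ (({x | (g (horoPt x 1)).im = 2 ^ (0 : ℤ)} ∪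
      {x | (g (horoPt x 1)).im = 2 ^ (1 : ℤ)}) ∪ ({x | (g (horoPt x 1)).re = w} ∪
      {x | (g (horoPt x 1)).re = -w})) := by
    intro x hx
    rcases hmem x hx with h | h | h | h
    · exact Or.inl (Or.inl h)
    · exact Or.inl (Or.inr h)
    · exact Or.inr (Or.inl h)
    · exact Or.inr (Or.inr h)
  have hinf' := hinf.mono hcov
  simp only [infinite_union] at hinf'
  rcases hinf' with (h | h) | (h | h) <;>
    obtain ⟨x, hx, y, hy, z, hz, hxy, hxz, hyz⟩ := exists_three_of_infinite h <;>
    rw [mem_ofPred_eq] at hx hy hz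
  · obtain ⟨ε, b, h⟩ := eq_sim_of_horoPt g hxy hxz hyz hx hy hz
    exact hsim _ _ _ h
  · obtain ⟨ε, b, h⟩ := eq_sim_of_horoPt g hxy hxz hyz hx hy hz
    exact hsim _ _ _ h
  · exact (not_re_eq_of_horoPt g hxy hxz hyz (hx.trans hy.symm) (hy.trans hz.symm)).elim
  · exact (not_re_eq_of_horoPt g hxy hxz hyz (hx.trans hy.symm) (hy.trans hz.symm)).elim

theorem mul_image (g h : UpperHalfPlane ≃ᵢ UpperHalfPlane) (s : Set UpperHalfPlane) :
    (g * h) '' s = g '' (h '' s) := (image_image g h s).symm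

theorem inv_image_image (g : UpperHalfPlane ≃ᵢ UpperHalfPlane) (s : Set UpperHalfPlane) :
    (g⁻¹ : UpperHalfPlane ≃ᵢ UpperHalfPlane) '' (g '' s) = s := by
  rw [← mul_image, inv_mul_cancel]
  exact image_id s

/-- The edge predicates quantify over all isometries onto a tile. As there are only two of them, the
edges can be read off from any one. -/
theorem eq_or_eq_mul_reflection {w : ℝ} (hw : 0 < w) {g h : UpperHalfPlane ≃ᵢ UpperHalfPlane}
    (hgh : g '' proto w = h '' proto w) : h = g ∨ h = g * sim (-1) 0 0 := by
  have h1 : (g⁻¹ * h) '' rect 0 w 0 1 = rect 0 w 0 1 := by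
    rw [mul_image, ← proto_eq, ← hgh, inv_image_image]
  rcases stabilizer_proto hw _ h1 with h2 | h2
  · left
    exact (inv_mul_eq_one.1 h2).symm
  · right
    rw [← h2, mul_inv_cancel_left]

theorem reflection_image_rect (x r : ℝ) (i j : ℤ) :
    sim (-1) 0 0 '' rect x r i j = rect (-x) r i j := by
  rw [sim_image_rect]
  simp

theorem isAEdge_image_proto {w : ℝ} (hw : 0 < w) (g : UpperHalfPlane ≃ᵢ UpperHalfPlane)
    (e : Set UpperHalfPlane) : IsAEdge w (g '' proto w) e ↔ e = g '' rect 0 w 1 1 := by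
  rw [← protoA_eq]
  constructor
  · rintro ⟨h, h1, h2⟩
    rcases eq_or_eq_mul_reflection hw h1 with rfl | rfl
    · exact h2
    · rw [h2, mul_image, protoA_eq, reflection_image_rect, neg_zero]
  · intro h
    exact ⟨g, rfl, h⟩

theorem isBEdge_image_proto {w : ℝ} (hw : 0 < w) (g : UpperHalfPlane ≃ᵢ UpperHalfPlane)
    (e : Set UpperHalfPlane) : IsBEdge w (g '' proto w) e ↔
      e = g '' rect (-(w / 2)) (w / 2) 0 0 ∨ e = g '' rect (w / 2) (w / 2) 0 0 := by
  rw [← protoB1_eq, ← protoB2_eq]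
  constructor
  · rintro ⟨h, h1, h2⟩
    rcases eq_or_eq_mul_reflection hw h1 with rfl | rfl
    · exact h2
    · rw [mul_image, mul_image, protoB1_eq, protoB2_eq, reflection_image_rect,
        reflection_image_rect, neg_neg] at h2
      rw [protoB1_eq, protoB2_eq]
      exact h2.symm
  · intro h
    exact ⟨g, rfl, h⟩

theorem isCEdgeFrom_image_proto {w : ℝ} (hw : 0 < w) (g : UpperHalfPlane ≃ᵢ UpperHalfPlane)
    (e : Set UpperHalfPlane) (p : UpperHalfPlane) : IsCEdgeFrom w (g '' proto w) e p ↔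
      ∃ η : ℤˣ, e = g '' rect ((η : ℤ) * w) 0 0 1 ∧ p = g (horoPt ((η : ℤ) * w) 1) := by
  constructor
  · rintro ⟨h, h1, x, hx, h2, q, hq, hq', h3⟩
    have hq'' : q = horoPt x 1 := UpperHalfPlane.ext_re_im hq (by simp [hq'])
    have hx' : ∃ η : ℤˣ, x = (η : ℤ) * w := by
      rcases hx with rfl | rfl
      · exact ⟨-1, by simp⟩
      · exact ⟨1, by simp⟩
    obtain ⟨η, rfl⟩ := hx'
    rw [protoC_eq] at h2
    subst hq''
    rcases eq_or_eq_mul_reflection hw h1 with rfl | rfl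
    · exact ⟨η, h2, h3⟩
    · refine ⟨-η, ?_, ?_⟩
      · rw [h2, mul_image, reflection_image_rect]
        simp
      · rw [h3, IsometryEquiv.mul_apply, sim_horoPt]
        simp
  · rintro ⟨η, h1, h2⟩
    refine ⟨g, rfl, (η : ℤ) * w, ?_, by rw [protoC_eq, h1], _, rfl, by simp, h2⟩
    rcases Int.units_eq_one_or η with rfl | rfl <;> simp

theorem isVertex_image_proto {w : ℝ} (hw : 0 < w) (g : UpperHalfPlane ≃ᵢ UpperHalfPlane)
    (v : UpperHalfPlane) (hv : IsVertex w (g '' proto w) v) : v ∈ g '' protoVertices w := by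
  obtain ⟨h, h1, h2⟩ := hv
  rcases eq_or_eq_mul_reflection hw h1 with rfl | rfl
  · exact h2
  · rw [mul_image] at h2
    refine image_mono ?_ h2
    rw [protoVertices_eq]
    rintro _ ⟨u, hu, rfl⟩
    simp only [mem_insert_iff, mem_singleton_iff] at hu ⊢
    rcases hu with rfl | rfl | rfl | rfl | rfl <;> simp [sim_horoPt]

theorem eq_of_slIso_image_proto {w : ℝ} (hw : 0 < w) {A B : Matrix.SpecialLinearGroup (Fin 2) ℝ}
    (h : slIso A '' proto w = slIso B '' proto w) : slIso B = slIso A := by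
  rcases eq_or_eq_mul_reflection hw h with h | h
  · exact h
  · rw [← inv_mul_eq_iff_eq_mul, ← slIso_inv, ← slIso_mul] at h
    exact (slIso_ne_reflection _ h).elim

theorem isB1Edge_image_proto {w : ℝ} (hw : 0 < w) (A : Matrix.SpecialLinearGroup (Fin 2) ℝ)
    (e : Set UpperHalfPlane) : IsB1Edge w (slIso A '' proto w) e ↔
      e = slIso A '' rect (-(w / 2)) (w / 2) 0 0 := by
  rw [← protoB1_eq]
  constructor
  · rintro ⟨B, h1, h2⟩
    rw [h2, ← eq_of_slIso_image_proto hw h1]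
    rfl
  · intro h
    exact ⟨A, rfl, h⟩

theorem isB2Edge_image_proto {w : ℝ} (hw : 0 < w) (A : Matrix.SpecialLinearGroup (Fin 2) ℝ)
    (e : Set UpperHalfPlane) : IsB2Edge w (slIso A '' proto w) e ↔
      e = slIso A '' rect (w / 2) (w / 2) 0 0 := by
  rw [← protoB2_eq]
  constructor
  · rintro ⟨B, h1, h2⟩
    rw [h2, ← eq_of_slIso_image_proto hw h1]
    rfl
  · intro h
    exact ⟨A, rfl, h⟩

theorem IsPentagon.exists_slIso {w : ℝ} {T : Set UpperHalfPlane} (hT : IsPentagon w T) :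
    ∃ A, T = slIso A '' proto w := by
  obtain ⟨g, rfl⟩ := hT
  obtain ⟨A, rfl | rfl⟩ := exists_slIso_eq g
  · exact ⟨A, rfl⟩
  · refine ⟨A, ?_⟩
    rw [mul_image, proto_eq, reflection_image_rect, neg_zero]

/-! ### Tiles of all sizes -/

/-- The copy of the prototile under `z ↦ 2 ^ k z + x`. -/
def cell (w : ℝ) (k : ℤ) (x : ℝ) : Set UpperHalfPlane := rect x (2 ^ k * w) k (k + 1)

theorem sim_image_proto (w : ℝ) (ε : ℤˣ) (k : ℤ) (x : ℝ) : sim ε k x '' proto w = cell w k x := by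
  rw [proto_eq, sim_image_rect, cell]
  simp

theorem image_cell_eq (w : ℝ) (g : UpperHalfPlane ≃ᵢ UpperHalfPlane) (k : ℤ) (x : ℝ) :
    g '' cell w k x = (g * sim 1 k x) '' proto w := by
  rw [mul_image, sim_image_proto]

theorem sim_image_cell (w : ℝ) (ε : ℤˣ) (m k : ℤ) (b x : ℝ) :
    sim ε m b '' cell w k x = cell w (m + k) ((ε : ℤ) * 2 ^ m * x + b) := by
  rw [cell, sim_image_rect, cell, zpow_add₀ (two_ne_zero' ℝ), add_assoc, mul_assoc (2 ^ m : ℝ)]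

theorem isAEdge_image_cell {w : ℝ} (hw : 0 < w) (g : UpperHalfPlane ≃ᵢ UpperHalfPlane) (k : ℤ)
    (x : ℝ) (e : Set UpperHalfPlane) : IsAEdge w (g '' cell w k x) e ↔
      e = g '' rect x (2 ^ k * w) (k + 1) (k + 1) := by
  rw [image_cell_eq, isAEdge_image_proto hw, mul_image, sim_image_rect]
  simp

theorem isBEdge_image_cell {w : ℝ} (hw : 0 < w) (g : UpperHalfPlane ≃ᵢ UpperHalfPlane) (k : ℤ)
    (x : ℝ) (e : Set UpperHalfPlane) : IsBEdge w (g '' cell w k x) e ↔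
      ∃ η : ℤˣ, e = g '' rect (x + (η : ℤ) * (2 ^ k * (w / 2))) (2 ^ k * (w / 2)) k k := by
  have h1 : (((1 : ℤˣ) : ℤ) : ℝ) * 2 ^ k * -(w / 2) + x =
      x + ((-1 : ℤˣ) : ℤ) * (2 ^ k * (w / 2)) := by
    push_cast
    ring
  have h2 : (((1 : ℤˣ) : ℤ) : ℝ) * 2 ^ k * (w / 2) + x =
      x + ((1 : ℤˣ) : ℤ) * (2 ^ k * (w / 2)) := by
    push_cast
    ring
  rw [image_cell_eq, isBEdge_image_proto hw, mul_image, mul_image, sim_image_rect, sim_image_rect,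
    h1, h2, add_zero]
  constructor
  · rintro (h | h)
    · exact ⟨-1, h⟩
    · exact ⟨1, h⟩
  · rintro ⟨η, h⟩
    rcases Int.units_eq_one_or η with rfl | rfl
    · exact Or.inr h
    · exact Or.inl h

theorem isCEdgeFrom_image_cell {w : ℝ} (hw : 0 < w) (g : UpperHalfPlane ≃ᵢ UpperHalfPlane) (k : ℤ)
    (x : ℝ) (e : Set UpperHalfPlane) (p : UpperHalfPlane) :
    IsCEdgeFrom w (g '' cell w k x) e p ↔
      ∃ η : ℤˣ, e = g '' rect (x + (η : ℤ) * (2 ^ k * w)) 0 k (k + 1) ∧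
        p = g (horoPt (x + (η : ℤ) * (2 ^ k * w)) (k + 1)) := by
  have h1 : ∀ η : ℤˣ, (((1 : ℤˣ) : ℤ) : ℝ) * 2 ^ k * ((η : ℤ) * w) + x =
      x + (η : ℤ) * (2 ^ k * w) := by
    intro η
    push_cast
    ring
  rw [image_cell_eq, isCEdgeFrom_image_proto hw]
  simp only [mul_image, sim_image_rect, h1, IsometryEquiv.mul_apply, sim_horoPt, mul_zero, add_zero]

theorem isB1Edge_image_cell {w : ℝ} (hw : 0 < w) (A : Matrix.SpecialLinearGroup (Fin 2) ℝ) (k : ℤ)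
    (x : ℝ) (e : Set UpperHalfPlane) : IsB1Edge w (slIso A '' cell w k x) e ↔
      e = slIso A '' rect (x - 2 ^ k * (w / 2)) (2 ^ k * (w / 2)) k k := by
  obtain ⟨B, hB⟩ := exists_slIso_eq_sim k x
  rw [image_cell_eq, ← hB, ← slIso_mul, isB1Edge_image_proto hw, slIso_mul, hB, mul_image,
    sim_image_rect]
  have h1 : (((1 : ℤˣ) : ℤ) : ℝ) * 2 ^ k * -(w / 2) + x = x - 2 ^ k * (w / 2) := by
    push_cast
    ring
  rw [h1, add_zero]

theorem isB2Edge_image_cell {w : ℝ} (hw : 0 < w) (A : Matrix.SpecialLinearGroup (Fin 2) ℝ) (k : ℤ)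
    (x : ℝ) (e : Set UpperHalfPlane) : IsB2Edge w (slIso A '' cell w k x) e ↔
      e = slIso A '' rect (x + 2 ^ k * (w / 2)) (2 ^ k * (w / 2)) k k := by
  obtain ⟨B, hB⟩ := exists_slIso_eq_sim k x
  rw [image_cell_eq, ← hB, ← slIso_mul, isB2Edge_image_proto hw, slIso_mul, hB, mul_image,
    sim_image_rect]
  have h1 : (((1 : ℤˣ) : ℤ) : ℝ) * 2 ^ k * (w / 2) + x = x + 2 ^ k * (w / 2) := by
    push_cast
    ring
  rw [h1, add_zero]

/-! ### Local finiteness -/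

theorem interior_image (g : UpperHalfPlane ≃ᵢ UpperHalfPlane) (s : Set UpperHalfPlane) :
    interior (g '' s) = g '' interior s :=
  (g.toHomeomorph.image_interior s).symm

theorem closure_image (g : UpperHalfPlane ≃ᵢ UpperHalfPlane) (s : Set UpperHalfPlane) :
    closure (g '' s) = g '' closure s :=
  (g.toHomeomorph.image_closure s).symm

theorem IsPentagon.isClosed {w : ℝ} {T : Set UpperHalfPlane} (hT : IsPentagon w T) :
    IsClosed T := by
  obtain ⟨g, rfl⟩ := hT
  rw [proto_eq]
  exact g.toHomeomorph.isClosedMap _ (isClosed_rect _ _ _ _)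

/-- The point `3 / 2 i`, which lies in the interior of the prototile. -/
def protoCenter : UpperHalfPlane := ⟨⟨0, 3 / 2⟩, by norm_num⟩

theorem protoCenter_mem_interior {w : ℝ} (hw : 0 < w) : protoCenter ∈ interior (proto w) := by
  have h1 : protoCenter.re = 0 := rfl
  have h2 : protoCenter.im = 3 / 2 := rfl
  rw [proto_eq, mem_interior_rect, h1, h2]
  norm_num
  exact hw

theorem exists_dist_protoCenter_le (w : ℝ) : ∃ D, ∀ z ∈ proto w, dist z protoCenter ≤ D := by
  -- The bound comes from `d ≤ exp d ≤ 2 * cosh d` and `cosh d = 1 + distQuot / 2`.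
  refine ⟨2 * (1 + (w ^ 2 + 1) / 2), ?_⟩
  intro z hz
  rw [proto_eq, mem_rect, sub_zero, zpow_zero, zpow_one] at hz
  have h1 : protoCenter.re = 0 := rfl
  have h2 : protoCenter.im = 3 / 2 := rfl
  have h3 : distQuot z protoCenter ≤ w ^ 2 + 1 := by
    rw [distQuot, h1, h2, div_le_iff₀ (by linarith), sub_zero]
    have h4 : z.re ^ 2 ≤ w ^ 2 := sq_le_sq' (abs_le.1 hz.1).1 (abs_le.1 hz.1).2
    nlinarith
  have h4 := cosh_dist_eq_distQuot z protoCenter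
  have h5 := Real.add_one_le_exp (dist z protoCenter)
  have h6 := Real.exp_pos (-dist z protoCenter)
  rw [Real.cosh_eq] at h4
  linarith

/-- Each tile contains a ball of fixed radius `r` about its centre, so the centres of different
tiles are `r`-separated. Those of the tiles in question lie in one totally bounded ball. -/
theorem IsBTiling.finite_meeting {w : ℝ} (hw : 0 < w) {𝒯 : Set (Set UpperHalfPlane)}
    (h𝒯 : IsBTiling w 𝒯) (p : UpperHalfPlane) :
    {T ∈ 𝒯 | (T ∩ Metric.closedBall p 1).Nonempty}.Finite := by
  obtain ⟨D, hD⟩ := exists_dist_protoCenter_le w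
  obtain ⟨r, hr, hball⟩ := Metric.isOpen_iff.1 isOpen_interior _ (protoCenter_mem_interior hw)
  have hex : ∀ T : Set UpperHalfPlane, ∃ c : UpperHalfPlane, IsPentagon w T →
      (∀ z ∈ T, dist z c ≤ D) ∧ Metric.ball c r ⊆ interior T := by
    intro T
    by_cases hT : IsPentagon w T
    · obtain ⟨g, rfl⟩ := hT
      refine ⟨g protoCenter, fun _ => ⟨?_, ?_⟩⟩
      · rintro _ ⟨z, hz, rfl⟩
        rw [g.isometry.dist_eq]
        exact hD z hz
      · rw [interior_image, ← g.image_ball]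
        exact image_mono hball
    · exact ⟨p, fun h => (hT h).elim⟩
  choose c hc using hex
  have htb : TotallyBounded (Metric.closedBall p (1 + D)) :=
    (isCompact_closedBall p (1 + D)).totallyBounded
  obtain ⟨t, ht, hcov⟩ := Metric.totallyBounded_iff.1 htb (r / 2) (by positivity)
  have hex2 : ∀ T : Set UpperHalfPlane, ∃ y, T ∈ 𝒯 → (T ∩ Metric.closedBall p 1).Nonempty →
      y ∈ t ∧ dist (c T) y < r / 2 := by
    intro T
    by_cases h : T ∈ 𝒯 ∧ (T ∩ Metric.closedBall p 1).Nonempty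
    · obtain ⟨h1, z, hz, hz'⟩ := h
      have h2 := (hc T (h𝒯.pentagon T h1)).1 z hz
      rw [Metric.mem_closedBall] at hz'
      have h3 : c T ∈ Metric.closedBall p (1 + D) := by
        rw [Metric.mem_closedBall]
        have := dist_triangle (c T) z p
        rw [dist_comm (c T) z] at this
        linarith
      obtain ⟨y, hy, hy'⟩ := mem_iUnion₂.1 (hcov h3)
      exact ⟨y, fun _ _ => ⟨hy, hy'⟩⟩
    · exact ⟨p, fun h1 h2 => (h ⟨h1, h2⟩).elim⟩
  choose y hy using hex2
  refine Finite.of_injOn (f := y) (fun T hT => (hy T hT.1 hT.2).1) ?_ ht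
  intro T hT T' hT' hTT'
  by_contra hne
  have h1 := (hy T hT.1 hT.2).2
  have h2 := (hy T' hT'.1 hT'.2).2
  rw [hTT'] at h1
  have h3 : dist (c T) (c T') < r := by
    have := dist_triangle_right (c T) (c T') (y T')
    linarith
  have h4 := (hc T (h𝒯.pentagon T hT.1)).2
  have h5 := (hc T' (h𝒯.pentagon T' hT'.1)).2
  refine disjoint_left.1 (h𝒯.disjoint T hT.1 T' hT'.1 hne) (h4 (Metric.mem_ball_self hr)) (h5 ?_)
  rwa [Metric.mem_ball]

/-- Near `p` only finitely many closed tiles occur. If all but `T` missed `p`, then `T` would fill a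
neighbourhood of `p`. -/
theorem IsBTiling.exists_other_tile {w : ℝ} (hw : 0 < w) {𝒯 : Set (Set UpperHalfPlane)}
    (h𝒯 : IsBTiling w 𝒯) {T : Set UpperHalfPlane} {p : UpperHalfPlane}
    (hp : p ∉ interior T) : ∃ T' ∈ 𝒯, T ≠ T' ∧ p ∈ T' := by
  by_contra! hno
  set F := {T' ∈ 𝒯 | (T' ∩ Metric.closedBall p 1).Nonempty} \ {T}
  have hF : F.Finite := (h𝒯.finite_meeting hw p).subset sdiff_subset
  have hcl : IsClosed (⋃₀ F) := by
    rw [sUnion_eq_biUnion]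
    exact hF.isClosed_biUnion fun T' hT' => (h𝒯.pentagon T' hT'.1.1).isClosed
  apply hp
  rw [mem_interior_iff_mem_nhds]
  have h1 : (⋃₀ F)ᶜ ∈ nhds p := by
    refine hcl.isOpen_compl.mem_nhds ?_
    rintro ⟨T', hT', hpT'⟩
    exact hno T' hT'.1.1 (fun h => hT'.2 h.symm) hpT'
  filter_upwards [h1, Metric.closedBall_mem_nhds p one_pos] with z hz hz'
  have h2 : z ∈ ⋃₀ 𝒯 := by rw [h𝒯.cover]; trivial
  obtain ⟨T', hT', hzT'⟩ := h2
  by_cases h : T' = T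
  · rwa [← h]
  · exact (hz ⟨T', ⟨⟨hT', z, hzT', hz'⟩, h⟩, hzT'⟩).elim

/-- A point that is no vertex excludes intersection in a vertex. The isometry `h` describes the
neighbour in the coordinates in which the given tile is the prototile. -/
theorem IsBTiling.exists_edge_neighbor {w : ℝ} (hw : 0 < w) {𝒯 : Set (Set UpperHalfPlane)}
    (h𝒯 : IsBTiling w 𝒯) {g : UpperHalfPlane ≃ᵢ UpperHalfPlane} (hg : g '' proto w ∈ 𝒯)
    {z : UpperHalfPlane} (hz : z ∈ proto w) (hz' : z ∉ interior (proto w))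
    (hz'' : z ∉ protoVertices w) : ∃ h : UpperHalfPlane ≃ᵢ UpperHalfPlane,
      g '' (h '' proto w) ∈ 𝒯 ∧ proto w ≠ h '' proto w ∧ z ∈ h '' proto w ∧
      IsEdge w (g '' proto w) (g '' proto w ∩ g '' (h '' proto w)) ∧
      IsEdge w (g '' (h '' proto w)) (g '' proto w ∩ g '' (h '' proto w)) := by
  have h1 : g z ∉ interior (g '' proto w) := by
    rwa [interior_image, g.injective.mem_set_image]
  obtain ⟨T', hT', hne, hzT'⟩ := h𝒯.exists_other_tile hw h1
  obtain ⟨g', rfl⟩ := h𝒯.pentagon T' hT'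
  have h2 : g' '' proto w = g '' ((g⁻¹ * g') '' proto w) := by
    rw [← mul_image, mul_inv_cancel_left]
  rw [h2] at hT' hne hzT'
  refine ⟨g⁻¹ * g', hT', fun h => hne (by rw [← h]), ?_, ?_⟩
  · rwa [g.injective.mem_set_image] at hzT'
  rcases h𝒯.edgeToEdge _ hg _ hT' hne ⟨g z, mem_image_of_mem _ hz, hzT'⟩ with h | ⟨v, hv, -, h⟩
  · exact h
  · exfalso
    have h3 : g z ∈ ({v} : Set UpperHalfPlane) := by
      rw [← h]
      exact ⟨mem_image_of_mem _ hz, hzT'⟩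
    rw [mem_singleton_iff] at h3
    have h4 := isVertex_image_proto hw g v hv
    rw [← h3, g.injective.mem_set_image] at h4
    exact hz'' h4

/-! ### Edges in terms of the frame of a tile -/

theorem isEdge_image_proto {w : ℝ} (hw : 0 < w) (g : UpperHalfPlane ≃ᵢ UpperHalfPlane)
    (e : Set UpperHalfPlane) (he : IsEdge w (g '' proto w) e) :
    e = g '' rect 0 w 1 1 ∨ (∃ η : ℤˣ, e = g '' rect ((η : ℤ) * (w / 2)) (w / 2) 0 0) ∨
      ∃ η : ℤˣ, e = g '' rect ((η : ℤ) * w) 0 0 1 ∧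
        IsCEdgeFrom w (g '' proto w) e (g (horoPt ((η : ℤ) * w) 1)) := by
  rcases he with he | he | ⟨p, he⟩
  · exact Or.inl ((isAEdge_image_proto hw g e).1 he)
  · right
    left
    rcases (isBEdge_image_proto hw g e).1 he with h | h
    · refine ⟨-1, ?_⟩
      rw [h]
      simp
    · refine ⟨1, ?_⟩
      rw [h]
      simp
  · right
    right
    obtain ⟨η, h1, h2⟩ := (isCEdgeFrom_image_proto hw g e p).1 he
    rw [h2] at he
    exact ⟨η, h1, he⟩

theorem eq_sim_of_image_horizontal {h : UpperHalfPlane ≃ᵢ UpperHalfPlane} {x x' r r' : ℝ} {i j : ℤ}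
    (hr' : 0 < r') (hh : h '' rect x' r' j j = rect x r i i) :
    ∃ ε b, h = sim ε (i - j) b ∧ x = (ε : ℤ) * 2 ^ (i - j) * x' + b := by
  have h1 : ∀ t, |t| ≤ r' → (h (horoPt (x' + t) j)).im = 2 ^ i := by
    intro t ht
    have h2 : h (horoPt (x' + t) j) ∈ rect x r i i := by
      rw [← hh]
      refine mem_image_of_mem _ (horoPt_mem_rect.2 ⟨?_, le_rfl, le_rfl⟩)
      rwa [add_sub_cancel_left]
    exact le_antisymm h2.2.2 h2.2.1
  obtain ⟨ε, b, rfl⟩ := eq_sim_of_horoPt h (x := x' + 0) (y := x' + r') (z := x' + -r')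
    (by simp [hr'.ne']) (by simpa using hr'.ne') (by simp; linarith)
    (h1 _ (by simpa using hr'.le)) (h1 _ (abs_of_pos hr').le) (h1 _ (by simp [abs_of_pos hr']))
  refine ⟨ε, b, rfl, ?_⟩
  rw [sim_image_rect] at hh
  exact (rect_injective (by positivity) le_rfl hh).1.symm

theorem image_vertical_ne_horizontal {h : UpperHalfPlane ≃ᵢ UpperHalfPlane} {x x' r : ℝ}
    {i j k : ℤ} (hr : 0 < r) (hh : h '' rect x' 0 j k = rect x r i i) : False := by
  have h1 : ∀ t, |t| ≤ r → (h⁻¹ (horoPt (x + t) i)).re = x' := by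
    intro t ht
    have h2 : horoPt (x + t) i ∈ h '' rect x' 0 j k := by
      rw [hh]
      refine horoPt_mem_rect.2 ⟨?_, le_rfl, le_rfl⟩
      rwa [add_sub_cancel_left]
    obtain ⟨u, hu, hu'⟩ := h2
    rw [← hu', IsometryEquiv.inv_apply_self]
    exact sub_eq_zero.1 (abs_nonpos_iff.1 hu.1)
  have e0 := h1 0 (by simpa using hr.le)
  have e1 := h1 r (abs_of_pos hr).le
  have e2 := h1 (-r) (by simp [abs_of_pos hr])
  exact not_re_eq_of_horoPt h⁻¹ (x := x + 0) (y := x + r) (z := x + -r)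
    (by simp [hr.ne']) (by simpa using hr.ne') (by simp; linarith)
    (e0.trans e1.symm) (e1.trans e2.symm)

theorem eq_of_image_vertical {h : UpperHalfPlane ≃ᵢ UpperHalfPlane} {x x' : ℝ}
    (hh : h '' rect x' 0 0 1 = rect x 0 0 1) (h1 : h (horoPt x' 1) = horoPt x 1) :
    h = sim 1 0 (x - x') ∨ h = sim (-1) 0 (x + x') := by
  have h2 : h (horoPt x' 0) = horoPt x 0 := by
    have h3 : h (horoPt x' 0) ∈ rect x 0 0 1 := by
      rw [← hh]
      exact mem_image_of_mem _ (horoPt_mem_rect.2 ⟨by simp, le_rfl, zero_le_one⟩)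
    have hre : (h (horoPt x' 0)).re = x := sub_eq_zero.1 (abs_nonpos_iff.1 h3.1)
    have h4 := distQuot_map h (horoPt x' 0) (horoPt x' 1)
    have h5 := h3.2.2
    have h6 := (h (horoPt x' 0)).im_pos
    rw [h1] at h4
    simp only [distQuot, hre, horoPt_re, horoPt_im, zpow_zero, zpow_one] at h4 h5
    rw [div_eq_div_iff (by positivity) (by positivity)] at h4
    apply UpperHalfPlane.ext_re_im hre
    rw [horoPt_im, zpow_zero]
    -- The distance from the endpoint at height `2` allows the heights `1` and `4`; the edge ends at
    -- height `2`.
    have h7 : ((h (horoPt x' 0)).im - 1) * ((h (horoPt x' 0)).im - 4) = 0 := by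
      linear_combination h4 / 2
    rcases mul_eq_zero.1 h7 with h8 | h8 <;> linarith
  have h3 : ∀ i, (sim 1 0 (x - x'))⁻¹ (horoPt x i) = horoPt x' i := by
    intro i
    rw [sim_inv, sim_horoPt]
    simp
  have h4 := eq_one_or_reflection (h * (sim 1 0 (x - x'))⁻¹) (x := x) (i := 1) (j := 0) one_ne_zero
    (by rw [IsometryEquiv.mul_apply, h3, h1]) (by rw [IsometryEquiv.mul_apply, h3, h2])
  refine h4.imp (fun h => mul_inv_eq_one.1 h) fun h => ?_
  rw [mul_inv_eq_iff_eq_mul, sim_mul_sim] at h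
  rw [h]
  congr 1
  simp
  ring

/-- The point `3 / 2 i + x`. -/
def midPt (x : ℝ) : UpperHalfPlane := ⟨⟨x, 3 / 2⟩, by norm_num⟩

theorem midPt_mem_rect {x u r : ℝ} : midPt x ∈ rect u r 0 1 ↔ |x - u| ≤ r := by
  have h1 : (midPt x).re = x := rfl
  have h2 : (midPt x).im = 3 / 2 := rfl
  rw [mem_rect, h1, h2]
  norm_num

theorem midPt_notMem_rect {x u r : ℝ} {i : ℤ} : midPt x ∉ rect u r i i := by
  rintro ⟨-, h1, h2⟩
  have h3 : (2 : ℝ) ^ i = 3 / 2 := le_antisymm h1 h2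
  rcases le_or_gt i 0 with h | h
  · have : (2 : ℝ) ^ i ≤ 2 ^ (0 : ℤ) := zpow_le_zpow_right₀ one_le_two h
    norm_num [h3] at this
  · have : (2 : ℝ) ^ (1 : ℤ) ≤ 2 ^ i := zpow_le_zpow_right₀ one_le_two h
    norm_num [h3] at this

theorem cell_zero (w x : ℝ) : cell w 0 x = rect x w 0 1 := by
  rw [cell, zpow_zero, one_mul, zero_add]

/-! ### Neighbours across the edges of one tile -/

/-- An isometry that preserves a horizontal horocycle cannot exchange its two sides. An `a`-edge
against the `a`-edge would thus give the same tile, so the neighbour has a `b`-edge there. -/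
theorem IsBTiling.above_proto {w : ℝ} (hw : 0 < w) {𝒯 : Set (Set UpperHalfPlane)}
    (h𝒯 : IsBTiling w 𝒯) {g : UpperHalfPlane ≃ᵢ UpperHalfPlane} (hg : g '' proto w ∈ 𝒯) :
    ∃ η : ℤˣ, g '' cell w 1 ((η : ℤ) * w) ∈ 𝒯 := by
  obtain ⟨h, h1, h2, h3, h4, h5⟩ := h𝒯.exists_edge_neighbor hw hg (z := horoPt 0 1)
    (by rw [proto_eq, horoPt_mem_rect]; simp [hw.le])
    (by rw [proto_eq, mem_interior_rect]; simp)
    (by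
      have hp : ∀ x i, horoPt 0 1 = horoPt x i → x = 0 ∧ (2 : ℝ) ^ (1 : ℤ) = 2 ^ i := fun x i h =>
        ⟨(congrArg UpperHalfPlane.re h).symm, congrArg UpperHalfPlane.im h⟩
      rw [protoVertices_eq]
      rintro (h | h | h | h | h)
      · linarith [(hp _ _ h).1]
      · linarith [(hp _ _ h).1]
      · linarith [(hp _ _ h).1]
      · have := (hp _ _ h).2
        norm_num at this
      · linarith [(hp _ _ h).1])
  have hz : g (horoPt 0 1) ∈ g '' proto w ∩ g '' (h '' proto w) := by
    refine ⟨mem_image_of_mem _ ?_, mem_image_of_mem _ h3⟩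
    rw [proto_eq, horoPt_mem_rect]
    simp [hw.le]
  have hE : g '' proto w ∩ g '' (h '' proto w) = g '' rect 0 w 1 1 := by
    rcases isEdge_image_proto hw g _ h4 with h | ⟨η, h⟩ | ⟨η, h, -⟩
    · exact h
    · rw [h, g.injective.mem_set_image, horoPt_mem_rect] at hz
      simp at hz
    · rw [h, g.injective.mem_set_image, horoPt_mem_rect] at hz
      rcases Int.units_eq_one_or η with rfl | rfl <;> simp [hw.ne'] at hz
  rw [hE] at h5
  rw [← mul_image] at h5
  rcases isEdge_image_proto hw _ _ h5 with h6 | ⟨η, h6⟩ | ⟨η, h6, -⟩ <;>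
    rw [mul_image, (image_injective.2 g.injective).eq_iff, eq_comm] at h6
  · obtain ⟨ε, b, rfl, hb⟩ := eq_sim_of_image_horizontal hw h6
    exfalso
    apply h2
    rw [sim_image_proto, show (1 : ℤ) - 1 = 0 by norm_num, cell_zero, proto_eq]
    congr 1
    simpa using hb
  · obtain ⟨ε, b, rfl, hb⟩ := eq_sim_of_image_horizontal (half_pos hw) h6
    -- The `b`-edge of sign `η`, reflected by `ε`, must be centred at `0`, so the centre of the
    -- neighbour is `-ε η w`.
    refine ⟨-(ε * η), ?_⟩
    rw [sim_image_proto, sub_zero] at h1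
    convert h1 using 3
    simp only [sub_zero, zpow_one] at hb
    rw [Units.val_neg, Units.val_mul]
    push_cast
    linear_combination hb
  · exact (image_vertical_ne_horizontal hw h6).elim

theorem IsBTiling.below_proto {w : ℝ} (hw : 0 < w) {𝒯 : Set (Set UpperHalfPlane)}
    (h𝒯 : IsBTiling w 𝒯) {g : UpperHalfPlane ≃ᵢ UpperHalfPlane} (hg : g '' proto w ∈ 𝒯) (η : ℤˣ) :
    g '' cell w (-1) ((η : ℤ) * (w / 2)) ∈ 𝒯 := by
  have hmem : horoPt ((η : ℤ) * (w / 2)) 0 ∈ rect 0 w 0 1 := by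
    rw [horoPt_mem_rect, sub_zero, abs_mul, abs_cast_units, abs_of_pos (half_pos hw)]
    refine ⟨by linarith, le_rfl, zero_le_one⟩
  obtain ⟨h, h1, h2, h3, h4, h5⟩ := h𝒯.exists_edge_neighbor hw hg
    (z := horoPt ((η : ℤ) * (w / 2)) 0)
    (by rwa [proto_eq])
    (by rw [proto_eq, mem_interior_rect]; simp)
    (by
      have hp : ∀ x i, horoPt ((η : ℤ) * (w / 2)) 0 = horoPt x i → (η : ℤ) * (w / 2) = x :=
        fun x i h => congrArg UpperHalfPlane.re h
      rw [protoVertices_eq]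
      rintro (h | h | h | h | h) <;> replace h := hp _ _ h <;>
        rcases Int.units_eq_one_or η with rfl | rfl <;> simp at h <;> linarith)
  have hz : g (horoPt ((η : ℤ) * (w / 2)) 0) ∈ g '' proto w ∩ g '' (h '' proto w) := by
    refine ⟨mem_image_of_mem _ ?_, mem_image_of_mem _ h3⟩
    rwa [proto_eq]
  have hE : g '' proto w ∩ g '' (h '' proto w) = g '' rect ((η : ℤ) * (w / 2)) (w / 2) 0 0 := by
    rcases isEdge_image_proto hw g _ h4 with h | ⟨η', h⟩ | ⟨η', h, -⟩
    · rw [h, g.injective.mem_set_image, horoPt_mem_rect] at hz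
      simp at hz
    · rw [h, g.injective.mem_set_image, horoPt_mem_rect] at hz
      rw [h]
      have h0 := hz.1
      have : η = η' := by
        rcases Int.units_eq_one_or η with rfl | rfl <;>
          rcases Int.units_eq_one_or η' with rfl | rfl <;> simp [abs_le] at h0 ⊢ <;> linarith
      rw [this]
    · rw [h, g.injective.mem_set_image, horoPt_mem_rect] at hz
      have h0 := hz.1
      rcases Int.units_eq_one_or η with rfl | rfl <;>
        rcases Int.units_eq_one_or η' with rfl | rfl <;> simp at h0 <;> linarith
  rw [hE] at h5
  rw [← mul_image] at h5
  rcases isEdge_image_proto hw _ _ h5 with h6 | ⟨η', h6⟩ | ⟨η', h6, -⟩ <;>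
    rw [mul_image, (image_injective.2 g.injective).eq_iff, eq_comm] at h6
  · obtain ⟨ε, b, rfl, hb⟩ := eq_sim_of_image_horizontal hw h6
    rw [sim_image_proto] at h1
    rw [mul_zero, zero_add] at hb
    rwa [hb]
  · obtain ⟨ε, b, rfl, hb⟩ := eq_sim_of_image_horizontal (half_pos hw) h6
    exfalso
    -- With `b` against `b` the neighbour is the prototile shifted by at most `w`. The point halfway
    -- between the centres then lies in both tiles, but on no horocyclic edge.
    have hb' : |b| ≤ w := by
      simp only [sub_zero, zpow_zero, mul_one] at hb
      rcases Int.units_eq_one_or η with rfl | rfl <;>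
        rcases Int.units_eq_one_or η' with rfl | rfl <;>
        rcases Int.units_eq_one_or ε with rfl | rfl <;> simp at hb <;> rw [abs_le] <;>
        constructor <;> linarith
    have hm : g (midPt (b / 2)) ∈ g '' rect ((η : ℤ) * (w / 2)) (w / 2) 0 0 := by
      rw [← hE]
      refine ⟨mem_image_of_mem _ ?_, mem_image_of_mem _ ?_⟩
      · rw [proto_eq, midPt_mem_rect, sub_zero, abs_div, abs_two]
        linarith [abs_nonneg b]
      · rw [sim_image_proto, sub_zero, cell_zero, midPt_mem_rect, show b / 2 - b = -(b / 2) by ring,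
          abs_neg, abs_div, abs_two]
        linarith [abs_nonneg b]
    rw [g.injective.mem_set_image] at hm
    exact midPt_notMem_rect hm
  · exact (image_vertical_ne_horizontal (half_pos hw) h6).elim

/-- The orientation of `c`-edges is needed here: it excludes a neighbour attached with the ends of
the `c`-edge exchanged. What remains is the tile itself or its translate by `± 2 * w`. -/
theorem IsBTiling.beside_proto {w : ℝ} (hw : 0 < w) {𝒯 : Set (Set UpperHalfPlane)}
    (h𝒯 : IsBTiling w 𝒯) {g : UpperHalfPlane ≃ᵢ UpperHalfPlane} (hg : g '' proto w ∈ 𝒯) (η : ℤˣ) :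
    g '' cell w 0 ((η : ℤ) * (2 * w)) ∈ 𝒯 := by
  have hηw : |((η : ℤ) : ℝ) * w| = w := by rw [abs_mul, abs_cast_units, one_mul, abs_of_pos hw]
  have hmem : midPt ((η : ℤ) * w) ∈ rect 0 w 0 1 := by
    rw [midPt_mem_rect, sub_zero, hηw]
  obtain ⟨h, h1, h2, h3, h4, h5⟩ := h𝒯.exists_edge_neighbor hw hg
    (z := midPt ((η : ℤ) * w))
    (by rwa [proto_eq])
    (by
      rw [proto_eq, mem_interior_rect]
      rintro ⟨h, -⟩
      rw [sub_zero, show (midPt ((η : ℤ) * w)).re = (η : ℤ) * w from rfl, hηw] at h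
      exact lt_irrefl _ h)
    (by
      have hp : ∀ x i, midPt ((η : ℤ) * w) ≠ horoPt x i := fun x i h =>
        midPt_notMem_rect (x := (η : ℤ) * w) (u := x) (r := 0) (i := i)
          (by rw [h, horoPt_mem_rect]; simp)
      rw [protoVertices_eq]
      rintro (h | h | h | h | h) <;> exact hp _ _ h)
  have hz : g (midPt ((η : ℤ) * w)) ∈ g '' proto w ∩ g '' (h '' proto w) := by
    refine ⟨mem_image_of_mem _ ?_, mem_image_of_mem _ h3⟩
    rwa [proto_eq]
  have hE : g '' proto w ∩ g '' (h '' proto w) = g '' rect ((η : ℤ) * w) 0 0 1 ∧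
      IsCEdgeFrom w (g '' proto w) (g '' proto w ∩ g '' (h '' proto w))
        (g (horoPt ((η : ℤ) * w) 1)) := by
    rcases isEdge_image_proto hw g _ h4 with h | ⟨η', h⟩ | ⟨η', h, h'⟩
    · rw [h, g.injective.mem_set_image] at hz
      exact (midPt_notMem_rect hz).elim
    · rw [h, g.injective.mem_set_image] at hz
      exact (midPt_notMem_rect hz).elim
    · have : η = η' := by
        rw [h, g.injective.mem_set_image, midPt_mem_rect] at hz
        rcases Int.units_eq_one_or η with rfl | rfl <;>
          rcases Int.units_eq_one_or η' with rfl | rfl <;> simp [abs_le] at hz ⊢ <;> linarith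
      rw [this]
      exact ⟨h, h'⟩
  obtain ⟨hE, hE'⟩ := hE
  rw [hE] at h5 hE'
  rw [← mul_image] at h5
  rcases isEdge_image_proto hw _ _ h5 with h6 | ⟨η', h6⟩ | ⟨η', h6, h7⟩
  · rw [mul_image, (image_injective.2 g.injective).eq_iff] at h6
    have h8 : (h⁻¹ : UpperHalfPlane ≃ᵢ UpperHalfPlane) '' rect ((η : ℤ) * w) 0 0 1 = rect 0 w 1 1 := by rw [h6, inv_image_image]
    exact (image_vertical_ne_horizontal hw h8).elim
  · rw [mul_image, (image_injective.2 g.injective).eq_iff] at h6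
    have h8 : (h⁻¹ : UpperHalfPlane ≃ᵢ UpperHalfPlane) '' rect ((η : ℤ) * w) 0 0 1 = rect ((η' : ℤ) * (w / 2)) (w / 2) 0 0 := by
      rw [h6, inv_image_image]
    exact (image_vertical_ne_horizontal (half_pos hw) h8).elim
  · rw [mul_image, (image_injective.2 g.injective).eq_iff] at h6
    have h8 := h𝒯.oriented _ hg _ (by rw [mul_image]; exact h1) _ _ _ hE' h7
    rw [IsometryEquiv.mul_apply, g.injective.eq_iff] at h8
    have hb : ∃ ε b, h = sim ε 0 b ∧ (b = 0 ∨ b = (η : ℤ) * (2 * w)) := by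
      rcases eq_of_image_vertical h6.symm h8.symm with h9 | h9
      · refine ⟨1, _, h9, ?_⟩
        rcases Int.units_eq_one_or η with rfl | rfl <;>
          rcases Int.units_eq_one_or η' with rfl | rfl <;> simp <;> right <;> ring
      · refine ⟨-1, _, h9, ?_⟩
        rcases Int.units_eq_one_or η with rfl | rfl <;>
          rcases Int.units_eq_one_or η' with rfl | rfl <;> simp <;> right <;> ring
    obtain ⟨ε, b, rfl, rfl | rfl⟩ := hb
    · exfalso
      apply h2
      rw [sim_image_proto, cell_zero, proto_eq]
    · rwa [sim_image_proto] at h1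

/-! ### Neighbours of a tile of arbitrary size -/

theorem mul_sim_image_cell (w : ℝ) (g : UpperHalfPlane ≃ᵢ UpperHalfPlane) (k m : ℤ) (x b : ℝ) :
    (g * sim 1 k x) '' cell w m b = g '' cell w (k + m) (2 ^ k * b + x) := by
  rw [mul_image, sim_image_cell]
  simp

theorem IsBTiling.above {w : ℝ} (hw : 0 < w) {𝒯 : Set (Set UpperHalfPlane)}
    (h𝒯 : IsBTiling w 𝒯) {g : UpperHalfPlane ≃ᵢ UpperHalfPlane} {k : ℤ} {x : ℝ}
    (hg : g '' cell w k x ∈ 𝒯) :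
    ∃ η : ℤˣ, g '' cell w (k + 1) (x + 2 ^ k * w * (η : ℤ)) ∈ 𝒯 := by
  rw [image_cell_eq] at hg
  obtain ⟨η, h⟩ := h𝒯.above_proto hw hg
  refine ⟨η, ?_⟩
  rw [mul_sim_image_cell] at h
  convert h using 3
  ring

theorem IsBTiling.below {w : ℝ} (hw : 0 < w) {𝒯 : Set (Set UpperHalfPlane)}
    (h𝒯 : IsBTiling w 𝒯) {g : UpperHalfPlane ≃ᵢ UpperHalfPlane} {k : ℤ} {x : ℝ}
    (hg : g '' cell w (k + 1) x ∈ 𝒯) (η : ℤˣ) :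
    g '' cell w k (x + 2 ^ k * w * (η : ℤ)) ∈ 𝒯 := by
  rw [image_cell_eq] at hg
  have h := h𝒯.below_proto hw hg η
  rw [mul_sim_image_cell] at h
  convert h using 3
  · ring
  · rw [zpow_add₀ (two_ne_zero' ℝ)]
    ring

theorem IsBTiling.beside {w : ℝ} (hw : 0 < w) {𝒯 : Set (Set UpperHalfPlane)}
    (h𝒯 : IsBTiling w 𝒯) {g : UpperHalfPlane ≃ᵢ UpperHalfPlane} {k : ℤ} {x : ℝ}
    (hg : g '' cell w k x ∈ 𝒯) (n : ℤ) :
    g '' cell w k (x + 2 ^ k * (2 * w) * n) ∈ 𝒯 := by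
  have step : ∀ (x : ℝ) (η : ℤˣ), g '' cell w k x ∈ 𝒯 →
      g '' cell w k (x + 2 ^ k * (2 * w) * (η : ℤ)) ∈ 𝒯 := by
    intro x η hg
    rw [image_cell_eq] at hg
    have h := h𝒯.beside_proto hw hg η
    rw [mul_sim_image_cell] at h
    convert h using 3
    · ring
    · ring
  induction n using Int.induction_on with
  | zero => simpa using hg
  | succ n ih =>
    convert step _ 1 ih using 3
    push_cast
    ring
  | pred n ih =>
    convert step _ (-1) ih using 3
    push_cast
    ring

/-! ### Frames: integer coordinates for the tiles -/

/-- The tile number `n` of the level `k`, where the level `k` consists of the tiles of width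
`2 ^ k * (2 * w)` (seen from the Möbius transformation `A`) whose centre lines are the
translates of `re = c k` by multiples of this width. -/
def tile (w : ℝ) (A : Matrix.SpecialLinearGroup (Fin 2) ℝ) (c : ℤ → ℝ) (k n : ℤ) :
    Set UpperHalfPlane :=
  slIso A '' cell w k (c k + 2 ^ k * (2 * w) * n)

/-- The tiling consists of the tiles `tile w A c k n`, and the signs `σ` describe the relative
position of consecutive levels. -/
structure IsFrame (w : ℝ) (𝒯 : Set (Set UpperHalfPlane)) (A : Matrix.SpecialLinearGroup (Fin 2) ℝ)
    (c : ℤ → ℝ) (σ : ℤ → ℤˣ) : Prop where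
  pos : 0 < w
  step : ∀ k, c (k + 1) = c k + 2 ^ k * w * (σ k : ℤ)
  mem_iff : ∀ T, T ∈ 𝒯 ↔ ∃ k n, T = tile w A c k n

theorem exists_mem_cell {w : ℝ} (hw : 0 < w) (c : ℤ → ℝ) (z : UpperHalfPlane) :
    ∃ k n : ℤ, z ∈ cell w k (c k + 2 ^ k * (2 * w) * n) := by
  obtain ⟨k, hk1, hk2⟩ := exists_mem_Ico_zpow z.im_pos (one_lt_two (α := ℝ))
  have h := abs_sub_round ((z.re - c k) / (2 ^ k * (2 * w)))
  refine ⟨k, round ((z.re - c k) / (2 ^ k * (2 * w))), ?_, hk1, hk2.le⟩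
  generalize round ((z.re - c k) / (2 ^ k * (2 * w))) = n at h ⊢
  have hpos : (0 : ℝ) < 2 ^ k * (2 * w) := by positivity
  have h2 : z.re - (c k + 2 ^ k * (2 * w) * n) =
      2 ^ k * (2 * w) * ((z.re - c k) / (2 ^ k * (2 * w)) - n) := by
    field_simp
    ring
  rw [h2, abs_mul, abs_of_pos hpos]
  nlinarith

theorem closure_interior_image_cell {w : ℝ} (hw : 0 < w) (g : UpperHalfPlane ≃ᵢ UpperHalfPlane)
    (k : ℤ) (x : ℝ) : closure (interior (g '' cell w k x)) = g '' cell w k x := by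
  rw [interior_image, closure_image, cell, closure_interior_rect (by positivity) (by omega)]

/-- Towards greater heights the tiling prescribes the next centre. Towards smaller heights there is
a tile at both `b`-edges, so the choice is free and the left one is taken. -/
theorem IsBTiling.exists_centers {w : ℝ} (hw : 0 < w) {𝒯 : Set (Set UpperHalfPlane)}
    (h𝒯 : IsBTiling w 𝒯) {g : UpperHalfPlane ≃ᵢ UpperHalfPlane} (hg : g '' cell w 0 0 ∈ 𝒯) :
    ∃ (c : ℤ → ℝ) (σ : ℤ → ℤˣ), c 0 = 0 ∧ (∀ k, c (k + 1) = c k + 2 ^ k * w * (σ k : ℤ)) ∧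
      ∀ k, g '' cell w k (c k) ∈ 𝒯 := by
  choose! η hη using fun (k : ℤ) (x : ℝ) (h : g '' cell w k x ∈ 𝒯) => h𝒯.above hw h
  let s : ℕ → ℝ := fun n => Nat.rec 0 (fun n x => x + 2 ^ (n : ℤ) * w * (η n x : ℤ)) n
  have hs : ∀ n : ℕ, g '' cell w n (s n) ∈ 𝒯 := by
    intro n
    induction n with
    | zero => simpa [s] using hg
    | succ n ih => simpa [s] using hη n (s n) ih
  -- For `k < 0` this is the sum of the steps `-2 ^ j * w` with `k ≤ j < 0`.
  let c : ℤ → ℝ := fun k => if 0 ≤ k then s k.toNat else 2 ^ k * w - w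
  have hc : ∀ n : ℕ, c n = s n := by
    intro n
    simp [c]
  have hc' : ∀ n : ℕ, c (-n) = 2 ^ (-n : ℤ) * w - w := by
    intro n
    rcases n with - | n
    · simp [c, s]
    · have : ¬ (0 ≤ (-((n + 1 : ℕ) : ℤ))) := by omega
      simp only [c, if_neg this]
  have hstep : ∀ k, ∃ σ : ℤˣ, c (k + 1) = c k + 2 ^ k * w * (σ : ℤ) := by
    intro k
    obtain ⟨n, rfl | rfl⟩ := Int.eq_nat_or_neg k
    · refine ⟨η n (s n), ?_⟩
      have : ((n : ℤ) + 1) = ((n + 1 : ℕ) : ℤ) := by push_cast; ring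
      rw [this, hc, hc]
    · rcases n with - | n
      · refine ⟨η 0 0, ?_⟩
        have h1 := hc 1
        have h0 := hc 0
        simp only [Nat.cast_one, Nat.cast_zero] at h1 h0
        simp [h1, h0, s]
      · refine ⟨1, ?_⟩
        have : (-((n + 1 : ℕ) : ℤ)) + 1 = -(n : ℤ) := by push_cast; ring
        rw [this, hc', hc', ← this, zpow_add₀ (two_ne_zero' ℝ)]
        push_cast
        ring
  choose σ hσ using hstep
  refine ⟨c, σ, by simpa [s] using hc 0, hσ, ?_⟩
  intro k
  obtain ⟨n, rfl | rfl⟩ := Int.eq_nat_or_neg k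
  · rw [hc]
    exact hs n
  · induction n with
    | zero =>
      rw [hc']
      simpa using hg
    | succ n ih =>
      have h1 : (-((n + 1 : ℕ) : ℤ)) + 1 = -(n : ℤ) := by push_cast; ring
      rw [← h1] at ih
      convert h𝒯.below hw ih (-1) using 3
      rw [h1, hc', hc', ← h1, zpow_add₀ (two_ne_zero' ℝ)]
      push_cast
      ring

/-- Every B-tiling has a frame in which a given tile has level `0` and number `0`. -/
theorem IsBTiling.exists_frame {w : ℝ} (hw : 0 < w) {𝒯 : Set (Set UpperHalfPlane)}
    (h𝒯 : IsBTiling w 𝒯) {T : Set UpperHalfPlane} (hT : T ∈ 𝒯) :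
    ∃ A c σ, IsFrame w 𝒯 A c σ ∧ T = tile w A c 0 0 := by
  obtain ⟨A, hA⟩ := (h𝒯.pentagon T hT).exists_slIso
  have hT0 : T = slIso A '' cell w 0 0 := by rw [hA, cell_zero, proto_eq]
  rw [hT0] at hT
  obtain ⟨c, σ, hc0, hstep, hc⟩ := h𝒯.exists_centers hw hT
  have hmem : ∀ k n, tile w A c k n ∈ 𝒯 := fun k n => h𝒯.beside hw (hc k) n
  refine ⟨A, c, σ, ⟨hw, hstep, fun T' => ⟨fun hT' => ?_, ?_⟩⟩, ?_⟩
  · obtain ⟨g, rfl⟩ := h𝒯.pentagon T' hT'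
    have hq : g protoCenter ∈ interior (g '' proto w) := by
      rw [interior_image]
      exact mem_image_of_mem _ (protoCenter_mem_interior hw)
    -- The frame tiles already cover the plane, so the interior of any tile meets the interior of
    -- one of them.
    obtain ⟨k, n, hkn⟩ := exists_mem_cell hw c ((slIso A)⁻¹ (g protoCenter))
    refine ⟨k, n, ?_⟩
    have h1 : g protoCenter ∈ closure (interior (tile w A c k n)) := by
      rw [tile, closure_interior_image_cell hw]
      refine ⟨_, hkn, ?_⟩
      rw [IsometryEquiv.apply_inv_self]
    obtain ⟨q, hq1, hq2⟩ := mem_closure_iff.1 h1 _ isOpen_interior hq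
    by_contra hne
    exact disjoint_left.1 (h𝒯.disjoint _ hT' _ (hmem k n) hne) hq1 hq2
  · rintro ⟨k, n, rfl⟩
    exact hmem k n
  · rw [hT0, tile, hc0]
    simp

section Frame

variable {w : ℝ} {𝒯 : Set (Set UpperHalfPlane)} {A : Matrix.SpecialLinearGroup (Fin 2) ℝ}
  {c : ℤ → ℝ} {σ : ℤ → ℤˣ}

theorem IsFrame.tile_mem (F : IsFrame w 𝒯 A c σ) (k n : ℤ) : tile w A c k n ∈ 𝒯 :=
  (F.mem_iff _).2 ⟨k, n, rfl⟩

theorem image_eq_image_iff (g : UpperHalfPlane ≃ᵢ UpperHalfPlane) {s t : Set UpperHalfPlane} :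
    g '' s = g '' t ↔ s = t := (image_injective.2 g.injective).eq_iff

theorem tile_inj (hw : 0 < w) {k n k' n' : ℤ}
    (h : tile w A c k n = tile w A c k' n') : k = k' ∧ n = n' := by
  rw [tile, tile, image_eq_image_iff] at h
  obtain ⟨h1, -, rfl, -⟩ := rect_injective (by positivity) (by omega) h
  refine ⟨rfl, ?_⟩
  have hpos : (2 : ℝ) ^ k * (2 * w) ≠ 0 := by positivity
  exact_mod_cast mul_left_cancel₀ hpos (add_left_cancel h1)

/-- Comparing midpoints and dividing by `2 ^ k * w` gives the integer equation behind all horocyclic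
incidences; `t = -1` is the `b₁`-edge and `t = 1` the `b₂`-edge. -/
theorem IsFrame.edge_eq_iff (F : IsFrame w 𝒯 A c σ) (k n k' n' t : ℤ) :
    slIso A '' rect (c k + 2 ^ k * (2 * w) * n) (2 ^ k * w) (k + 1) (k + 1) =
      slIso A '' rect (c k' + 2 ^ k' * (2 * w) * n' + t * (2 ^ k' * (w / 2))) (2 ^ k' * (w / 2))
        k' k' ↔ k' = k + 1 ∧ 2 * n = σ k + 4 * n' + t := by
  have hw := F.pos
  have hpos : (2 : ℝ) ^ k * w ≠ 0 := by positivity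
  have hk : (2 : ℝ) ^ (k + 1) = 2 ^ k * 2 := by rw [zpow_add₀ (two_ne_zero' ℝ), zpow_one]
  rw [image_eq_image_iff]
  constructor
  · intro h
    obtain ⟨h1, -, rfl, -⟩ := rect_injective (by positivity) le_rfl h
    refine ⟨rfl, ?_⟩
    rw [F.step, hk] at h1
    have h2 : (2 : ℝ) ^ k * w * (2 * n) = 2 ^ k * w * ((σ k : ℤ) + 4 * n' + t) := by
      linear_combination h1
    exact_mod_cast mul_left_cancel₀ hpos h2
  · rintro ⟨rfl, h⟩
    have h' : 2 * (n : ℝ) = (σ k : ℤ) + 4 * n' + t := by exact_mod_cast h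
    rw [F.step, hk]
    congr 1
    · linear_combination (2 : ℝ) ^ k * w * h'
    · ring

theorem IsFrame.down_iff (F : IsFrame w 𝒯 A c σ) (k n k' n' : ℤ) :
    Down w (tile w A c k n) (tile w A c k' n') ↔
      k' = k + 1 ∧ ∃ η : ℤˣ, 2 * n = σ k + 4 * n' + η := by
  simp only [Down, tile, isAEdge_image_cell F.pos, isBEdge_image_cell F.pos, exists_eq_left]
  simp only [F.edge_eq_iff, exists_and_left]

theorem IsFrame.b1_iff (F : IsFrame w 𝒯 A c σ) (k n k' n' : ℤ) :
    (∃ e, IsAEdge w (tile w A c k n) e ∧ IsB1Edge w (tile w A c k' n') e) ↔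
      k' = k + 1 ∧ 2 * n = σ k + 4 * n' - 1 := by
  simp only [tile, isAEdge_image_cell F.pos, isB1Edge_image_cell F.pos, exists_eq_left]
  have := F.edge_eq_iff k n k' n' (-1)
  rw [← sub_eq_add_neg] at this
  rw [← this]
  push_cast
  rw [neg_one_mul, ← sub_eq_add_neg]

theorem IsFrame.b2_iff (F : IsFrame w 𝒯 A c σ) (k n k' n' : ℤ) :
    (∃ e, IsAEdge w (tile w A c k n) e ∧ IsB2Edge w (tile w A c k' n') e) ↔
      k' = k + 1 ∧ 2 * n = σ k + 4 * n' + 1 := by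
  simp only [tile, isAEdge_image_cell F.pos, isB2Edge_image_cell F.pos, exists_eq_left]
  rw [← F.edge_eq_iff k n k' n' 1]
  push_cast
  rw [one_mul]

theorem shareC_iff (hw : 0 < w) (k n k' n' : ℤ) :
    (∃ e, IsCEdge w (tile w A c k n) e ∧ IsCEdge w (tile w A c k' n') e) ↔
      k = k' ∧ ∃ η η' : ℤˣ, 2 * n + η = 2 * n' + η' := by
  have hC : ∀ k n e, IsCEdge w (tile w A c k n) e ↔ ∃ η : ℤˣ, e =
      slIso A '' rect (c k + 2 ^ k * (2 * w) * n + (η : ℤ) * (2 ^ k * w)) 0 k (k + 1) := by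
    intro k n e
    simp only [IsCEdge, tile, isCEdgeFrom_image_cell hw]
    rw [exists_comm]
    simp
  have key : ∀ (k n : ℤ) (η : ℤˣ), c k + 2 ^ k * (2 * w) * n + (η : ℤ) * (2 ^ k * w) =
      c k + 2 ^ k * w * ((2 * n + η : ℤ) : ℝ) := by
    intro k n η
    push_cast
    ring
  simp only [hC, key]
  constructor
  · rintro ⟨e, ⟨η, rfl⟩, η', h⟩
    rw [image_eq_image_iff] at h
    obtain ⟨h1, -, rfl, -⟩ := rect_injective le_rfl (by omega) h
    refine ⟨rfl, η, η', ?_⟩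
    have hpos : (2 : ℝ) ^ k * w ≠ 0 := by positivity
    exact_mod_cast mul_left_cancel₀ hpos (add_left_cancel h1)
  · rintro ⟨rfl, η, η', h⟩
    exact ⟨_, ⟨η, rfl⟩, η', by rw [h]⟩

theorem IsFrame.eq_or_down_of_share (F : IsFrame w 𝒯 A c σ) {T T' : Set UpperHalfPlane}
    (hT : T ∈ 𝒯) (hT' : T' ∈ 𝒯) (h : ShareHorocyclicEdge w T T') :
    T = T' ∨ Down w T T' ∨ Down w T' T := by
  obtain ⟨e, h1 | h1, h2 | h2⟩ := h
  · left
    obtain ⟨k, n, rfl⟩ := (F.mem_iff _).1 hT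
    obtain ⟨k', n', rfl⟩ := (F.mem_iff _).1 hT'
    rw [tile, isAEdge_image_cell F.pos] at h1 h2
    rw [h1, image_eq_image_iff] at h2
    have hw := F.pos
    obtain ⟨h3, -, h4, -⟩ := rect_injective (by positivity) (by omega) h2
    obtain rfl : k = k' := by omega
    rw [tile, tile, h3]
  · exact Or.inr (Or.inl ⟨e, h1, h2⟩)
  · exact Or.inr (Or.inr ⟨e, h2, h1⟩)
  · left
    obtain ⟨k, n, rfl⟩ := (F.mem_iff _).1 hT
    obtain ⟨k', n', rfl⟩ := (F.mem_iff _).1 hT'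
    rw [tile, isBEdge_image_cell F.pos] at h1 h2
    obtain ⟨η, h1⟩ := h1
    obtain ⟨η', h2⟩ := h2
    rw [h1, image_eq_image_iff] at h2
    have hw := F.pos
    obtain ⟨h3, -, rfl, -⟩ := rect_injective (by positivity) le_rfl h2
    have hpos : (2 : ℝ) ^ k * (w / 2) ≠ 0 := by positivity
    have h4 : (2 : ℝ) ^ k * (w / 2) * (4 * n + (η : ℤ)) =
        2 ^ k * (w / 2) * (4 * n' + (η' : ℤ)) := by linear_combination h3
    have h5 : 4 * n + (η : ℤ) = 4 * n' + η' := by exact_mod_cast mul_left_cancel₀ hpos h4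
    have : n = n' := by
      rcases Int.units_eq_one_or η with rfl | rfl <;>
        rcases Int.units_eq_one_or η' with rfl | rfl <;> simp at h5 <;> omega
    rw [this]

end Frame

theorem exists_lt_two_zpow_mul {w : ℝ} (hw : 0 < w) (x : ℝ) :
    ∃ K : ℤ, ∀ k, K ≤ k → x < 2 ^ k * (2 * w) := by
  obtain ⟨n, hn⟩ := pow_unbounded_of_one_lt (x / (2 * w)) (one_lt_two (α := ℝ))
  refine ⟨n, fun k hk => ?_⟩
  rw [div_lt_iff₀ (by positivity)] at hn
  have h : (2 : ℝ) ^ n ≤ 2 ^ k := by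
    rw [← zpow_natCast]
    exact zpow_le_zpow_right₀ one_le_two hk
  nlinarith

section Frame

variable {w : ℝ} {𝒯 : Set (Set UpperHalfPlane)} {A : Matrix.SpecialLinearGroup (Fin 2) ℝ}
  {c : ℤ → ℝ} {σ : ℤ → ℤˣ}

/-! ### The tiles above a given abscissa -/

/-- The number of the tile of level `k` that lies over the abscissa `x`. -/
def idx (w : ℝ) (c : ℤ → ℝ) (k : ℤ) (x : ℝ) : ℤ := ⌊(x - c k) / (2 ^ k * (2 * w)) + 1 / 2⌋

/-- An abscissa on a `c`-edge is assigned to the tile on its right. -/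
theorem idx_eq_iff (hw : 0 < w) (k n : ℤ) (x : ℝ) : idx w c k x = n ↔
    c k + 2 ^ k * w * (2 * n - 1) ≤ x ∧ x < c k + 2 ^ k * w * (2 * n + 1) := by
  have hpos : (0 : ℝ) < 2 ^ k * (2 * w) := by positivity
  rw [idx, Int.floor_eq_iff, ← sub_le_iff_le_add, ← lt_sub_iff_add_lt, le_div_iff₀ hpos,
    div_lt_iff₀ hpos]
  constructor <;> rintro ⟨h1, h2⟩ <;> constructor <;> linarith

theorem idx_center (hw : 0 < w) (k n : ℤ) : idx w c k (c k + 2 ^ k * (2 * w) * n) = n := by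
  have hpos : (0 : ℝ) < 2 ^ k * w := by positivity
  rw [idx_eq_iff hw]
  constructor <;> linarith

theorem idx_mono (hw : 0 < w) (k : ℤ) {x x' : ℝ} (h : x ≤ x') : idx w c k x ≤ idx w c k x' := by
  unfold idx
  gcongr

/-- Both tiles lie over `x`, so `2 n - σ k - 4 m` lies strictly between `-3` and `3`. It is odd,
hence `± 1`. -/
theorem IsFrame.idx_step (F : IsFrame w 𝒯 A c σ) (k : ℤ) (x : ℝ) :
    ∃ η : ℤˣ, 2 * idx w c k x = σ k + 4 * idx w c (k + 1) x + η := by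
  have hpos : (0 : ℝ) < 2 ^ k * w := mul_pos (by positivity) F.pos
  obtain ⟨h1, h2⟩ := (idx_eq_iff (c := c) F.pos k _ x).1 rfl
  obtain ⟨h3, h4⟩ := (idx_eq_iff (c := c) F.pos (k + 1) _ x).1 rfl
  generalize idx w c k x = n at *
  generalize idx w c (k + 1) x = m at *
  rw [F.step, zpow_add₀ (two_ne_zero' ℝ), zpow_one] at h3 h4
  have h5 : 2 ^ k * w * (2 * n - 1 : ℝ) < 2 ^ k * w * ((σ k : ℤ) + 4 * m + 2) := by linarith
  have h6 : 2 ^ k * w * ((σ k : ℤ) + 4 * m - 2 : ℝ) < 2 ^ k * w * (2 * n + 1) := by linarith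
  have h7 := lt_of_mul_lt_mul_left h5 hpos.le
  have h8 := lt_of_mul_lt_mul_left h6 hpos.le
  have h9 : 2 * n - 1 < σ k + 4 * m + 2 := by exact_mod_cast h7
  have h10 : σ k + 4 * m - 2 < 2 * n + 1 := by exact_mod_cast h8
  have h11 : 2 * n = σ k + 4 * m + 1 ∨ 2 * n = σ k + 4 * m + -1 := by
    rcases Int.units_eq_one_or (σ k) with h | h <;> rw [h] at h9 h10 ⊢ <;> simp at h9 h10 ⊢ <;>
      omega
  rcases h11 with h | h
  · exact ⟨1, h⟩
  · exact ⟨-1, h⟩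

theorem IsFrame.idx_eq_of_le (F : IsFrame w 𝒯 A c σ) {k k' : ℤ} (hk : k ≤ k') {x x' : ℝ}
    (h : idx w c k x = idx w c k x') : idx w c k' x = idx w c k' x' := by
  induction k', hk using Int.leInduction with
  | base => exact h
  | succ m _ ih =>
    obtain ⟨η, h1⟩ := F.idx_step m x
    obtain ⟨η', h2⟩ := F.idx_step m x'
    rcases Int.units_eq_one_or η with rfl | rfl <;>
      rcases Int.units_eq_one_or η' with rfl | rfl <;> simp at h1 h2 <;> omega

/-! ### Lines that consist of `c`-edges -/

/-- The vertical line at `v` consists of `c`-edges. -/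
def IsWall (w : ℝ) (c : ℤ → ℝ) (v : ℝ) : Prop := ∀ k : ℤ, ∃ n : ℤ, v = c k + 2 ^ k * w * (2 * n + 1)

/-- Level `k` subdivides level `k + 1`, so boundaries persist to lower heights and only high levels
decide whether a line is a wall. -/
theorem IsFrame.wall_step (F : IsFrame w 𝒯 A c σ) {k : ℤ} {v : ℝ}
    (h : ∃ n : ℤ, v = c (k + 1) + 2 ^ (k + 1) * w * (2 * n + 1)) :
    ∃ n : ℤ, v = c k + 2 ^ k * w * (2 * n + 1) := by
  obtain ⟨n, rfl⟩ := h
  rw [F.step, zpow_add₀ (two_ne_zero' ℝ), zpow_one]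
  rcases Int.units_eq_one_or (σ k) with h | h
  · refine ⟨2 * n + 1, ?_⟩
    rw [h]
    push_cast
    ring
  · refine ⟨2 * n, ?_⟩
    rw [h]
    push_cast
    ring

theorem IsFrame.isWall_of_le (F : IsFrame w 𝒯 A c σ) {K : ℤ} {v : ℝ}
    (h : ∀ k, K ≤ k → ∃ n : ℤ, v = c k + 2 ^ k * w * (2 * n + 1)) : IsWall w c v := by
  intro k
  rcases le_total K k with hk | hk
  · exact h k hk
  · induction k, hk using Int.leInductionDown with
    | base => exact h K le_rfl
    | pred m _ ih =>
      refine F.wall_step ?_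
      rwa [sub_add_cancel]

theorem IsWall.unique (hw : 0 < w) {v v' : ℝ} (h : IsWall w c v) (h' : IsWall w c v') :
    v = v' := by
  obtain ⟨K, hK⟩ := exists_lt_two_zpow_mul hw |v - v'|
  obtain ⟨n, hn⟩ := h K
  obtain ⟨n', hn'⟩ := h' K
  have h1 := hK K le_rfl
  have hpos : (0 : ℝ) < 2 ^ K * (2 * w) := by positivity
  have h2 : v - v' = 2 ^ K * (2 * w) * ((n - n' : ℤ) : ℝ) := by
    rw [hn, hn']
    push_cast
    ring
  rw [h2, abs_mul, abs_of_pos hpos] at h1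
  have h3 : |((n - n' : ℤ) : ℝ)| < 1 := by
    by_contra! h
    nlinarith
  have h4 : n - n' = 0 := by
    rw [← Int.cast_abs] at h3
    exact Int.abs_lt_one_iff.1 (by exact_mod_cast h3)
  rw [hn, hn', sub_eq_zero.1 h4]

/-- The chains of tiles over two abscissas merge, unless they are separated by a wall. -/
theorem IsFrame.exists_wall_between (F : IsFrame w 𝒯 A c σ) {x x' : ℝ} (hx : x ≤ x')
    (h : ∀ k, idx w c k x ≠ idx w c k x') : ∃ v, x < v ∧ v ≤ x' ∧ IsWall w c v := by
  have hw := F.pos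
  obtain ⟨K, hK⟩ := exists_lt_two_zpow_mul hw (x' - x)
  -- Once the tiles are wider than `x' - x`, the two different tiles are adjacent.
  have hidx : ∀ k, K ≤ k → idx w c k x' = idx w c k x + 1 := by
    intro k hk
    have h1 := lt_of_le_of_ne (idx_mono (c := c) hw k hx) (h k)
    have h2 : idx w c k x' ≤ idx w c k x + 1 := by
      have hpos : (0 : ℝ) < 2 ^ k * w := by positivity
      obtain ⟨h3, h4⟩ := (idx_eq_iff (c := c) hw k _ x).1 rfl
      obtain ⟨h5, h6⟩ := (idx_eq_iff (c := c) hw k _ x').1 rfl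
      have h7 := hK k hk
      have h8 : 2 ^ k * w * (2 * idx w c k x' - 1 : ℝ) <
          2 ^ k * w * (2 * idx w c k x + 1 + 2) := by linarith
      have h9 := lt_of_mul_lt_mul_left h8 hpos.le
      have h10 : 2 * idx w c k x' - 1 < 2 * idx w c k x + 1 + 2 := by exact_mod_cast h9
      omega
    omega
  -- Two adjacent tiles with adjacent tiles above them are the right half under the left one and the
  -- left half under the right one, so their common boundary continues upwards.
  have hv : ∀ k, K ≤ k → c k + 2 ^ k * w * (2 * idx w c k x + 1) =
      c K + 2 ^ K * w * (2 * idx w c K x + 1) := by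
    intro k hk
    induction k, hk using Int.leInduction with
    | base => rfl
    | succ m hm ih =>
      rw [← ih, F.step, zpow_add₀ (two_ne_zero' ℝ), zpow_one]
      obtain ⟨η, h1⟩ := F.idx_step m x
      obtain ⟨η', h2⟩ := F.idx_step m x'
      rw [hidx m hm, hidx (m + 1) (by omega)] at h2
      have h3 : 2 * idx w c m x + 1 = σ m + 4 * idx w c (m + 1) x + 2 := by
        rcases Int.units_eq_one_or η with rfl | rfl <;>
          rcases Int.units_eq_one_or η' with rfl | rfl <;> simp at h1 h2 <;> omega
      have h4 : (2 * idx w c m x + 1 : ℝ) = (σ m : ℤ) + 4 * idx w c (m + 1) x + 2 := by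
        exact_mod_cast h3
      rw [h4]
      ring
  refine ⟨c K + 2 ^ K * w * (2 * idx w c K x + 1), ?_, ?_, ?_⟩
  · exact ((idx_eq_iff (c := c) hw K _ x).1 rfl).2
  · have := ((idx_eq_iff (c := c) hw K _ x').1 (hidx K le_rfl)).1
    push_cast at this
    linarith
  · exact F.isWall_of_le (K := K) fun k hk => ⟨idx w c k x, (hv k hk).symm⟩

/-! ### Pools -/

/-- The graph on the tiles whose edges are the pairs of tiles that share a horocyclic edge. -/
def linkGraph (w : ℝ) (𝒯 : Set (Set UpperHalfPlane)) : SimpleGraph (Set UpperHalfPlane) where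
  Adj T T' := T ≠ T' ∧ (T ∈ 𝒯 ∧ T' ∈ 𝒯) ∧ ShareHorocyclicEdge w T T'
  symm := ⟨fun _ _ h => ⟨h.1.symm, ⟨h.2.1.2, h.2.1.1⟩, h.2.2.imp fun _ he => ⟨he.2, he.1⟩⟩⟩
  loopless := ⟨fun _ h => h.1 rfl⟩

/-- Shortening a walk to a path provides the pairwise different tiles that `Linked` requires. -/
theorem linked_iff_reachable {T T' : Set UpperHalfPlane} (hT : T ∈ 𝒯) :
    Linked w 𝒯 T T' ↔ (linkGraph w 𝒯).Reachable T T' := by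
  constructor
  · rintro ⟨n, f, rfl, rfl, hmem, hinj, hsh⟩
    have key : ∀ i, i ≤ n → (linkGraph w 𝒯).Reachable (f 0) (f i) := by
      intro i hi
      induction i with
      | zero => exact SimpleGraph.Reachable.refl _
      | succ i ih =>
        refine (ih (by omega)).trans (SimpleGraph.Adj.reachable ?_)
        refine ⟨fun h => ?_, ⟨hmem _ (by omega), hmem _ hi⟩, hsh i (by omega)⟩
        have := hinj (mem_Iic.2 (by omega)) (mem_Iic.2 hi) h
        omega
    exact key n le_rfl
  · rintro ⟨p⟩
    classical
    let q := p.toPath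
    have hmem : ∀ i, (q : (linkGraph w 𝒯).Walk T T').getVert i ∈ 𝒯 := by
      intro i
      induction i with
      | zero => simpa using hT
      | succ i ih =>
        by_cases hi : i < (q : (linkGraph w 𝒯).Walk T T').length
        · exact ((q : (linkGraph w 𝒯).Walk T T').adj_getVert_succ hi).2.1.2
        · rw [SimpleGraph.Walk.getVert_of_length_le _ (by omega)] at ih ⊢
          exact ih
    refine ⟨(q : (linkGraph w 𝒯).Walk T T').length, (q : (linkGraph w 𝒯).Walk T T').getVert,
      SimpleGraph.Walk.getVert_zero _, SimpleGraph.Walk.getVert_length _, fun i _ => hmem i, ?_, ?_⟩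
    · exact q.2.getVert_injOn
    · intro i hi
      exact ((q : (linkGraph w 𝒯).Walk T T').adj_getVert_succ hi).2.2

theorem reachable_of_down {T T' : Set UpperHalfPlane}
    (hT : T ∈ 𝒯) (hT' : T' ∈ 𝒯) (h : Down w T T') : (linkGraph w 𝒯).Reachable T T' := by
  by_cases hne : T = T'
  · rw [hne]
  · obtain ⟨e, h1, h2⟩ := h
    exact SimpleGraph.Adj.reachable ⟨hne, ⟨hT, hT'⟩, e, Or.inl h1, Or.inr h2⟩

theorem IsFrame.reachable_of_le (F : IsFrame w 𝒯 A c σ) (x : ℝ) {k k' : ℤ} (hk : k ≤ k') :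
    (linkGraph w 𝒯).Reachable (tile w A c k (idx w c k x)) (tile w A c k' (idx w c k' x)) := by
  induction k', hk using Int.leInduction with
  | base => exact SimpleGraph.Reachable.refl _
  | succ m _ ih =>
    exact ih.trans (reachable_of_down (F.tile_mem _ _) (F.tile_mem _ _)
      ((F.down_iff _ _ _ _).2 ⟨rfl, F.idx_step m x⟩))

theorem IsFrame.reachable_of_idx_eq (F : IsFrame w 𝒯 A c σ) {x x' : ℝ} {m : ℤ}
    (h : idx w c m x = idx w c m x') (k k' : ℤ) :
    (linkGraph w 𝒯).Reachable (tile w A c k (idx w c k x)) (tile w A c k' (idx w c k' x')) := by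
  set K := max m (max k k') with hK
  have h1 := F.reachable_of_le x (k := k) (k' := K) (by omega)
  have h2 := F.reachable_of_le x' (k := k') (k' := K) (by omega)
  rw [F.idx_eq_of_le (show m ≤ K by omega) h] at h1
  exact h1.trans h2.symm

theorem IsFrame.reachable_of_no_wall_between (F : IsFrame w 𝒯 A c σ) {k n k' n' : ℤ}
    (h : ∀ v, IsWall w c v →
      (v < c k + 2 ^ k * (2 * w) * n ↔ v < c k' + 2 ^ k' * (2 * w) * n')) :
    (linkGraph w 𝒯).Reachable (tile w A c k n) (tile w A c k' n') := by
  have hw := F.pos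
  rw [← idx_center (c := c) hw k n, ← idx_center (c := c) hw k' n']
  -- Centre lines are even and walls odd multiples of `2 ^ k * w` away from `c k`. This settles the
  -- endpoint of the half-open interval in `exists_wall_between`.
  have hne : ∀ v, IsWall w c v → ∀ k n : ℤ, v ≠ c k + 2 ^ k * (2 * w) * n := by
    intro v hv k n h
    obtain ⟨m, hm⟩ := hv k
    have hpos : (2 : ℝ) ^ k * w ≠ 0 := by positivity
    have h1 : 2 ^ k * w * (2 * n : ℝ) = 2 ^ k * w * (2 * m + 1) := by linear_combination hm - h
    have h2 : 2 * n = 2 * m + 1 := by exact_mod_cast mul_left_cancel₀ hpos h1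
    omega
  have hne1 := fun v hv => hne v hv k n
  have hne2 := fun v hv => hne v hv k' n'
  generalize c k + 2 ^ k * (2 * w) * n = x at *
  generalize c k' + 2 ^ k' * (2 * w) * n' = x' at *
  by_cases hm : ∃ m, idx w c m x = idx w c m x'
  · obtain ⟨m, hm⟩ := hm
    exact F.reachable_of_idx_eq hm k k'
  · push Not at hm
    exfalso
    rcases le_total x x' with hx | hx
    · obtain ⟨v, h1, h2, hv⟩ := F.exists_wall_between hx hm
      exact lt_asymm h1 ((h v hv).2 (lt_of_le_of_ne h2 (hne2 v hv)))
    · obtain ⟨v, h1, h2, hv⟩ := F.exists_wall_between hx fun k => (hm k).symm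
      exact lt_asymm h1 ((h v hv).1 (lt_of_le_of_ne h2 (hne1 v hv)))

theorem IsFrame.pools_eq_of_no_wall (F : IsFrame w 𝒯 A c σ) (h : ∀ v, ¬ IsWall w c v) :
    pools w 𝒯 = {𝒯} := by
  have key : ∀ T ∈ 𝒯, {T' | Linked w 𝒯 T T'} = 𝒯 := by
    intro T hT
    ext T'
    constructor
    · rintro ⟨n, f, -, rfl, hmem, -⟩
      exact hmem n le_rfl
    · intro hT'
      rw [mem_ofPred_eq, linked_iff_reachable hT]
      obtain ⟨k, n, rfl⟩ := (F.mem_iff _).1 hT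
      obtain ⟨k', n', rfl⟩ := (F.mem_iff _).1 hT'
      exact F.reachable_of_no_wall_between fun v hv => (h v hv).elim
  ext P
  constructor
  · rintro ⟨T, hT, rfl⟩
    exact key T hT
  · rintro rfl
    exact ⟨_, F.tile_mem 0 0, (key _ (F.tile_mem 0 0)).symm⟩

/-- The tiles on the right of the wall `v`. -/
def rightSide (w : ℝ) (A : Matrix.SpecialLinearGroup (Fin 2) ℝ) (c : ℤ → ℝ) (v : ℝ) :
    Set (Set UpperHalfPlane) :=
  {T | ∃ k n : ℤ, T = tile w A c k n ∧ v < c k + 2 ^ k * (2 * w) * n}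

/-- The tiles on the left of the wall `v`. -/
def leftSide (w : ℝ) (A : Matrix.SpecialLinearGroup (Fin 2) ℝ) (c : ℤ → ℝ) (v : ℝ) :
    Set (Set UpperHalfPlane) :=
  {T | ∃ k n : ℤ, T = tile w A c k n ∧ ¬ v < c k + 2 ^ k * (2 * w) * n}

theorem tile_mem_rightSide (hw : 0 < w) {v : ℝ} {k n : ℤ} :
    tile w A c k n ∈ rightSide w A c v ↔ v < c k + 2 ^ k * (2 * w) * n := by
  constructor
  · rintro ⟨k', n', h1, h2⟩
    obtain ⟨rfl, rfl⟩ := tile_inj hw h1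
    exact h2
  · intro h
    exact ⟨k, n, rfl, h⟩

theorem tile_mem_leftSide (hw : 0 < w) {v : ℝ} {k n : ℤ} :
    tile w A c k n ∈ leftSide w A c v ↔ ¬ v < c k + 2 ^ k * (2 * w) * n := by
  constructor
  · rintro ⟨k', n', h1, h2⟩
    obtain ⟨rfl, rfl⟩ := tile_inj hw h1
    exact h2
  · intro h
    exact ⟨k, n, rfl, h⟩

/-- A wall runs along tile boundaries on both levels, so it cannot separate a tile from the one that
carries its `a`-edge. -/
theorem IsFrame.right_iff_of_down (F : IsFrame w 𝒯 A c σ) {v : ℝ} (hv : IsWall w c v)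
    {T T' : Set UpperHalfPlane} (hT : T ∈ 𝒯) (hT' : T' ∈ 𝒯) (h : Down w T T') :
    T ∈ rightSide w A c v ↔ T' ∈ rightSide w A c v := by
  obtain ⟨k, n, rfl⟩ := (F.mem_iff _).1 hT
  obtain ⟨k', n', rfl⟩ := (F.mem_iff _).1 hT'
  obtain ⟨rfl, η, h1⟩ := (F.down_iff _ _ _ _).1 h
  have hw := F.pos
  have key : ∀ k n p : ℤ, v = c k + 2 ^ k * w * (2 * p + 1) →
      (tile w A c k n ∈ rightSide w A c v ↔ p < n) := by
    intro k n p hp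
    have hpos : (0 : ℝ) < 2 ^ k * w := by positivity
    rw [tile_mem_rightSide hw, hp, show (2 : ℝ) ^ k * (2 * w) * n = 2 ^ k * w * (2 * n) by ring,
      add_lt_add_iff_left, mul_lt_mul_iff_right₀ hpos]
    have : (2 * p + 1 : ℝ) < 2 * n ↔ 2 * p + 1 < 2 * n := by exact_mod_cast Iff.rfl
    rw [this]
    omega
  obtain ⟨p', hp'⟩ := hv (k + 1)
  obtain ⟨p, hp⟩ := hv k
  rw [key _ _ _ hp, key _ _ _ hp']
  have hpos : (2 : ℝ) ^ k * w ≠ 0 := by positivity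
  rw [F.step, zpow_add₀ (two_ne_zero' ℝ), zpow_one] at hp'
  have h2 : (2 : ℝ) ^ k * w * (2 * p + 1) = 2 ^ k * w * ((σ k : ℤ) + 4 * p' + 2) := by
    linear_combination hp' - hp
  have h3 : 2 * p + 1 = σ k + 4 * p' + 2 := by exact_mod_cast mul_left_cancel₀ hpos h2
  rcases Int.units_eq_one_or η with rfl | rfl <;> simp at h1 <;> omega

theorem IsFrame.right_iff_of_reachable (F : IsFrame w 𝒯 A c σ) {v : ℝ} (hv : IsWall w c v)
    {T T' : Set UpperHalfPlane} (h : (linkGraph w 𝒯).Reachable T T') :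
    T ∈ rightSide w A c v ↔ T' ∈ rightSide w A c v := by
  obtain ⟨p⟩ := h
  induction p with
  | nil => rfl
  | cons h _ ih =>
    rw [← ih]
    rcases F.eq_or_down_of_share h.2.1.1 h.2.1.2 h.2.2 with h1 | h1 | h1
    · exact (h.1 h1).elim
    · exact F.right_iff_of_down hv h.2.1.1 h.2.1.2 h1
    · exact (F.right_iff_of_down hv h.2.1.2 h.2.1.1 h1).symm

theorem IsFrame.pools_eq_of_wall (F : IsFrame w 𝒯 A c σ) {v : ℝ} (hv : IsWall w c v) :
    pools w 𝒯 = {rightSide w A c v, leftSide w A c v} := by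
  have hw := F.pos
  have key : ∀ k n k' n' : ℤ, Linked w 𝒯 (tile w A c k n) (tile w A c k' n') ↔
      (v < c k + 2 ^ k * (2 * w) * n ↔ v < c k' + 2 ^ k' * (2 * w) * n') := by
    intro k n k' n'
    rw [linked_iff_reachable (F.tile_mem k n)]
    constructor
    · intro h
      have := F.right_iff_of_reachable hv h
      rwa [tile_mem_rightSide hw, tile_mem_rightSide hw] at this
    · intro h
      exact F.reachable_of_no_wall_between fun v' hv' => by rwa [hv'.unique hw hv]
  have hmem : ∀ T T', Linked w 𝒯 T T' → T' ∈ 𝒯 := by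
    rintro T T' ⟨n, f, -, rfl, hmem, -⟩
    exact hmem n le_rfl
  have key2 : ∀ k n : ℤ, (v < c k + 2 ^ k * (2 * w) * n →
      {T' | Linked w 𝒯 (tile w A c k n) T'} = rightSide w A c v) ∧
      (¬ v < c k + 2 ^ k * (2 * w) * n →
      {T' | Linked w 𝒯 (tile w A c k n) T'} = leftSide w A c v) := by
    intro k n
    constructor <;> intro h <;> ext T' <;> constructor
    · intro hT'
      obtain ⟨k', n', rfl⟩ := (F.mem_iff _).1 (hmem _ _ hT')
      exact (tile_mem_rightSide hw).2 (((key _ _ _ _).1 hT').1 h)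
    · rintro ⟨k', n', rfl, h'⟩
      exact (key _ _ _ _).2 (iff_of_true h h')
    · intro hT'
      obtain ⟨k', n', rfl⟩ := (F.mem_iff _).1 (hmem _ _ hT')
      exact (tile_mem_leftSide hw).2 fun h' => h (((key _ _ _ _).1 hT').2 h')
    · rintro ⟨k', n', rfl, h'⟩
      exact (key _ _ _ _).2 (iff_of_false h h')
  obtain ⟨m, hm⟩ := hv 0
  rw [zpow_zero, one_mul] at hm
  ext P
  constructor
  · rintro ⟨T, hT, rfl⟩
    obtain ⟨k, n, rfl⟩ := (F.mem_iff _).1 hT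
    by_cases h : v < c k + 2 ^ k * (2 * w) * n
    · exact Or.inl ((key2 k n).1 h)
    · exact Or.inr ((key2 k n).2 h)
  · rintro (rfl | rfl)
    · refine ⟨_, F.tile_mem 0 (m + 1), ((key2 _ _).1 ?_).symm⟩
      rw [hm, zpow_zero]
      push_cast
      linarith
    · refine ⟨_, F.tile_mem 0 m, ((key2 _ _).2 ?_).symm⟩
      rw [hm, zpow_zero]
      linarith

theorem IsFrame.ncard_pools_of_no_wall (F : IsFrame w 𝒯 A c σ) (h : ∀ v, ¬ IsWall w c v) :
    (pools w 𝒯).ncard = 1 := by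
  rw [F.pools_eq_of_no_wall h, ncard_singleton]

theorem IsFrame.ncard_pools_of_wall (F : IsFrame w 𝒯 A c σ) {v : ℝ} (hv : IsWall w c v) :
    (pools w 𝒯).ncard = 2 := by
  have hw := F.pos
  rw [F.pools_eq_of_wall hv, ncard_pair]
  intro h
  obtain ⟨m, hm⟩ := hv 0
  have h1 : tile w A c 0 (m + 1) ∈ rightSide w A c v := by
    rw [tile_mem_rightSide hw, hm, zpow_zero]
    push_cast
    linarith
  have h2 := h1
  rw [h, tile_mem_leftSide hw] at h2
  rw [tile_mem_rightSide hw] at h1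
  exact h2 h1

/-! ### Rings -/

theorem IsFrame.isRingSeq (F : IsFrame w 𝒯 A c σ) (k n : ℤ) (s : ℤˣ) :
    IsRingSeq w 𝒯 fun i => tile w A c k (n + s * i) := by
  refine ⟨?_, fun i => F.tile_mem _ _, fun i => ?_⟩
  · intro i j h
    have h1 := (tile_inj F.pos h).2
    rcases Int.units_eq_one_or s with rfl | rfl <;> simp at h1 <;> omega
  · rw [shareC_iff F.pos]
    refine ⟨rfl, s, -s, ?_⟩
    rw [Units.val_neg]
    ring

/-- A shared `c`-edge keeps the level and changes the number by `± 1`; injectivity forbids turning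
back, so the sign is constant. -/
theorem IsFrame.eq_tile_of_isRingSeq (F : IsFrame w 𝒯 A c σ) {f : ℤ → Set UpperHalfPlane}
    (hf : IsRingSeq w 𝒯 f) : ∃ (k n : ℤ) (s : ℤˣ), ∀ i, f i = tile w A c k (n + s * i) := by
  obtain ⟨hinj, hmem, hsh⟩ := hf
  choose K N hKN using fun i => (F.mem_iff _).1 (hmem i)
  have hK : ∀ i, K (i + 1) = K i ∧ ∃ s : ℤˣ, N (i + 1) = N i + s := by
    intro i
    have h := hsh i
    rw [hKN i, hKN (i + 1), shareC_iff F.pos] at h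
    obtain ⟨h1, η, η', h2⟩ := h
    refine ⟨h1.symm, ?_⟩
    have hne : N (i + 1) ≠ N i := by
      intro h3
      have : f (i + 1) = f i := by rw [hKN, hKN i, h1, h3]
      have := hinj this
      omega
    have : N (i + 1) = N i + 1 ∨ N (i + 1) = N i + -1 := by
      rcases Int.units_eq_one_or η with rfl | rfl <;>
        rcases Int.units_eq_one_or η' with rfl | rfl <;> simp at h2 <;> omega
    rcases this with h | h
    · exact ⟨1, h⟩
    · exact ⟨-1, h⟩
  choose hK s hs using hK
  have hs' : ∀ i, s (i + 1) = s i := by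
    intro i
    have h1 := hs i
    have h2 := hs (i + 1)
    have hne : N (i + 1 + 1) ≠ N i := by
      intro h3
      have : f (i + 1 + 1) = f i := by rw [hKN, hKN i, hK, hK, h3]
      have := hinj this
      omega
    rcases Int.units_eq_one_or (s i) with h | h <;>
      rcases Int.units_eq_one_or (s (i + 1)) with h' | h' <;> rw [h, h'] <;>
      rw [h] at h1 <;> rw [h'] at h2 <;> simp at h1 h2 <;> omega
  have key : ∀ i, K i = K 0 ∧ s i = s 0 ∧ N i = N 0 + s 0 * i := by
    intro i
    induction i using Int.induction_on with
    | zero => simp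
    | succ i ih =>
      obtain ⟨h1, h2, h3⟩ := ih
      refine ⟨(hK _).trans h1, (hs' _).trans h2, ?_⟩
      rw [hs, h2, h3]
      ring
    | pred i ih =>
      obtain ⟨h1, h2, h3⟩ := ih
      have e1 := hK (-(i : ℤ) - 1)
      have e2 := hs (-(i : ℤ) - 1)
      have e3 := hs' (-(i : ℤ) - 1)
      rw [sub_add_cancel] at e1 e2 e3
      refine ⟨e1.symm.trans h1, e3.symm.trans h2, ?_⟩
      rw [← e3, h2, h3] at e2
      linarith
  refine ⟨K 0, N 0, s 0, fun i => ?_⟩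
  rw [hKN i, (key i).1, (key i).2.2]

theorem IsFrame.isRing_iff (F : IsFrame w 𝒯 A c σ) (R : Set (Set UpperHalfPlane)) :
    IsRing w 𝒯 R ↔ ∃ k, R = range (tile w A c k) := by
  constructor
  · rintro ⟨f, hf, rfl⟩
    obtain ⟨k, n, s, h⟩ := F.eq_tile_of_isRingSeq hf
    refine ⟨k, ?_⟩
    ext T
    constructor
    · rintro ⟨i, rfl⟩
      exact ⟨_, (h i).symm⟩
    · rintro ⟨m, rfl⟩
      refine ⟨s * (m - n), ?_⟩
      rw [h, ← mul_assoc, ← Units.val_mul, Int.units_mul_self]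
      simp
  · rintro ⟨k, rfl⟩
    refine ⟨_, F.isRingSeq k 0 1, ?_⟩
    congr 1
    funext i
    simp

theorem IsFrame.isHalfRing_right (F : IsFrame w 𝒯 A c σ) (k n : ℤ) :
    IsHalfRing w 𝒯 (tile w A c k '' Ici n) := by
  refine ⟨_, F.isRingSeq k n 1, ?_⟩
  ext T
  constructor
  · rintro ⟨m, hm, rfl⟩
    exact ⟨m - n, by simpa using hm, by simp⟩
  · rintro ⟨i, hi, rfl⟩
    exact ⟨n + i, by simpa using hi, by simp⟩

theorem IsFrame.isHalfRing_left (F : IsFrame w 𝒯 A c σ) (k n : ℤ) :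
    IsHalfRing w 𝒯 (tile w A c k '' Iic n) := by
  refine ⟨_, F.isRingSeq k n (-1), ?_⟩
  ext T
  constructor
  · rintro ⟨m, hm, rfl⟩
    exact ⟨n - m, by simpa using hm, by simp⟩
  · rintro ⟨i, hi, rfl⟩
    refine ⟨n - i, by simpa using hi, ?_⟩
    simp [sub_eq_add_neg]

end Frame

/-! ### Symmetries and fundamental domains in a frame -/

/-- A criterion for fundamental domains. -/
theorem isFundDomain_of {Γ : Subgroup (UpperHalfPlane ≃ᵢ UpperHalfPlane)} {F : Set UpperHalfPlane}
    (h1 : closure (interior F) = F) (h2 : IsConnected (interior F))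
    (h3 : ∀ z, ∃ γ ∈ Γ, γ z ∈ F)
    (h4 : ∀ γ ∈ Γ, γ ≠ 1 → ∀ z ∈ interior F, γ z ∉ interior F) : IsFundDomain Γ F := by
  refine ⟨h1, h2, ?_, ?_⟩
  · refine eq_univ_of_forall fun z => ?_
    obtain ⟨γ, hγ, hz⟩ := h3 z
    exact mem_iUnion₂.2 ⟨γ⁻¹, Γ.inv_mem hγ, γ z, hz, γ.inv_apply_self z⟩
  · intro γ hγ δ hδ hne
    rw [interior_image, interior_image, disjoint_left]
    rintro _ ⟨z, hz, rfl⟩ ⟨z', hz', h⟩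
    refine h4 (γ⁻¹ * δ) (Γ.mul_mem (Γ.inv_mem hγ) hδ) (fun h => hne (inv_mul_eq_one.1 h)) z' hz' ?_
    rw [IsometryEquiv.mul_apply, h, IsometryEquiv.inv_apply_self]
    exact hz

theorem mem_symGroup_iff {𝒯 : Set (Set UpperHalfPlane)} {φ : UpperHalfPlane ≃ᵢ UpperHalfPlane} :
    φ ∈ symGroup 𝒯 ↔ (fun T : Set UpperHalfPlane => φ '' T) '' 𝒯 = 𝒯 := Iff.rfl

/-- The similarity `sim ε m b` maps every level `k` of centre lines to the level `m + k`. -/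
def IsCompatible (w : ℝ) (c : ℤ → ℝ) (ε : ℤˣ) (m : ℤ) (b : ℝ) : Prop :=
  ∀ k : ℤ, ∃ n : ℤ, (ε : ℤ) * 2 ^ m * c k + b = c (m + k) + 2 ^ (m + k) * (2 * w) * n

section Frame

variable {w : ℝ} {𝒯 : Set (Set UpperHalfPlane)} {A : Matrix.SpecialLinearGroup (Fin 2) ℝ}
  {c : ℤ → ℝ} {σ : ℤ → ℤˣ}

theorem conj_sim_image_tile (ε : ℤˣ) (m : ℤ) (b : ℝ) (k n : ℤ) :
    (slIso A * sim ε m b * (slIso A)⁻¹) '' tile w A c k n =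
      slIso A '' cell w (m + k)
        ((ε : ℤ) * 2 ^ m * c k + b + 2 ^ (m + k) * (2 * w) * ((ε * n : ℤ) : ℝ)) := by
  rw [tile, mul_image, inv_image_image, mul_image, sim_image_cell, zpow_add₀ (two_ne_zero' ℝ)]
  congr 2
  push_cast
  ring

theorem IsFrame.conj_mem_symGroup (F : IsFrame w 𝒯 A c σ) {ε : ℤˣ} {m : ℤ} {b : ℝ}
    (h : IsCompatible w c ε m b) : slIso A * sim ε m b * (slIso A)⁻¹ ∈ symGroup 𝒯 := by
  rw [mem_symGroup_iff]
  have key : ∀ k, ∃ n : ℤ, ∀ i : ℤ, (slIso A * sim ε m b * (slIso A)⁻¹) '' tile w A c k i =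
      tile w A c (m + k) (n + ε * i) := by
    intro k
    obtain ⟨n, hn⟩ := h k
    refine ⟨n, fun i => ?_⟩
    rw [conj_sim_image_tile, hn, tile]
    congr 2
    push_cast
    ring
  ext T
  constructor
  · rintro ⟨T', hT', rfl⟩
    obtain ⟨k, i, rfl⟩ := (F.mem_iff _).1 hT'
    obtain ⟨n, hn⟩ := key k
    simp only [hn]
    exact F.tile_mem _ _
  · intro hT
    obtain ⟨k, i, rfl⟩ := (F.mem_iff _).1 hT
    obtain ⟨n, hn⟩ := key (k - m)
    refine ⟨tile w A c (k - m) (ε * (i - n)), F.tile_mem _ _, ?_⟩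
    simp only [hn]
    rw [← mul_assoc, ← Units.val_mul, Int.units_mul_self]
    simp

/-- A tile and its image both arise from the prototile by a similarity followed by `slIso A`, and
the isometry onto a tile is unique up to reflection. -/
theorem IsFrame.exists_of_mem_symGroup (F : IsFrame w 𝒯 A c σ)
    {φ : UpperHalfPlane ≃ᵢ UpperHalfPlane} (hφ : φ ∈ symGroup 𝒯) :
    ∃ ε m b, φ = slIso A * sim ε m b * (slIso A)⁻¹ ∧ IsCompatible w c ε m b := by
  have hw := F.pos
  rw [mem_symGroup_iff] at hφ
  have hmem : ∀ k n, φ '' tile w A c k n ∈ 𝒯 := by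
    intro k n
    rw [← hφ]
    exact mem_image_of_mem _ (F.tile_mem k n)
  have hsim : ∃ ε m b, φ = slIso A * sim ε m b * (slIso A)⁻¹ := by
    obtain ⟨m, n, h⟩ := (F.mem_iff _).1 (hmem 0 0)
    rw [tile, tile, image_cell_eq, image_cell_eq, ← mul_image] at h
    generalize c 0 + 2 ^ (0 : ℤ) * (2 * w) * ((0 : ℤ) : ℝ) = x at h
    generalize c m + 2 ^ m * (2 * w) * (n : ℝ) = y at h
    rcases eq_or_eq_mul_reflection hw h.symm with h | h
    · rw [← mul_assoc, ← eq_mul_inv_iff_mul_eq, ← eq_mul_inv_iff_mul_eq, sim_inv,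
        mul_assoc (slIso A), sim_mul_sim] at h
      exact ⟨_, _, _, h⟩
    · rw [← mul_assoc, ← eq_mul_inv_iff_mul_eq, ← eq_mul_inv_iff_mul_eq, sim_inv,
        mul_assoc (slIso A), sim_mul_sim, mul_assoc (slIso A), sim_mul_sim] at h
      exact ⟨_, _, _, h⟩
  obtain ⟨ε, m, b, rfl⟩ := hsim
  refine ⟨ε, m, b, rfl, fun k => ?_⟩
  obtain ⟨k', n', h⟩ := (F.mem_iff _).1 (hmem k 0)
  rw [conj_sim_image_tile, tile, image_eq_image_iff] at h
  obtain ⟨h1, -, rfl, -⟩ := rect_injective (by positivity) (by omega) h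
  refine ⟨n', ?_⟩
  rw [← h1]
  simp

theorem IsCompatible.inv {ε : ℤˣ} {m : ℤ} {b : ℝ} (h : IsCompatible w c ε m b) :
    IsCompatible w c ε (-m) (-((ε : ℤ) * 2 ^ (-m) * b)) := by
  intro k
  obtain ⟨n, hn⟩ := h (-m + k)
  rw [add_neg_cancel_left] at hn
  refine ⟨-(ε * n), ?_⟩
  have h1 := cast_units_mul_self ε
  have h2 : (2 : ℝ) ^ (-m) * 2 ^ m = 1 := by
    rw [← zpow_add₀ (two_ne_zero' ℝ)]
    simp
  rw [zpow_add₀ (two_ne_zero' ℝ)]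
  push_cast
  linear_combination (-((ε : ℤ) : ℝ) * 2 ^ (-m)) * hn + c (-m + k) * h1 +
    (((ε : ℤ) : ℝ) * (ε : ℤ) * c (-m + k)) * h2

theorem isCompatible_one : IsCompatible w c 1 0 0 := by
  intro k
  refine ⟨0, ?_⟩
  simp

/-- A criterion for fundamental domains of the symmetry group in terms of a frame. -/
theorem IsFrame.isFundDomain_box (F : IsFrame w 𝒯 A c σ) {I J : Set ℝ}
    (hI : closure (interior I) = I) (hJ : closure (interior J) ∩ Ioi 0 = J)
    (hI' : IsConnected (interior I)) (hJ' : IsConnected (interior J))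
    (hcov : ∀ z : UpperHalfPlane, ∃ ε m b, IsCompatible w c ε m b ∧ sim ε m b z ∈ box I J)
    (hdis : ∀ ε m b, IsCompatible w c ε m b → sim ε m b ≠ 1 → ∀ z ∈ box (interior I) (interior J),
      sim ε m b z ∉ box (interior I) (interior J)) :
    IsFundDomain (symGroup 𝒯) (slIso A '' box I J) := by
  have hpos : J ⊆ Ioi 0 := by
    rw [← hJ]
    exact inter_subset_right
  refine isFundDomain_of ?_ ?_ ?_ ?_
  · rw [interior_image, closure_image, interior_box, closure_box, hI]
    congr 1
    ext z
    -- Only positive heights occur. Hence `hJ` requires closedness only relative to `Ioi 0`, which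
    -- admits `J = Ioi 0`.
    have h : z.im ∈ closure (interior J) ↔ z.im ∈ J := by
      conv_rhs => rw [← hJ]
      simp [z.im_pos]
    rw [mem_box, mem_box, h]
  · rw [interior_image, interior_box]
    exact (isConnected_box hI' hJ' (interior_subset.trans hpos)).image _
      (slIso A).continuous.continuousOn
  · intro z
    obtain ⟨ε, m, b, h1, h2⟩ := hcov ((slIso A)⁻¹ z)
    exact ⟨_, F.conj_mem_symGroup h1, mem_image_of_mem _ h2⟩
  · intro γ hγ hne z hz
    obtain ⟨ε, m, b, rfl, h⟩ := F.exists_of_mem_symGroup hγ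
    have hne' : sim ε m b ≠ 1 := by
      intro h
      apply hne
      rw [h]
      simp
    rw [interior_image, interior_box] at hz ⊢
    obtain ⟨u, hu, rfl⟩ := hz
    rw [IsometryEquiv.mul_apply, IsometryEquiv.inv_apply_self, IsometryEquiv.mul_apply,
      (slIso A).injective.mem_set_image]
    exact hdis ε m b h hne' u hu

/-! ### Symmetries of a tiling with a wall -/

/-- A symmetry maps the wall to a wall, hence to itself. Conversely, the wall determines the
boundaries of every level, so any similarity fixing it respects them. -/
theorem IsFrame.isCompatible_iff_of_wall (F : IsFrame w 𝒯 A c σ) {v : ℝ} (hv : IsWall w c v)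
    {ε : ℤˣ} {m : ℤ} {b : ℝ} : IsCompatible w c ε m b ↔ b = v - (ε : ℤ) * 2 ^ m * v := by
  constructor
  · intro h
    have h1 : IsWall w c ((ε : ℤ) * 2 ^ m * v + b) := by
      intro k
      obtain ⟨n, hn⟩ := hv (-m + k)
      obtain ⟨n', hn'⟩ := h (-m + k)
      rw [add_neg_cancel_left] at hn'
      have h2 : (2 : ℝ) ^ m * 2 ^ (-m + k) = 2 ^ k := by
        rw [← zpow_add₀ (two_ne_zero' ℝ)]
        simp
      have h3 : ∃ j : ℤ, 2 * n' + ε * (2 * n + 1) = 2 * j + 1 := by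
        rcases Int.units_eq_one_or ε with rfl | rfl
        · refine ⟨n' + n, ?_⟩
          simp
          ring
        · refine ⟨n' - n - 1, ?_⟩
          simp
          ring
      obtain ⟨j, hj⟩ := h3
      refine ⟨j, ?_⟩
      have hj' : 2 * (n' : ℝ) + (ε : ℤ) * (2 * n + 1) = 2 * j + 1 := by exact_mod_cast hj
      rw [hn]
      linear_combination hn' + ((ε : ℤ) : ℝ) * w * (2 * n + 1) * h2 + 2 ^ k * w * hj'
    have := h1.unique F.pos hv
    linarith
  · rintro rfl k
    obtain ⟨n, hn⟩ := hv k
    obtain ⟨n', hn'⟩ := hv (m + k)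
    have h3 : ∃ j : ℤ, 2 * n' + 1 - ε * (2 * n + 1) = 2 * j := by
      rcases Int.units_eq_one_or ε with rfl | rfl
      · refine ⟨n' - n, ?_⟩
        simp
        ring
      · refine ⟨n' + n + 1, ?_⟩
        simp
        ring
    obtain ⟨j, hj⟩ := h3
    refine ⟨j, ?_⟩
    have hj' : 2 * (n' : ℝ) + 1 - (ε : ℤ) * (2 * n + 1) = 2 * j := by exact_mod_cast hj
    rw [zpow_add₀ (two_ne_zero' ℝ)] at hn' ⊢
    linear_combination hn' - ((ε : ℤ) : ℝ) * 2 ^ m * hn + 2 ^ m * 2 ^ k * w * hj'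

theorem strip_disjoint {y : ℝ} {j k m : ℤ} (h1 : (2 : ℝ) ^ j < y) (h2 : y < 2 ^ (j + k))
    (h3 : (2 : ℝ) ^ j < 2 ^ m * y) (h4 : 2 ^ m * y < (2 : ℝ) ^ (j + k)) : -k < m ∧ m < k := by
  have hm : (0 : ℝ) < 2 ^ m := by positivity
  constructor
  · have h5 : (2 : ℝ) ^ j < 2 ^ (m + (j + k)) := by
      rw [zpow_add₀ (two_ne_zero' ℝ) m]
      exact h3.trans (mul_lt_mul_of_pos_left h2 hm)
    have := (zpow_lt_zpow_iff_right₀ one_lt_two).1 h5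
    omega
  · have h5 : (2 : ℝ) ^ (m + j) < 2 ^ (j + k) := by
      rw [zpow_add₀ (two_ne_zero' ℝ) m]
      exact (mul_lt_mul_of_pos_left h1 hm).trans h4
    have := (zpow_lt_zpow_iff_right₀ one_lt_two).1 h5
    omega

theorem closure_Ioo_zpow_inter {j k : ℤ} (h : j < k) :
    closure (interior (Icc ((2 : ℝ) ^ j) (2 ^ k))) ∩ Ioi 0 = Icc (2 ^ j) (2 ^ k) := by
  have h1 : (2 : ℝ) ^ j < 2 ^ k := zpow_lt_zpow_right₀ one_lt_two h
  have h2 : (0 : ℝ) < 2 ^ j := by positivity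
  rw [interior_Icc, closure_Ioo h1.ne, inter_eq_left]
  exact fun x hx => h2.trans_le hx.1

theorem isConnected_interior_Icc_zpow {j k : ℤ} (h : j < k) :
    IsConnected (interior (Icc ((2 : ℝ) ^ j) (2 ^ k))) := by
  rw [interior_Icc]
  exact isConnected_Ioo (zpow_lt_zpow_right₀ one_lt_two h)

/-- The scalings by powers of `2` that fix the wall permute the levels simply transitively, and the
reflection in the wall exchanges the sides. -/
theorem IsFrame.isFundDomain_half_strip (F : IsFrame w 𝒯 A c σ) {v : ℝ} (hv : IsWall w c v) (k : ℤ)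
    {I : Set ℝ} (hI : I = Ici v ∨ I = Iic v) :
    IsFundDomain (symGroup 𝒯) (slIso A '' box I (Icc (2 ^ k) (2 ^ (k + 1)))) := by
  refine F.isFundDomain_box ?_ (closure_Ioo_zpow_inter (by omega)) ?_
    (isConnected_interior_Icc_zpow (by omega)) ?_ ?_
  · rcases hI with rfl | rfl <;> simp
  · rcases hI with rfl | rfl
    · rw [interior_Ici]
      exact isConnected_Ioi
    · rw [interior_Iic]
      exact isConnected_Iio
  · intro z
    obtain ⟨N, hN1, hN2⟩ := exists_mem_Ico_zpow z.im_pos (one_lt_two (α := ℝ))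
    have hpos : (0 : ℝ) < 2 ^ (k - N) := by positivity
    have hε : ∃ ε : ℤˣ, (ε : ℤ) * 2 ^ (k - N) * z.re + (v - (ε : ℤ) * 2 ^ (k - N) * v) ∈ I := by
      have h1 : ∀ ε : ℤˣ, (ε : ℤ) * 2 ^ (k - N) * z.re + (v - (ε : ℤ) * 2 ^ (k - N) * v) =
          v + (ε : ℤ) * (2 ^ (k - N) * (z.re - v)) := by
        intro ε
        ring
      simp only [h1]
      rcases hI with rfl | rfl <;> rcases le_total v z.re with h | h
      · refine ⟨1, ?_⟩
        have := mul_nonneg hpos.le (sub_nonneg.2 h)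
        simpa using this
      · refine ⟨-1, ?_⟩
        have := mul_nonneg hpos.le (sub_nonneg.2 h)
        rw [mem_Ici]
        push_cast
        linarith
      · refine ⟨-1, ?_⟩
        have := mul_nonneg hpos.le (sub_nonneg.2 h)
        rw [mem_Iic]
        push_cast
        linarith
      · refine ⟨1, ?_⟩
        have := mul_nonneg hpos.le (sub_nonneg.2 h)
        rw [mem_Iic]
        push_cast
        linarith
    obtain ⟨ε, hε⟩ := hε
    refine ⟨ε, k - N, _, (F.isCompatible_iff_of_wall hv).2 rfl, hε, ?_, ?_⟩
    · rw [sim_im]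
      calc (2 : ℝ) ^ k = 2 ^ (k - N) * 2 ^ N := by rw [← zpow_add₀ (two_ne_zero' ℝ)]; simp
        _ ≤ _ := by gcongr
    · rw [sim_im]
      calc _ ≤ (2 : ℝ) ^ (k - N) * 2 ^ (N + 1) := by gcongr
        _ = 2 ^ (k + 1) := by
          rw [← zpow_add₀ (two_ne_zero' ℝ)]
          congr 1
          ring
  · intro ε m b h hne z hz hz'
    rw [mem_box, interior_Icc] at hz hz'
    rw [F.isCompatible_iff_of_wall hv] at h
    have hm := strip_disjoint hz.2.1 hz.2.2 hz'.2.1 hz'.2.2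
    obtain rfl : m = 0 := by omega
    rcases Int.units_eq_one_or ε with rfl | rfl
    · apply hne
      rw [h]
      simp [sim_one_zero]
    · have h1 := hz.1
      have h2 := hz'.1
      rw [sim_re, h] at h2
      rcases hI with rfl | rfl
      · rw [interior_Ici, mem_Ioi] at h1 h2
        push_cast at h2
        simp only [zpow_zero] at h2
        linarith
      · rw [interior_Iic, mem_Iio] at h1 h2
        push_cast at h2
        simp only [zpow_zero] at h2
        linarith

/-! ### Symmetries of a tiling without walls -/

/-- A translation length would be a multiple of every tile width. The axis of a reflection is a
centre line or a boundary of level `k + 1`, hence a boundary of level `k`, for every `k`: a wall. -/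
theorem IsFrame.sim_eq_one_of_no_wall (F : IsFrame w 𝒯 A c σ) (hno : ∀ v, ¬ IsWall w c v)
    {ε : ℤˣ} {b : ℝ} (h : IsCompatible w c ε 0 b) : sim ε 0 b = 1 := by
  have hw := F.pos
  rcases Int.units_eq_one_or ε with rfl | rfl
  · obtain ⟨K, hK⟩ := exists_lt_two_zpow_mul hw |b|
    obtain ⟨n, hn⟩ := h K
    have h1 := hK K le_rfl
    have hpos : (0 : ℝ) < 2 ^ K * (2 * w) := by positivity
    simp only [zero_add, zpow_zero, mul_one, Units.val_one, Int.cast_one, one_mul,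
      add_right_inj] at hn
    rw [hn, abs_mul, abs_of_pos hpos] at h1
    have h3 : |(n : ℝ)| < 1 := by
      by_contra! h
      nlinarith
    have h4 : n = 0 := by
      rw [← Int.cast_abs] at h3
      exact Int.abs_lt_one_iff.1 (by exact_mod_cast h3)
    rw [hn, h4]
    simp [sim_one_zero]
  · refine (hno (b / 2) fun k => ?_).elim
    obtain ⟨n, hn⟩ := h (k + 1)
    rw [zero_add, F.step, zpow_add₀ (two_ne_zero' ℝ)] at hn
    simp at hn
    rcases Int.units_eq_one_or (σ k) with h1 | h1
    · refine ⟨n, ?_⟩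
      rw [h1] at hn
      push_cast at hn
      linear_combination hn / 2
    · refine ⟨n - 1, ?_⟩
      rw [h1] at hn
      push_cast at hn ⊢
      linear_combination hn / 2

/-- The steps add up to at most `(2 ^ k - 1) * w`. So `c 0` stays below the tile number `0` of every
level `k ≥ 0`. -/
theorem IsFrame.abs_center_sub_lt (F : IsFrame w 𝒯 A c σ) {k : ℤ} (hk : 0 ≤ k) :
    |c 0 - c k| < 2 ^ k * w := by
  have hw := F.pos
  have key : |c 0 - c k| ≤ (2 ^ k - 1) * w := by
    induction k, hk using Int.leInduction with
    | base => simp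
    | succ m hm ih =>
      have hpos : (0 : ℝ) < 2 ^ m * w := by positivity
      have h1 : |2 ^ m * w * ((σ m : ℤ) : ℝ)| = 2 ^ m * w := by
        rw [abs_mul, abs_cast_units, mul_one, abs_of_pos hpos]
      rw [F.step, ← sub_sub]
      refine (abs_sub _ _).trans ?_
      rw [h1, zpow_add₀ (two_ne_zero' ℝ), zpow_one]
      linarith
  linarith

/-- A symmetry of a tiling without walls eventually shifts the signs, up to a global sign. -/
theorem IsFrame.eventually_shift (F : IsFrame w 𝒯 A c σ) (hno : ∀ v, ¬ IsWall w c v)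
    {ε : ℤˣ} {m : ℤ} {b : ℝ} (h : IsCompatible w c ε m b) :
    ∃ K : ℤ, 0 ≤ K ∧ ∀ k, K ≤ k → σ (m + k) = ε * σ k := by
  have hw := F.pos
  set x' := (ε : ℤ) * 2 ^ m * c 0 + b with hx'
  have hidx : ∀ k, 0 ≤ k → idx w c k (c 0) = 0 := by
    intro k hk
    have := abs_lt.1 (F.abs_center_sub_lt hk)
    rw [idx_eq_iff hw]
    push_cast
    constructor <;> linarith
  -- The chain over `c 0` consists of the tiles number `0`. Its image under the symmetry is the
  -- chain over `x'`, and without walls the two merge.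
  have hmerge : ∃ K, idx w c K (c 0) = idx w c K x' := by
    by_contra! hne
    rcases le_total (c 0) x' with hx | hx
    · obtain ⟨v, -, -, hv⟩ := F.exists_wall_between hx hne
      exact hno v hv
    · obtain ⟨v, -, -, hv⟩ := F.exists_wall_between hx fun k => (hne k).symm
      exact hno v hv
  obtain ⟨K₁, hK₁⟩ := hmerge
  -- The threshold ensures `0 ≤ k`, `0 ≤ m + k` and `K₁ ≤ m + k`. After merging, centres `c k` go to
  -- centres `c (m + k)`, and consecutive differences compare the signs.
  have key : ∀ k, max 0 (max (-m) (K₁ - m)) ≤ k → (ε : ℤ) * 2 ^ m * c k + b = c (m + k) := by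
    intro k hk
    obtain ⟨n, hn⟩ := h k
    have h1 : idx w c (m + k) x' = n := by
      have h2 := F.abs_center_sub_lt (show 0 ≤ k by omega)
      have hm : (0 : ℝ) < 2 ^ m := by positivity
      have h3 : |((ε : ℤ) : ℝ) * (2 ^ m * (c 0 - c k))| < 2 ^ m * 2 ^ k * w := by
        rw [abs_mul, abs_cast_units, one_mul, abs_mul, abs_of_pos hm, mul_assoc]
        exact mul_lt_mul_of_pos_left h2 hm
      have h4 := abs_lt.1 h3
      rw [idx_eq_iff hw, hx']
      rw [zpow_add₀ (two_ne_zero' ℝ)] at hn ⊢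
      constructor <;> linarith
    have h2 := F.idx_eq_of_le (show K₁ ≤ m + k by omega) hK₁
    rw [h1, hidx _ (by omega)] at h2
    rw [hn, ← h2]
    simp
  refine ⟨max 0 (max (-m) (K₁ - m)), le_max_left _ _, fun k hk => ?_⟩
  have h1 := key k hk
  have h2 := key (k + 1) (by omega)
  have hpos : (2 : ℝ) ^ m * 2 ^ k * w ≠ 0 := by positivity
  rw [← add_assoc, F.step, F.step, zpow_add₀ (two_ne_zero' ℝ)] at h2
  have h3 : (2 : ℝ) ^ m * 2 ^ k * w * ((σ (m + k) : ℤ) : ℝ) =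
      2 ^ m * 2 ^ k * w * ((ε : ℤ) * (σ k : ℤ)) := by
    linear_combination h1 - h2
  have h4 := mul_left_cancel₀ hpos h3
  apply Units.ext
  rw [Units.val_mul]
  exact_mod_cast h4

/-- If a shift changes the signs by a global sign, it is induced by a symmetry. -/
theorem IsFrame.isCompatible_of_shift (F : IsFrame w 𝒯 A c σ) {ε : ℤˣ} {m : ℤ}
    (h : ∀ k, 0 ≤ k → σ (m + k) = ε * σ k) :
    IsCompatible w c ε m (c m - (ε : ℤ) * 2 ^ m * c 0) := by
  intro k
  rcases le_total 0 k with hk | hk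
  · refine ⟨0, ?_⟩
    induction k, hk using Int.leInduction with
    | base => simp
    | succ k hk ih =>
      rw [← add_assoc, F.step, F.step, h k hk, zpow_add₀ (two_ne_zero' ℝ) m]
      push_cast
      linear_combination ih
  · induction k, hk using Int.leInductionDown with
    | base =>
      refine ⟨0, ?_⟩
      simp
    | pred k hk ih =>
      obtain ⟨n, hn⟩ := ih
      obtain ⟨l, rfl⟩ : ∃ l, k = l + 1 := ⟨k - 1, by ring⟩
      rw [← add_assoc, F.step, F.step, zpow_add₀ (two_ne_zero' ℝ) (m + l) 1,
        zpow_add₀ (two_ne_zero' ℝ) m l, zpow_one] at hn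
      -- Below level `0` the signs need not match, but two odd signs differ by an even number, which
      -- is a whole number of tile widths.
      have h3 : ∃ j : ℤ, (σ (m + l) : ℤ) - ε * σ l + 4 * n = 2 * j := by
        rcases Int.units_eq_one_or (σ (m + l)) with h1 | h1 <;>
          rcases Int.units_eq_one_or ε with h2 | h2 <;>
          rcases Int.units_eq_one_or (σ l) with h4 | h4 <;> rw [h1, h2, h4]
        · exact ⟨2 * n, by simp; ring⟩
        · exact ⟨2 * n + 1, by simp; ring⟩
        · exact ⟨2 * n + 1, by simp; ring⟩
        · exact ⟨2 * n, by simp; ring⟩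
        · exact ⟨2 * n - 1, by simp; ring⟩
        · exact ⟨2 * n, by simp; ring⟩
        · exact ⟨2 * n, by simp; ring⟩
        · exact ⟨2 * n - 1, by simp; ring⟩
      obtain ⟨j, hj⟩ := h3
      have hj' : ((σ (m + l) : ℤ) : ℝ) - (ε : ℤ) * (σ l : ℤ) + 4 * n = 2 * j := by
        exact_mod_cast hj
      refine ⟨j, ?_⟩
      rw [add_sub_cancel_right, zpow_add₀ (two_ne_zero' ℝ)]
      linear_combination hn + 2 ^ m * 2 ^ l * w * hj'

end Frame

/-! ### Periods up to sign -/

/-- Shifting `s` by `m` changes `s` by a global sign. -/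
def IsSignedPeriod (s : ℕ → ℤˣ) (m : ℕ) : Prop := ∃ ε : ℤˣ, ∀ i, s (i + m) = ε * s i

theorem IsSignedPeriod.mul {s : ℕ → ℤˣ} {m : ℕ} (h : IsSignedPeriod s m) (q : ℕ) :
    IsSignedPeriod s (m * q) := by
  obtain ⟨ε, hε⟩ := h
  refine ⟨ε ^ q, fun i => ?_⟩
  induction q with
  | zero => simp
  | succ q ih => rw [Nat.mul_succ, ← add_assoc, hε, ih, pow_succ', mul_assoc]

theorem HasPeriod.add_mul {s : ℕ → ℤˣ} {p : ℕ} (h : HasPeriod s p) (i q : ℕ) :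
    s (i + p * q) = s i := by
  induction q with
  | zero => simp
  | succ q ih => rw [Nat.mul_succ, ← add_assoc, ← h.2, ih]

theorem IsPeriodic.hasPeriod_leastPeriod {s : ℕ → ℤˣ} (hs : IsPeriodic s) :
    HasPeriod s (leastPeriod s) := Nat.sInf_mem hs

theorem IsPeriodic.leastPeriod_dvd {s : ℕ → ℤˣ} (hs : IsPeriodic s) {m : ℕ}
    (hm : ∀ i, s (i + m) = s i) : leastPeriod s ∣ m := by
  have hp := hs.hasPeriod_leastPeriod
  set p := leastPeriod s
  by_contra hdvd
  have hpos : 0 < m % p := Nat.pos_of_ne_zero fun h => hdvd (Nat.dvd_of_mod_eq_zero h)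
  have h1 : HasPeriod s (m % p) := by
    refine ⟨hpos, fun i => ?_⟩
    rw [← hp.add_mul (i + m % p) (m / p), add_assoc, Nat.mod_add_div, hm]
  have h2 : p ≤ m % p := Nat.sInf_le h1
  exact absurd (Nat.mod_lt m hp.1) (not_lt.2 h2)

theorem IsPeriodic.one_le_essentialPeriod {s : ℕ → ℤˣ} (hs : IsPeriodic s) :
    1 ≤ essentialPeriod s := by
  have hp := hs.hasPeriod_leastPeriod.1
  unfold essentialPeriod
  split_ifs with h
  · obtain ⟨⟨r, hr⟩, -⟩ := h
    omega
  · exact hp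

theorem IsPeriodic.isSignedPeriod_essentialPeriod {s : ℕ → ℤˣ} (hs : IsPeriodic s) :
    IsSignedPeriod s (essentialPeriod s) := by
  unfold essentialPeriod
  split_ifs with h
  · refine ⟨-1, fun i => ?_⟩
    rw [h.2 i]
    simp
  · refine ⟨1, fun i => ?_⟩
    rw [← hs.hasPeriod_leastPeriod.2 i, one_mul]

/-- With global sign `-1` the least period `p` divides `2 * m` but not `m`. So `m` is an odd
multiple of `p / 2`, and the shift by `p / 2` itself changes all signs. -/
theorem IsPeriodic.essentialPeriod_dvd {s : ℕ → ℤˣ} (hs : IsPeriodic s) {m : ℕ}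
    (hm : IsSignedPeriod s m) : essentialPeriod s ∣ m := by
  have hp := hs.hasPeriod_leastPeriod
  have hle : essentialPeriod s ∣ leastPeriod s := by
    unfold essentialPeriod
    split_ifs with h
    · exact Nat.div_dvd_of_dvd h.1.two_dvd
    · exact dvd_rfl
  obtain ⟨ε, hε⟩ := hm
  rcases Int.units_eq_one_or ε with rfl | rfl
  · exact hle.trans (hs.leastPeriod_dvd fun i => by rw [hε, one_mul])
  · have h1 : leastPeriod s ∣ 2 * m := hs.leastPeriod_dvd fun i => by
      rw [two_mul, ← add_assoc, hε, hε]
      simp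
    have h2 : ¬ leastPeriod s ∣ m := by
      rintro ⟨q, rfl⟩
      have h3 := hε 0
      rw [hp.add_mul] at h3
      rcases Int.units_eq_one_or (s 0) with h | h <;> rw [h] at h3 <;> exact absurd h3 (by decide)
    obtain ⟨q, hq⟩ := h1
    have hodd : Odd q := by
      by_contra h
      rw [Nat.not_odd_iff_even] at h
      obtain ⟨r, rfl⟩ := h
      exact h2 ⟨r, by linarith⟩
    obtain ⟨r, rfl⟩ := hodd
    have heven : Even (leastPeriod s) := by
      have : Even (leastPeriod s * (2 * r + 1)) := by rw [← hq]; exact even_two_mul m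
      rcases Nat.even_mul.1 this with h | h
      · exact h
      · exact absurd h (by simp)
    obtain ⟨t, ht⟩ := heven
    have hmt : m = t + leastPeriod s * r := by
      have : 2 * m = 2 * (t + leastPeriod s * r) := by
        rw [hq]
        linear_combination ht
      omega
    have hhalf : leastPeriod s / 2 = t := by omega
    have hcond : Even (leastPeriod s) ∧ ∀ i, s i = -s (i + leastPeriod s / 2) := by
      refine ⟨⟨t, ht⟩, fun i => ?_⟩
      have h3 := hε i
      rw [hmt, ← add_assoc, hp.add_mul] at h3
      rw [hhalf, h3]
      simp
    have hess : essentialPeriod s = t := by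
      unfold essentialPeriod
      rw [if_pos hcond, hhalf]
    rw [hess, hmt, ht]
    exact ⟨1 + 2 * r, by ring⟩

/-- A global sign change by a shift of the end of a periodic sequence is one of the whole
sequence. -/
theorem IsPeriodic.isSignedPeriod_of_eventually {s : ℕ → ℤˣ} (hs : IsPeriodic s) {m K : ℕ}
    {ε : ℤˣ} (h : ∀ i, K ≤ i → s (i + m) = ε * s i) : IsSignedPeriod s m := by
  obtain ⟨p, hp⟩ := hs
  refine ⟨ε, fun i => ?_⟩
  -- Adding `K` periods moves every index beyond `K` without changing the values.
  have h1 : K ≤ i + p * K := by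
    have := Nat.le_mul_of_pos_left K hp.1
    omega
  have h2 := h _ h1
  rwa [hp.add_mul, add_right_comm, hp.add_mul] at h2

section Frame

variable {w : ℝ} {𝒯 : Set (Set UpperHalfPlane)} {A : Matrix.SpecialLinearGroup (Fin 2) ℝ}
  {c : ℤ → ℝ} {σ : ℤ → ℤˣ}

/-! ### Tails -/

theorem IsFrame.isTailSeq (F : IsFrame w 𝒯 A c σ) (K : ℤ) :
    IsTailSeq w 𝒯 (tile w A c K 0) fun i => σ (K + i) := by
  have hstep : ∀ i : ℕ, K + ((i + 1 : ℕ) : ℤ) = K + i + 1 := by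
    intro i
    push_cast
    ring
  refine ⟨fun i => tile w A c (K + i) 0, ⟨by simp, fun i => F.tile_mem _ _, ?_, ?_⟩, ?_⟩
  · intro i j h
    have := (tile_inj F.pos h).1
    omega
  · intro i
    dsimp only
    rw [hstep, F.down_iff]
    refine ⟨rfl, -σ (K + i), ?_⟩
    simp
  · intro i
    dsimp only
    rw [hstep]
    rcases Int.units_eq_one_or (σ (K + i)) with h | h
    · obtain ⟨e, h1, h2⟩ := (F.b1_iff (K + i) 0 (K + i + 1) 0).2 ⟨rfl, by simp [h]⟩
      exact ⟨e, h1, Or.inl ⟨h2, h⟩⟩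
    · obtain ⟨e, h1, h2⟩ := (F.b2_iff (K + i) 0 (K + i + 1) 0).2 ⟨rfl, by simp [h]⟩
      exact ⟨e, h1, Or.inr ⟨h2, h⟩⟩

/-- Each step of a tail is forced: in `0 = σ k + 4 * n' + η` the signs must cancel, so `n' = 0`. -/
theorem IsFrame.tailSeq_eq (F : IsFrame w 𝒯 A c σ) {s : ℕ → ℤˣ}
    (h : IsTailSeq w 𝒯 (tile w A c 0 0) s) (i : ℕ) : s i = σ i := by
  obtain ⟨t, ⟨h0, hmem, -, hdown⟩, hs⟩ := h
  have ht : ∀ i : ℕ, t i = tile w A c i 0 := by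
    intro i
    induction i with
    | zero => simpa using h0
    | succ i ih =>
      obtain ⟨k', n', hk⟩ := (F.mem_iff _).1 (hmem (i + 1))
      have h1 := hdown i
      rw [ih, hk, F.down_iff] at h1
      obtain ⟨rfl, η, h2⟩ := h1
      have : n' = 0 := by
        rcases Int.units_eq_one_or (σ i) with h | h <;>
          rcases Int.units_eq_one_or η with rfl | rfl <;> rw [h] at h2 <;> simp at h2 <;> omega
      rw [hk, this]
      push_cast
      rfl
  obtain ⟨e, h1, h2⟩ := hs i
  rw [ht] at h1 h2
  rcases h2 with ⟨h2, h3⟩ | ⟨h2, h3⟩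
  · have h4 := ((F.b1_iff _ _ _ _).1 ⟨e, h1, h2⟩).2
    rcases Int.units_eq_one_or (σ i) with h | h
    · rw [h, h3]
    · simp [h] at h4
  · have h4 := ((F.b2_iff _ _ _ _).1 ⟨e, h1, h2⟩).2
    rcases Int.units_eq_one_or (σ i) with h | h
    · simp [h] at h4
    · rw [h, h3]

/-! ### Unions of tiles -/

theorem mem_cell_iff (w : ℝ) (k n : ℤ) (z : UpperHalfPlane) :
    z ∈ cell w k (c k + 2 ^ k * (2 * w) * n) ↔
      (c k + 2 ^ k * w * (2 * n - 1) ≤ z.re ∧ z.re ≤ c k + 2 ^ k * w * (2 * n + 1)) ∧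
        2 ^ k ≤ z.im ∧ z.im ≤ 2 ^ (k + 1) := by
  rw [cell, mem_rect, abs_sub_le_iff]
  constructor <;> rintro ⟨⟨h1, h2⟩, h3⟩ <;> exact ⟨⟨by linarith, by linarith⟩, h3⟩

theorem sUnion_tile_image (k : ℤ) (S : Set ℤ) :
    ⋃₀ (tile w A c k '' S) = slIso A '' ⋃ n ∈ S, cell w k (c k + 2 ^ k * (2 * w) * n) := by
  rw [sUnion_image, image_iUnion₂]
  rfl

theorem sUnion_level (hw : 0 < w) (k : ℤ) : ⋃₀ (range (tile w A c k)) =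
    slIso A '' box univ (Icc (2 ^ k) (2 ^ (k + 1))) := by
  rw [← image_univ, sUnion_tile_image]
  congr 1
  ext z
  simp only [mem_iUnion, mem_univ, exists_const, mem_cell_iff, mem_box, true_and, mem_Icc]
  constructor
  · rintro ⟨n, -, h⟩
    exact h
  · intro h
    obtain ⟨h1, h2⟩ := (idx_eq_iff (c := c) hw k _ z.re).1 rfl
    exact ⟨_, ⟨h1, h2.le⟩, h⟩

theorem sUnion_right (hw : 0 < w) (k n : ℤ) : ⋃₀ (tile w A c k '' Ici n) =
    slIso A '' box (Ici (c k + 2 ^ k * w * (2 * n - 1))) (Icc (2 ^ k) (2 ^ (k + 1))) := by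
  have hpos : (0 : ℝ) < 2 ^ k * w := by positivity
  rw [sUnion_tile_image]
  congr 1
  ext z
  simp only [mem_iUnion, mem_Ici, exists_prop, mem_cell_iff, mem_box, mem_Icc]
  constructor
  · rintro ⟨i, hi, h1, h2⟩
    refine ⟨le_trans ?_ h1.1, h2⟩
    have : (n : ℝ) ≤ i := by exact_mod_cast hi
    gcongr
  · rintro ⟨h1, h2⟩
    obtain ⟨h3, h4⟩ := (idx_eq_iff (c := c) hw k _ z.re).1 rfl
    refine ⟨idx w c k z.re, ?_, ⟨h3, h4.le⟩, h2⟩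
    have h5 : 2 ^ k * w * (2 * n - 1 : ℝ) < 2 ^ k * w * (2 * idx w c k z.re + 1) := by linarith
    have h6 := lt_of_mul_lt_mul_left h5 hpos.le
    have h7 : 2 * n - 1 < 2 * idx w c k z.re + 1 := by exact_mod_cast h6
    omega

theorem sUnion_left (hw : 0 < w) (k n : ℤ) : ⋃₀ (tile w A c k '' Iic n) =
    slIso A '' box (Iic (c k + 2 ^ k * w * (2 * n + 1))) (Icc (2 ^ k) (2 ^ (k + 1))) := by
  have hpos : (0 : ℝ) < 2 ^ k * w := by positivity
  rw [sUnion_tile_image]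
  congr 1
  ext z
  simp only [mem_iUnion, mem_Iic, exists_prop, mem_cell_iff, mem_box, mem_Icc]
  constructor
  · rintro ⟨i, hi, h1, h2⟩
    refine ⟨le_trans h1.2 ?_, h2⟩
    have : (i : ℝ) ≤ n := by exact_mod_cast hi
    gcongr
  · rintro ⟨h1, h2⟩
    obtain ⟨h3, h4⟩ := (idx_eq_iff (c := c) hw k _ z.re).1 rfl
    -- On the right end of the region `idx` already gives `n + 1`, but the closed tile `n` still
    -- contains the point.
    by_cases hn : idx w c k z.re ≤ n
    · exact ⟨_, hn, ⟨h3, h4.le⟩, h2⟩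
    · refine ⟨n, le_rfl, ⟨?_, h1⟩, h2⟩
      refine le_trans ?_ h3
      have : (n : ℝ) ≤ idx w c k z.re := by exact_mod_cast (not_le.1 hn).le
      gcongr

theorem IsFrame.exists_of_isRingBlock (F : IsFrame w 𝒯 A c σ) {k : ℕ} (hk : 1 ≤ k)
    {S : Set (Set UpperHalfPlane)} (hS : IsRingBlock w 𝒯 k S) :
    ∃ j, S = ⋃ i : Fin k, range (tile w A c (j + (i : ℕ))) := by
  obtain ⟨R, hR, hdown, rfl⟩ := hS
  choose K hK using fun i => (F.isRing_iff _).1 (hR i)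
  refine ⟨K ⟨0, hk⟩, ?_⟩
  have key : ∀ (i : ℕ) (hi : i < k), K ⟨i, hi⟩ = K ⟨0, hk⟩ + i := by
    intro i hi
    induction i with
    | zero => simp
    | succ i ih =>
      obtain ⟨T, hT, T', hT', h⟩ := hdown ⟨i, by omega⟩ ⟨i + 1, hi⟩ rfl
      rw [hK] at hT hT'
      obtain ⟨n, rfl⟩ := hT
      obtain ⟨n', rfl⟩ := hT'
      rw [((F.down_iff _ _ _ _).1 h).1, ih]
      push_cast
      ring
  congr 1
  funext i
  rw [hK, ← key i i.2]

theorem IsFrame.isRingBlock (F : IsFrame w 𝒯 A c σ) (k : ℕ) (j : ℤ) :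
    IsRingBlock w 𝒯 k (⋃ i : Fin k, range (tile w A c (j + (i : ℕ)))) := by
  refine ⟨fun i => range (tile w A c (j + (i : ℕ))), fun i => (F.isRing_iff _).2 ⟨_, rfl⟩, ?_, rfl⟩
  intro i i' h
  refine ⟨tile w A c (j + (i : ℕ)) (idx w c (j + (i : ℕ)) 0), mem_range_self _,
    tile w A c (j + (i' : ℕ)) (idx w c (j + (i' : ℕ)) 0), mem_range_self _, ?_⟩
  have h1 : j + ((i' : ℕ) : ℤ) = j + ((i : ℕ) : ℤ) + 1 := by
    rw [h]
    push_cast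
    ring
  rw [F.down_iff, h1]
  exact ⟨rfl, F.idx_step _ 0⟩

theorem sUnion_block (hw : 0 < w) {k : ℕ} (hk : 1 ≤ k) (j : ℤ) :
    ⋃₀ (⋃ i : Fin k, range (tile w A c (j + (i : ℕ)))) =
      slIso A '' box univ (Icc (2 ^ j) (2 ^ (j + k))) := by
  rw [sUnion_iUnion]
  simp only [sUnion_level hw]
  rw [← image_iUnion]
  congr 1
  ext z
  simp only [mem_iUnion, mem_box, mem_univ, true_and, mem_Icc]
  constructor
  · rintro ⟨i, h1, h2⟩
    have hi := i.2
    refine ⟨le_trans ?_ h1, h2.trans ?_⟩ <;> refine zpow_le_zpow_right₀ one_le_two ?_ <;> omega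
  · rintro ⟨h1, h2⟩
    obtain ⟨N, hN1, hN2⟩ := exists_mem_Ico_zpow z.im_pos (one_lt_two (α := ℝ))
    have h3 := (zpow_lt_zpow_iff_right₀ one_lt_two).1 (h1.trans_lt hN2)
    by_cases hN : N < j + k
    · refine ⟨⟨(N - j).toNat, by omega⟩, ?_⟩
      have : j + (((N - j).toNat : ℕ) : ℤ) = N := by omega
      simp only [this]
      exact ⟨hN1, hN2.le⟩
    -- The remaining case is the top height `2 ^ (j + k)`, which belongs to the last ring.
    · refine ⟨⟨k - 1, by omega⟩, ?_⟩
      have : j + ((k - 1 : ℕ) : ℤ) = j + k - 1 := by omega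
      simp only [this, sub_add_cancel]
      refine ⟨le_trans ?_ hN1, h2⟩
      refine zpow_le_zpow_right₀ one_le_two ?_
      omega

/-! ### The fundamental domains -/

/-- A symmetry controls `σ` only eventually, but periodicity of `s` extends the relation to all
indices. Inversion reduces negative `m` to positive `m`. -/
theorem IsFrame.dvd_shift (F : IsFrame w 𝒯 A c σ) (hno : ∀ v, ¬ IsWall w c v) {s : ℕ → ℤˣ}
    (hsσ : ∀ i : ℕ, s i = σ i) (hs : IsPeriodic s) {ε : ℤˣ} {m : ℤ} {b : ℝ}
    (h : IsCompatible w c ε m b) : (essentialPeriod s : ℤ) ∣ m := by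
  have key : ∀ (m : ℕ) (b : ℝ), IsCompatible w c ε m b → (essentialPeriod s : ℤ) ∣ m := by
    intro m b h
    obtain ⟨K, hK0, hK⟩ := F.eventually_shift hno h
    lift K to ℕ using hK0
    rw [Int.natCast_dvd_natCast]
    refine hs.essentialPeriod_dvd (hs.isSignedPeriod_of_eventually (K := K) (ε := ε) fun i hi => ?_)
    have := hK i (by omega)
    rw [hsσ, hsσ, ← this]
    push_cast
    rw [add_comm]
  obtain ⟨n, rfl | rfl⟩ := Int.eq_nat_or_neg m
  · exact key n b h
  · have h1 := h.inv
    rw [neg_neg] at h1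
    rw [dvd_neg]
    exact key n _ h1

theorem IsFrame.exists_isCompatible (F : IsFrame w 𝒯 A c σ) {s : ℕ → ℤˣ}
    (hsσ : ∀ i : ℕ, s i = σ i) (hs : IsPeriodic s) (q : ℤ) :
    ∃ ε b, IsCompatible w c ε (essentialPeriod s * q) b := by
  have key : ∀ n : ℕ, ∃ ε b, IsCompatible w c ε (essentialPeriod s * n) b := by
    intro n
    obtain ⟨ε, hε⟩ := hs.isSignedPeriod_essentialPeriod.mul n
    refine ⟨ε, _, F.isCompatible_of_shift fun k hk => ?_⟩
    lift k to ℕ using hk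
    have := hε k
    rw [hsσ, hsσ] at this
    rw [← this, add_comm]
    push_cast
    rfl
  obtain ⟨n, rfl | rfl⟩ := Int.eq_nat_or_neg q
  · exact key n
  · obtain ⟨ε, b, h⟩ := key n
    have h' := h.inv
    rw [← mul_neg (essentialPeriod s : ℤ) (n : ℤ)] at h'
    exact ⟨ε, _, h'⟩

theorem IsFrame.isFundDomain_strip (F : IsFrame w 𝒯 A c σ) (hno : ∀ v, ¬ IsWall w c v)
    {s : ℕ → ℤˣ} (hsσ : ∀ i : ℕ, s i = σ i) (hs : IsPeriodic s) (j : ℤ) :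
    IsFundDomain (symGroup 𝒯)
      (slIso A '' box univ (Icc (2 ^ j) (2 ^ (j + (essentialPeriod s : ℤ))))) := by
  have he := hs.one_le_essentialPeriod
  have hdvd := fun ε m b => F.dvd_shift hno hsσ hs (ε := ε) (m := m) (b := b)
  have hex := F.exists_isCompatible hsσ hs
  generalize essentialPeriod s = e at he hdvd hex ⊢
  refine F.isFundDomain_box (by simp) (closure_Ioo_zpow_inter (by omega))
    (by rw [interior_univ]; exact isConnected_univ) (isConnected_interior_Icc_zpow (by omega)) ?_ ?_
  · intro z
    obtain ⟨N, hN1, hN2⟩ := exists_mem_Ico_zpow z.im_pos (one_lt_two (α := ℝ))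
    obtain ⟨ε, b, h⟩ := hex (-((N - j) / e))
    -- This shift takes level `N` to level `j + (N - j) % e`, which lies in the strip.
    refine ⟨ε, _, b, h, mem_univ _, ?_⟩
    have hdiv := Int.emod_add_mul_ediv (N - j) e
    have hmod1 := Int.emod_nonneg (N - j) (show (e : ℤ) ≠ 0 by omega)
    have hmod2 := Int.emod_lt_of_pos (N - j) (show (0 : ℤ) < e by omega)
    rw [mul_neg]
    generalize (e : ℤ) * ((N - j) / e) = d at *
    rw [sim_im]
    constructor
    · calc (2 : ℝ) ^ j ≤ 2 ^ (-d + N) := zpow_le_zpow_right₀ one_le_two (by omega)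
        _ = 2 ^ (-d) * 2 ^ N := zpow_add₀ (two_ne_zero' ℝ) _ _
        _ ≤ _ := by gcongr
    · calc _ ≤ (2 : ℝ) ^ (-d) * 2 ^ (N + 1) := by gcongr
        _ = 2 ^ (-d + (N + 1)) := (zpow_add₀ (two_ne_zero' ℝ) _ _).symm
        _ ≤ 2 ^ (j + (e : ℤ)) := zpow_le_zpow_right₀ one_le_two (by omega)
  · intro ε m b h hne z hz hz'
    rw [mem_box, interior_Icc] at hz hz'
    have hm := strip_disjoint hz.2.1 hz.2.2 hz'.2.1 hz'.2.2
    obtain ⟨q, rfl⟩ := hdvd ε m b h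
    have hq : q = 0 := by
      have h1 : -1 < q := by
        by_contra! h
        nlinarith [hm.1]
      have h2 : q < 1 := by
        by_contra! h
        nlinarith [hm.2]
      omega
    subst hq
    rw [mul_zero] at h hne
    exact hne (F.sim_eq_one_of_no_wall hno h)

theorem IsFrame.isFundDomain_univ (F : IsFrame w 𝒯 A c σ) (hno : ∀ v, ¬ IsWall w c v)
    (hper : ∀ K, ¬ IsPeriodic fun i : ℕ => σ (K + i)) : IsFundDomain (symGroup 𝒯) univ := by
  have key : ∀ (ε : ℤˣ) (m : ℕ) (b : ℝ), IsCompatible w c ε m b → m = 0 := by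
    intro ε m b h
    by_contra hm
    obtain ⟨K, -, hK⟩ := F.eventually_shift hno h
    refine hper K ⟨2 * m, by omega, fun i => ?_⟩
    have h1 : K + ((i + 2 * m : ℕ) : ℤ) = m + (m + (K + i)) := by
      push_cast
      ring
    dsimp only
    -- Two shifts by `m` square the global sign away, so the tail from level `K` has period `2 * m`.
    rw [h1, hK _ (by omega), hK _ (by omega), ← mul_assoc, Int.units_mul_self, one_mul]
  have hbox : slIso A '' box univ (Ioi 0) = univ := by
    have : box univ (Ioi 0) = univ := eq_univ_of_forall fun z => ⟨mem_univ _, z.im_pos⟩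
    rw [this, image_univ]
    exact (slIso A).surjective.range_eq
  rw [← hbox]
  refine F.isFundDomain_box (by simp) ?_ (by rw [interior_univ]; exact isConnected_univ)
    (by rw [interior_Ioi]; exact isConnected_Ioi) ?_ ?_
  · rw [interior_Ioi, closure_Ioi]
    exact inter_eq_right.2 Ioi_subset_Ici_self
  · intro z
    exact ⟨1, 0, 0, isCompatible_one, mem_univ _, UpperHalfPlane.im_pos _⟩
  · intro ε m b h hne
    have hm : m = 0 := by
      obtain ⟨n, rfl | rfl⟩ := Int.eq_nat_or_neg m
      · rw [key ε n b h]
        rfl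
      · have h1 := h.inv
        rw [neg_neg] at h1
        rw [key ε n _ h1]
        rfl
    subst hm
    exact (hne (F.sim_eq_one_of_no_wall hno h)).elim

theorem IsFrame.level_inter_pool (F : IsFrame w 𝒯 A c σ) {v : ℝ} (hv : IsWall w c v) (k : ℤ)
    {P : Set (Set UpperHalfPlane)} (hP : P ∈ pools w 𝒯) :
    IsHalfRing w 𝒯 (range (tile w A c k) ∩ P) ∧
      IsFundDomain (symGroup 𝒯) (⋃₀ (range (tile w A c k) ∩ P)) := by
  have hw := F.pos
  rw [F.pools_eq_of_wall hv] at hP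
  obtain ⟨p, hp⟩ := hv k
  have hpos : (0 : ℝ) < 2 ^ k * w := by positivity
  -- On level `k` the wall is the common boundary of the tiles `p` and `p + 1`.
  have key : ∀ n : ℤ, v < c k + 2 ^ k * (2 * w) * n ↔ p + 1 ≤ n := by
    intro n
    rw [hp, show (2 : ℝ) ^ k * (2 * w) * n = 2 ^ k * w * (2 * n) by ring, add_lt_add_iff_left,
      mul_lt_mul_iff_right₀ hpos]
    have : (2 * p + 1 : ℝ) < 2 * n ↔ 2 * p + 1 < 2 * n := by exact_mod_cast Iff.rfl
    rw [this]
    omega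
  rcases hP with rfl | rfl
  · have h1 : range (tile w A c k) ∩ rightSide w A c v = tile w A c k '' Ici (p + 1) := by
      ext T
      constructor
      · rintro ⟨⟨n, rfl⟩, h⟩
        exact ⟨n, (key n).1 ((tile_mem_rightSide hw).1 h), rfl⟩
      · rintro ⟨n, hn, rfl⟩
        exact ⟨⟨n, rfl⟩, (tile_mem_rightSide hw).2 ((key n).2 hn)⟩
    rw [h1, sUnion_right hw]
    refine ⟨F.isHalfRing_right _ _, F.isFundDomain_half_strip hv k (Or.inl ?_)⟩
    rw [hp]
    push_cast
    congr 3
    ring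
  · have h1 : range (tile w A c k) ∩ leftSide w A c v = tile w A c k '' Iic p := by
      ext T
      constructor
      · rintro ⟨⟨n, rfl⟩, h⟩
        refine ⟨n, ?_, rfl⟩
        have := (tile_mem_leftSide hw).1 h
        rw [key] at this
        rw [mem_Iic]
        omega
      · rintro ⟨n, hn, rfl⟩
        refine ⟨⟨n, rfl⟩, (tile_mem_leftSide hw).2 ?_⟩
        rw [key]
        rw [mem_Iic] at hn
        omega
    rw [h1, sUnion_left hw]
    exact ⟨F.isHalfRing_left _ _, F.isFundDomain_half_strip hv k (Or.inr (by rw [hp]))⟩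

end Frame

/-! ### Assembly of the three cases -/

theorem IsBTiling.nonempty {w : ℝ} {𝒯 : Set (Set UpperHalfPlane)} (h𝒯 : IsBTiling w 𝒯) :
    ∃ T, T ∈ 𝒯 := by
  have h : UpperHalfPlane.I ∈ ⋃₀ 𝒯 := by
    rw [h𝒯.cover]
    trivial
  obtain ⟨T, hT, -⟩ := h
  exact ⟨T, hT⟩

end Boroczky

end

theorem mainTheorem8 (w : ℝ) (hw : 0 < w) (𝒯 : Set (Set UpperHalfPlane))
    (h𝒯 : Boroczky.IsBTiling w 𝒯) :
    -- two pools: a half ring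
    ((Boroczky.pools w 𝒯).ncard = 2 →
      (∃ H, Boroczky.IsHalfRing w 𝒯 H ∧
        Boroczky.IsFundDomain (Boroczky.symGroup 𝒯) (⋃₀ H)) ∧
      ∀ R, Boroczky.IsRing w 𝒯 R → ∀ P ∈ Boroczky.pools w 𝒯,
        Boroczky.IsHalfRing w 𝒯 (R ∩ P) ∧
        Boroczky.IsFundDomain (Boroczky.symGroup 𝒯) (⋃₀ (R ∩ P))) ∧
    -- one pool and a periodic tail sequence: the union of `k` consecutive rings
    ((Boroczky.pools w 𝒯).ncard = 1 →
      ∀ T ∈ 𝒯, ∀ s, Boroczky.IsTailSeq w 𝒯 T s → Boroczky.IsPeriodic s →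
        (∃ S, Boroczky.IsRingBlock w 𝒯 (Boroczky.essentialPeriod s) S ∧
          Boroczky.IsFundDomain (Boroczky.symGroup 𝒯) (⋃₀ S)) ∧
        ∀ S, Boroczky.IsRingBlock w 𝒯 (Boroczky.essentialPeriod s) S →
          Boroczky.IsFundDomain (Boroczky.symGroup 𝒯) (⋃₀ S)) ∧
    -- otherwise: the whole plane
    (¬ (Boroczky.pools w 𝒯).ncard = 2 →
      ¬ ((Boroczky.pools w 𝒯).ncard = 1 ∧
        ∃ T ∈ 𝒯, ∃ s, Boroczky.IsTailSeq w 𝒯 T s ∧ Boroczky.IsPeriodic s) →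
      Boroczky.IsFundDomain (Boroczky.symGroup 𝒯) univ) := by
  refine ⟨fun h2 => ?_, fun h1 T hT s hTs hs => ?_, fun h2 h1 => ?_⟩
  · obtain ⟨T, hT⟩ := h𝒯.nonempty
    obtain ⟨A, c, σ, F, -⟩ := h𝒯.exists_frame hw hT
    obtain ⟨v, hv⟩ : ∃ v, Boroczky.IsWall w c v := by
      by_contra! hno
      rw [F.ncard_pools_of_no_wall hno] at h2
      exact absurd h2 (by norm_num)
    have hR : ∀ R, Boroczky.IsRing w 𝒯 R → ∀ P ∈ Boroczky.pools w 𝒯,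
        Boroczky.IsHalfRing w 𝒯 (R ∩ P) ∧
        Boroczky.IsFundDomain (Boroczky.symGroup 𝒯) (⋃₀ (R ∩ P)) := by
      intro R hR P hP
      obtain ⟨k, rfl⟩ := (F.isRing_iff R).1 hR
      exact F.level_inter_pool hv k hP
    refine ⟨⟨_, hR _ ((F.isRing_iff _).2 ⟨0, rfl⟩) (Boroczky.rightSide w A c v) ?_⟩, hR⟩
    rw [F.pools_eq_of_wall hv]
    exact Or.inl rfl
  -- The frame is based at the tile with the periodic tail, so that `s` is `σ` restricted to the
  -- levels `k ≥ 0`.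
  · obtain ⟨A, c, σ, F, rfl⟩ := h𝒯.exists_frame hw hT
    have hno : ∀ v, ¬ Boroczky.IsWall w c v := by
      intro v hv
      rw [F.ncard_pools_of_wall hv] at h1
      exact absurd h1 (by norm_num)
    have he := hs.one_le_essentialPeriod
    have hS : ∀ j : ℤ, Boroczky.IsFundDomain (Boroczky.symGroup 𝒯)
        (⋃₀ (⋃ i : Fin (Boroczky.essentialPeriod s),
          range (Boroczky.tile w A c (j + (i : ℕ))))) := by
      intro j
      rw [Boroczky.sUnion_block hw he]
      exact F.isFundDomain_strip hno (F.tailSeq_eq hTs) hs j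
    refine ⟨⟨_, F.isRingBlock _ 0, hS 0⟩, fun S hS' => ?_⟩
    obtain ⟨j, rfl⟩ := F.exists_of_isRingBlock he hS'
    exact hS j
  · obtain ⟨T, hT⟩ := h𝒯.nonempty
    obtain ⟨A, c, σ, F, -⟩ := h𝒯.exists_frame hw hT
    have hno : ∀ v, ¬ Boroczky.IsWall w c v := fun v hv => h2 (F.ncard_pools_of_wall hv)
    -- A periodic tail at any level `K` would be the tail of the tile `(K, 0)` and lead back to the
    -- second case.
    refine F.isFundDomain_univ hno fun K hK => h1 ⟨F.ncard_pools_of_no_wall hno, ?_⟩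
    exact ⟨_, F.tile_mem K 0, _, F.isTailSeq K, hK⟩
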